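/- Let $1\le p\le q$ be integers and let $$f(z)=\sum_{j=0}^m H_j(z)e^{w_jz^q},$$ where $m\ge 0$, the leading coefficients $w_0,\dots,w_m\in\mathbb C$ are pairwise distinct, and each $H_j\not\equiv 0$ is an exponential polynomial of order at most $q-p$, that is, a finite sum $\sum_i P_ie^{Q_i}$ with polynomials $P_i,Q_i$ and $\deg Q_i\le q-p$. (One of the $w_j$ may be $0$.) Let $W_f=\{\overline w_0,\dots,\overline w_m\}$, let $\operatorname{co}(W_f)$ be its convex hull, and let $C(\operatorname{co}(W_f))$ be its circumference (the sum of the lengths of the sides; $0$ for a point, and twice the length for a segment, which has two sides with opposite outer normals). For a finite set $W\subset\mathbb C$, a real number $\theta^*$ is called a critical angle of $W$ if $\max_{w\in W}\operatorname{Re}(we^{iq\theta^*})$ is attained by two distinct elements of $W$. The critical angles of $f$ are those of $\{w_0,\dots,w_m\}$, and the rays $\arg z=\theta^*$ with $\theta^*$ a critical angle of $f$ are the critical rays of $f$. For real $\theta^*$ and $c>0$ let $$\Lambda_p(\theta^*,c)=\left\{re^{i\theta}: r>1,\ |\theta-\theta^*|<c\,\frac{\log r}{r^p}\right\}.$$ All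 zeros and $a$-points are counted with multiplicities, and $O$ refers to $r\to\infty$. There is a constant $c_0>0$ such that (1) and (2) hold for every $c\ge c_0$. (1) The number of zeros of $f$ in $|z|<r$ outside the union of the domains $\Lambda_p(\theta^*,c)$, $\theta^*$ a critical angle of $f$, is $O(r^{q-p}+\log r)$. (2) Let $\overline w_j,\overline w_k$ be two consecutive vertices of $\operatorname{co}(W_f)$, let $\theta_0^\bot$ be an argument of the outer normal of $\operatorname{co}(W_f)$ at the side $[\overline w_j,\overline w_k]$, let $n\in\mathbb Z$ and $\theta^*=(\theta_0^\bot+2\pi n)/q$. Then for every $\varepsilon>0$ the number of zeros of $f$ in $\Lambda_p(\theta^*,c)\cap\{|z|<r\}$ is $$|w_j-w_k|\frac{r^q}{2\pi}+O\left(r^{q-p}\log^{3+\varepsilon}r\right).$$ Moreover: (3) For every $\varepsilon>0$ the number of zeros of $f$ in $|z|<r$ is $$n(r,1/f)=qC(\operatorname{co}(W_f))\frac{r^q}{2\pi}+O\left(r^{q-p}\log^{3+\varepsilon}r\right).$$ (4) A ray $\arg z=\theta$ is called a Borel direction of order $q$ of $f$ if for every $\varepsilon>0$ and all $a\in\mathbb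 C\cup\{\infty\}$ with at most two exceptions, the number $n(r)$ of $a$-points of $f$ in $\{|z|<r,\ |\arg z-\theta|<\varepsilon\}$ satisfies $\limsup_{r\to\infty}\log n(r)/\log r=q$. The Borel directions of order $q$ of $f$ are exactly the rays $\arg z=\theta$ with $\theta$ a critical angle of $\{0,w_0,\dots,w_m\}$. In particular, if $0\in\operatorname{co}(W_f)$, they are exactly the critical rays of $f$. -/

import Mathlib

open Complex Set Filter Asymptotics Topology

noncomputable section

/-- `g` is an exponential polynomial of order at most `d`: a finite sum `∑ P_j e^{Q_j}` with
polynomials `P_j`, `Q_j` such that `deg Q_j ≤ d` for all `j`. For `d = 0` these are the polynomials.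
(Merging equal exponents and absorbing the constants `e^{Q_j(0)}` into the `P_j` never raises
a degree, so it is not necessary to ask for pairwise distinct `Q_j` with `Q_j(0) = 0`.) -/
def IsExpPolyOfOrderLE (d : ℕ) (g : ℂ → ℂ) : Prop :=
  ∃ (n : ℕ) (P Q : Fin n → Polynomial ℂ), (∀ j, (Q j).natDegree ≤ d) ∧
    ∀ z, g z = ∑ j, (P j).eval z * exp ((Q j).eval z)

/-- The function `f(z) = ∑_j H_j(z) e^{w_j z^q}`. -/
def normalForm (q : ℕ) {m : ℕ} (w : Fin (m + 1) → ℂ) (H : Fin (m + 1) → ℂ → ℂ) : ℂ → ℂ :=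
  fun z => ∑ j, H j z * exp (w j * z ^ q)

/-- The set `W_f` of conjugated leading coefficients. -/
def conjLeading {m : ℕ} (w : Fin (m + 1) → ℂ) : Set ℂ :=
  range fun j => (starRingEnd ℂ) (w j)

/-- For a finite set `W` of leading coefficients, `θ` is a critical angle when the maximum over
`w ∈ W` of `Re (w e^{iqθ})` is attained by two distinct elements of `W`. -/
def IsCriticalAngle (q : ℕ) (W : Set ℂ) (θ : ℝ) : Prop :=
  ∃ a ∈ W, ∃ b ∈ W, a ≠ b ∧
    (a * exp (q * θ * I)).re = (b * exp (q * θ * I)).re ∧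
    ∀ v ∈ W, (v * exp (q * θ * I)).re ≤ (a * exp (q * θ * I)).re

/-- `[a, b]` is a side of the polygon `co G`, traversed counterclockwise from `a` to `b`: the points
`a ≠ b` are vertices of `co G`, and `co G` lies to the left of the line directed from `a` to `b`.
When `co G` is a nondegenerate segment with end points `a`, `b`, both `(a, b)` and `(b, a)` are
sides, with opposite outer normals. -/
def IsSide (G : Set ℂ) (a b : ℂ) : Prop :=
  a ≠ b ∧ a ∈ extremePoints ℝ (convexHull ℝ G) ∧ b ∈ extremePoints ℝ (convexHull ℝ G) ∧
    ∀ x ∈ convexHull ℝ G, 0 ≤ ((starRingEnd ℂ) (b - a) * (x - a)).im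

/-- `φ` is an argument of the outer normal of a counterclockwise side from `a` to `b`, that is,
of the direction of `b - a` turned by `-π/2`. -/
def IsOuterNormalArg (a b : ℂ) (φ : ℝ) : Prop :=
  b - a = (‖b - a‖ : ℂ) * (I * exp (φ * I))

/-- The circumference of `co G` for a finite set `G`: the sum of the lengths of the sides. It is
`0` when `co G` is a point and twice the length when `co G` is a segment. -/
def circumference (G : Set ℂ) : ℝ :=
  ∑ᶠ e ∈ {e : ℂ × ℂ | IsSide G e.1 e.2}, ‖e.2 - e.1‖

/-- The modified logarithmic strip `Λ_p(φ, c)` around the ray `arg z = φ`. -/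
def logStrip (p : ℕ) (φ c : ℝ) : Set ℂ :=
  {z | ∃ r θ : ℝ, 1 < r ∧ |θ - φ| < c * Real.log r / r ^ p ∧ z = r * exp (θ * I)}

/-- The open angle of half-opening `ε` around the ray `arg z = φ`. -/
def openAngle (φ ε : ℝ) : Set ℂ :=
  {z | ∃ r θ : ℝ, 0 < r ∧ |θ - φ| < ε ∧ z = r * exp (θ * I)}

/-- The number of zeros of `g` in `S ∩ {|z| < r}`, counted with multiplicities. It is used for
entire functions `g` that do not vanish identically, for which the sum is finite. -/
def zeroCount (g : ℂ → ℂ) (S : Set ℂ) (r : ℝ) : ℕ :=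
  ∑ᶠ z ∈ S ∩ Metric.ball 0 r, analyticOrderNatAt g z

/-- The number of `a`-points in `S ∩ {|z| < r}` of an entire function `g`, for `a` in the Riemann
sphere, counted with multiplicities. An entire function has no poles. -/
def pointCount (g : ℂ → ℂ) (S : Set ℂ) (r : ℝ) : OnePoint ℂ → ℕ
  | none => 0
  | some a => zeroCount (fun z => g z - a) S r

/-- The ray `arg z = φ` is a Borel direction of order `ρ` of the entire function `g`: for every
`ε > 0`, the number `n(r)` of `a`-points of `g` in `{|z| < r, |arg z - φ| < ε}` satisfies
`limsup_{r → ∞} log n(r) / log r = ρ` for all `a` in the Riemann sphere with at most two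
exceptions. -/
def IsBorelDirection (g : ℂ → ℂ) (ρ φ : ℝ) : Prop :=
  ∀ ε > 0, {a : OnePoint ℂ |
    ¬ limsup (fun r : ℝ =>
        ((Real.log (pointCount g (openAngle φ ε) r a) / Real.log r : ℝ) : EReal)) atTop
      = (ρ : EReal)}.encard ≤ 2

end

noncomputable section

/-! Put z = e^s with s = x + iy, and d = q - p. Then f becomes F(s) = Σ h_v(s) exp(w_v e^{qs}) with
h_v(s) = H_v(e^s). The v-th exponential has modulus exp(e^{qx} Re(w_v e^{iqy})), whereas log |h_v|
is at most O(x e^{dx}) and, away from the few zeros of h_v, at least -O(x e^{dx}). Hence one term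
swamps the others as soon as its Re(w_v e^{iqy}) leads by a large multiple of x e^{-px}. Next to a
critical angle θ* the lead grows linearly in |y - θ*|, so domination can fail only for |y - θ*| < c
x e^{-px}: this is the strip Λ_p seen in the logarithmic plane.

Outside the strips, Rouché's theorem on boxes of bounded size compares F with the dominating
coefficient h_j, which has only O(e^{dx}) zeros there (`zerosIn_expSum_le_of_dominant`). That this
bound carries no extra factor x is due to the points of good local growth required in `Tame`.

Around a critical ray the argument principle is applied to a box (`exists_box_count`). Each vertical
side is cut at θ*; below it F is divided by exp(w_j e^{qs}), above it by exp(w_k e^{qs}), where j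
and k are the indices that dominate on the two sides. At θ* the two phases differ by exactly |w_j -
w_k| e^{qx}, and this is the main term. The argument of the quotients varies only by O(x e^{dx}):
close to the ray by a Jensen and Borel–Carathéodory argument in a disc of radius comparable to x
e^{-px} (`exists_local_factorization`), further away because the quotient follows h_j or h_k.
Summing about log r boxes leaves an error O(r^d log² r), which is better than claimed.

The total count is a matter of convex geometry. Re(w e^{iqθ}) is the inner product of the conjugate
of w with e^{iqθ}, so θ is critical exactly when qθ is an argument of an outer normal of the
polygon, and the dominating pair consists of the end points of the corresponding side. Each side
occurs for q angles in a period, which yields q times the circumference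
(`sum_critical_eq_circumference`).

For the Borel directions, f - a has the same form with 0 adjoined to the exponents, except for one
value of a (`exists_normalSum_sub_const`). Around a critical ray of the enlarged set the a-points
have order r^q; around any other ray there are only O(r^d + log r) of them, and d < q. -/

/-! ### Counting zeros with multiplicity, and dividing them out -/

/-- The number of zeros of `g` in `A`, counted with multiplicities. -/
def zerosIn (g : ℂ → ℂ) (A : Set ℂ) : ℕ := ∑ᶠ z ∈ A, analyticOrderNatAt g z

lemma zeroCount_eq_zerosIn (g : ℂ → ℂ) (S : Set ℂ) (r : ℝ) :
    zeroCount g S r = zerosIn g (S ∩ Metric.ball 0 r) := rfl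

lemma finite_zeros {g : ℂ → ℂ} (hg : Differentiable ℂ g) (h0 : g ≠ 0) {A : Set ℂ}
    (hA : Bornology.IsBounded A) : {z ∈ A | g z = 0}.Finite := by
  by_contra hinf
  have hinf : {z ∈ A | g z = 0}.Infinite := hinf
  obtain ⟨x, -, hx⟩ := hinf.exists_accPt_of_subset_isCompact (K := closure A)
    hA.isCompact_closure (fun z hz => subset_closure hz.1)
  have hfreq : ∃ᶠ z in 𝓝[≠] x, g z = 0 :=
    (accPt_iff_frequently_nhdsNE.1 hx).mono fun z hz => hz.2
  have := AnalyticOnNhd.eqOn_zero_of_preconnected_of_frequently_eq_zero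
    (fun z _ => hg.analyticAt z) isPreconnected_univ (mem_univ x) hfreq
  exact h0 (funext fun z => this (mem_univ z))

lemma analyticOrderAt_ne_top_of_entire {g : ℂ → ℂ} (hg : Differentiable ℂ g) (h0 : g ≠ 0)
    (z : ℂ) : analyticOrderAt g z ≠ ⊤ := by
  rwa [Ne, AnalyticOnNhd.analyticOrderAt_eq_top_iff_eq_zero z fun z => hg.analyticAt z]

lemma analyticOrderNatAt_pos {g : ℂ → ℂ} (hg : Differentiable ℂ g) (h0 : g ≠ 0) {z : ℂ}
    (h : g z = 0) : 0 < analyticOrderNatAt g z := by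
  rw [Nat.pos_iff_ne_zero]
  intro h'
  have h1 := Nat.cast_analyticOrderNatAt (analyticOrderAt_ne_top_of_entire hg h0 z)
  rw [h', Nat.cast_zero] at h1
  exact ((hg.analyticAt z).analyticOrderAt_ne_zero.2 h) h1.symm

lemma finite_inter_support {g : ℂ → ℂ} (hg : Differentiable ℂ g) (h0 : g ≠ 0) {A : Set ℂ}
    (hA : Bornology.IsBounded A) : (A ∩ Function.support (analyticOrderNatAt g)).Finite := by
  refine (finite_zeros hg h0 hA).subset fun z hz => ⟨hz.1, ?_⟩
  exact apply_eq_zero_of_analyticOrderNatAt_ne_zero hz.2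

/-- Only zeros contribute, so the inclusion is required of zeros alone. Boundedness of `B` keeps the
larger sum finite; a `finsum` with infinite support would be 0. -/
lemma zerosIn_mono {g : ℂ → ℂ} (hg : Differentiable ℂ g) (h0 : g ≠ 0) {A B : Set ℂ}
    (hB : Bornology.IsBounded B) (hAB : ∀ z ∈ A, g z = 0 → z ∈ B) : zerosIn g A ≤ zerosIn g B := by
  have hfin := finite_inter_support hg h0 hB
  have hsub : A ∩ Function.support (analyticOrderNatAt g) ⊆
      B ∩ Function.support (analyticOrderNatAt g) := fun z hz =>
    ⟨hAB z hz.1 (apply_eq_zero_of_analyticOrderNatAt_ne_zero hz.2), hz.2⟩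
  unfold zerosIn
  rw [← finsum_mem_inter_support, ← finsum_mem_inter_support (s := B),
    finsum_mem_eq_finite_toFinset_sum _ hfin,
    finsum_mem_eq_finite_toFinset_sum _ (hfin.subset hsub)]
  exact Finset.sum_le_sum_of_subset (by simpa using hsub)

lemma zerosIn_union_disjoint {g : ℂ → ℂ} (hg : Differentiable ℂ g) (h0 : g ≠ 0) {A B : Set ℂ}
    (hA : Bornology.IsBounded A) (hB : Bornology.IsBounded B) (hAB : Disjoint A B) :
    zerosIn g (A ∪ B) = zerosIn g A + zerosIn g B :=
  finsum_mem_union' hAB (finite_inter_support hg h0 hA) (finite_inter_support hg h0 hB)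

lemma zerosIn_union_le {g : ℂ → ℂ} (hg : Differentiable ℂ g) (h0 : g ≠ 0) {A B : Set ℂ}
    (hA : Bornology.IsBounded A) (hB : Bornology.IsBounded B) :
    zerosIn g (A ∪ B) ≤ zerosIn g A + zerosIn g B := by
  rw [← union_sdiff_self, zerosIn_union_disjoint hg h0 hA (hB.subset sdiff_subset)
    disjoint_sdiff_right]
  exact Nat.add_le_add_left (zerosIn_mono hg h0 hB fun z hz _ => hz.1) _

lemma zerosIn_biUnion_le {g : ℂ → ℂ} (hg : Differentiable ℂ g) (h0 : g ≠ 0) {ι : Type*}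
    (t : Finset ι) (A : ι → Set ℂ) (hA : ∀ i ∈ t, Bornology.IsBounded (A i)) :
    zerosIn g (⋃ i ∈ t, A i) ≤ ∑ i ∈ t, zerosIn g (A i) := by
  classical
  induction t using Finset.induction_on with
  | empty => simp [zerosIn]
  | insert a t ha ih =>
    rw [Finset.sum_insert ha, Finset.set_biUnion_insert]
    refine (zerosIn_union_le hg h0 (hA a (Finset.mem_insert_self a t)) ?_).trans
      (Nat.add_le_add_left (ih fun i hi => hA i (Finset.mem_insert_of_mem hi)) _)
    exact (Bornology.isBounded_biUnion_finset t).2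
      fun i hi => hA i (Finset.mem_insert_of_mem hi)

lemma zerosIn_biUnion_disjoint {g : ℂ → ℂ} (hg : Differentiable ℂ g) (h0 : g ≠ 0) {ι : Type*}
    (t : Finset ι) (A : ι → Set ℂ) (hA : ∀ i ∈ t, Bornology.IsBounded (A i))
    (hd : (t : Set ι).PairwiseDisjoint A) :
    zerosIn g (⋃ i ∈ t, A i) = ∑ i ∈ t, zerosIn g (A i) := by
  classical
  induction t using Finset.induction_on with
  | empty => simp [zerosIn]
  | insert a t ha ih =>
    rw [Finset.sum_insert ha, Finset.set_biUnion_insert, zerosIn_union_disjoint hg h0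
      (hA a (Finset.mem_insert_self a t)), ih fun i hi => hA i (Finset.mem_insert_of_mem hi)]
    · exact hd.subset (by simp)
    · exact (Bornology.isBounded_biUnion_finset t).2
        fun i hi => hA i (Finset.mem_insert_of_mem hi)
    · simp only [disjoint_iUnion_right]
      intro i hi
      refine hd (by simp) (by simp [hi]) ?_
      rintro rfl
      exact ha hi

lemma zerosIn_mul_exp (g e : ℂ → ℂ) (hg : Differentiable ℂ g) (he : Differentiable ℂ e)
    (A : Set ℂ) : zerosIn (fun z => g z * exp (e z)) A = zerosIn g A := by
  unfold zerosIn
  refine finsum_congr fun z => ?_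
  congr 1
  have h1 : AnalyticAt ℂ (fun z => exp (e z)) z := he.cexp.analyticAt z
  have h2 : analyticOrderAt (fun z => exp (e z)) z = 0 :=
    h1.analyticOrderAt_eq_zero.2 (exp_ne_zero _)
  have : analyticOrderAt (fun z => g z * exp (e z)) z = analyticOrderAt g z := by
    have := analyticOrderAt_mul (hg.analyticAt z) h1
    rw [h2, add_zero] at this
    exact this
  simp [analyticOrderNatAt, this]

lemma analyticOrderNatAt_comp_exp (g : ℂ → ℂ) (s : ℂ) :
    analyticOrderNatAt (fun s => g (exp s)) s = analyticOrderNatAt g (exp s) := by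
  have := analyticOrderAt_comp_of_deriv_ne_zero (f := g) (g := exp) (z₀ := s)
    (by fun_prop) (by simp)
  simp only [analyticOrderNatAt]
  rw [← this]; rfl

/-- The derivative of `exp` never vanishes, so multiplicities are preserved, and injectivity on `B`
prevents a zero from being counted twice. -/
lemma zerosIn_comp_exp (g : ℂ → ℂ) {B : Set ℂ} (hB : InjOn exp B) :
    zerosIn (fun s => g (exp s)) B = zerosIn g (exp '' B) := by
  unfold zerosIn
  rw [finsum_mem_image hB]
  exact finsum_congr fun s => by rw [analyticOrderNatAt_comp_exp]

/-- Division of an entire function by its zeros in a finite set. -/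
lemma exists_factorization {g : ℂ → ℂ} (hg : Differentiable ℂ g) (h0 : g ≠ 0) (Z : Finset ℂ) :
    ∃ G : ℂ → ℂ, Differentiable ℂ G ∧ (∀ a ∈ Z, G a ≠ 0) ∧
      (∀ s, g s = (∏ a ∈ Z, (s - a) ^ analyticOrderNatAt g a) * G s) ∧
      ∀ s ∉ Z, analyticOrderNatAt G s = analyticOrderNatAt g s := by
  classical
  induction Z using Finset.induction_on with
  | empty => exact ⟨g, hg, by simp, by simp, by simp⟩
  | insert a Z ha ih =>
    obtain ⟨G, hG, hGZ, hprod, hord⟩ := ih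
    have hG0 : G ≠ 0 := by
      rintro rfl
      exact h0 (funext fun s => by simp [hprod s])
    obtain ⟨φ, hφ, hφa, hev⟩ := ((hG.analyticAt a).analyticOrderNatAt_eq_iff
      (analyticOrderAt_ne_top_of_entire hG hG0 a)).1 (hord a ha)
    set n := analyticOrderNatAt g a with hn
    -- The quotient by `(s - a) ^ n`, with its removable singularity at `a` filled in by the local
    -- factor `φ`.
    let K : ℂ → ℂ := fun s => if s = a then φ a else G s / (s - a) ^ n
    have hK1 : ∀ s, G s = (s - a) ^ n * K s := by
      intro s
      by_cases hs : s = a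
      · subst hs
        simp only [K, if_true]
        simpa using hev.self_of_nhds
      · have : (s - a) ^ n ≠ 0 := pow_ne_zero _ (sub_ne_zero.2 hs)
        simp only [K, if_neg hs]
        field_simp
    have hKa : K =ᶠ[𝓝 a] φ := by
      filter_upwards [hev] with s hs
      by_cases hsa : s = a
      · subst hsa; simp [K]
      · have : (s - a) ^ n ≠ 0 := pow_ne_zero _ (sub_ne_zero.2 hsa)
        simp only [K, if_neg hsa, hs, smul_eq_mul]
        field_simp
    have hKd : Differentiable ℂ K := by
      intro s
      by_cases hsa : s = a
      · subst hsa
        exact (hφ.differentiableAt.congr_of_eventuallyEq hKa)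
      · have h1 : DifferentiableAt ℂ (fun s => G s / (s - a) ^ n) s := by
          refine (hG s).div (by fun_prop) (pow_ne_zero _ (sub_ne_zero.2 hsa))
        refine h1.congr_of_eventuallyEq ?_
        filter_upwards [isOpen_ne.mem_nhds hsa] with t ht
        simp only [K, if_neg ht]
    refine ⟨K, hKd, ?_, ?_, ?_⟩
    · intro b hb
      rcases Finset.mem_insert.1 hb with rfl | hb
      · simpa [K] using hφa
      · have := hGZ b hb
        rw [hK1] at this
        exact right_ne_zero_of_mul this
    · intro s
      rw [Finset.prod_insert ha, hprod s, hK1 s]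
      ring
    · intro s hs
      rw [Finset.mem_insert, not_or] at hs
      rw [← hord s hs.2]
      have h1 : AnalyticAt ℂ (fun s : ℂ => (s - a) ^ n) s := by fun_prop
      have h2 : analyticOrderAt (fun s : ℂ => (s - a) ^ n) s = 0 :=
        h1.analyticOrderAt_eq_zero.2 (pow_ne_zero _ (sub_ne_zero.2 hs.1))
      have h3 := analyticOrderAt_mul h1 (hKd.analyticAt s)
      rw [h2, zero_add] at h3
      have h4 : G = (fun s : ℂ => (s - a) ^ n) * K := funext hK1
      simp only [analyticOrderNatAt]
      rw [h4, h3]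


/-! ### Variation of the argument along segments -/

/-- The variation of the argument of `g` along the path `t ↦ a + t * e`, `t` from `t₀` to `t₁`. -/
def argVar (g : ℂ → ℂ) (a e : ℂ) (t₀ t₁ : ℝ) : ℝ :=
  ∫ t in t₀..t₁, (e * logDeriv g (a + t * e)).im

lemma continuousOn_argVar_integrand {g : ℂ → ℂ} (hg : Differentiable ℂ g) {a e : ℂ} {T : Set ℝ}
    (h : ∀ t ∈ T, g (a + t * e) ≠ 0) :
    ContinuousOn (fun t : ℝ => (e * logDeriv g (a + t * e)).im) T := by
  have hd : Continuous (deriv g) := (hg.contDiff (n := 1)).continuous_deriv le_rfl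
  have hc := hg.continuous
  unfold logDeriv
  simp only [Pi.div_apply]
  refine Complex.continuous_im.comp_continuousOn ?_
  refine continuousOn_const.mul (ContinuousOn.div (by fun_prop) (by fun_prop) h)

lemma intervalIntegrable_argVar {g : ℂ → ℂ} (hg : Differentiable ℂ g) {a e : ℂ} {t₀ t₁ : ℝ}
    (h : ∀ t ∈ uIcc t₀ t₁, g (a + t * e) ≠ 0) :
    IntervalIntegrable (fun t : ℝ => (e * logDeriv g (a + t * e)).im) MeasureTheory.volume t₀ t₁ :=
  (continuousOn_argVar_integrand hg h).intervalIntegrable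

lemma argVar_symm (g : ℂ → ℂ) (a e : ℂ) (t₀ t₁ : ℝ) : argVar g a e t₁ t₀ = -argVar g a e t₀ t₁ :=
  intervalIntegral.integral_symm _ _

lemma argVar_add {g : ℂ → ℂ} (hg : Differentiable ℂ g) {a e : ℂ} {t₀ t₁ t₂ : ℝ}
    (h₁ : ∀ t ∈ uIcc t₀ t₁, g (a + t * e) ≠ 0) (h₂ : ∀ t ∈ uIcc t₁ t₂, g (a + t * e) ≠ 0) :
    argVar g a e t₀ t₁ + argVar g a e t₁ t₂ = argVar g a e t₀ t₂ :=
  intervalIntegral.integral_add_adjacent_intervals (intervalIntegrable_argVar hg h₁)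
    (intervalIntegrable_argVar hg h₂)

lemma argVar_mul {g h : ℂ → ℂ} (hg : Differentiable ℂ g) (hh : Differentiable ℂ h) {a e : ℂ}
    {t₀ t₁ : ℝ} (hg0 : ∀ t ∈ uIcc t₀ t₁, g (a + t * e) ≠ 0)
    (hh0 : ∀ t ∈ uIcc t₀ t₁, h (a + t * e) ≠ 0) :
    argVar (fun s => g s * h s) a e t₀ t₁ = argVar g a e t₀ t₁ + argVar h a e t₀ t₁ := by
  unfold argVar
  rw [← intervalIntegral.integral_add (intervalIntegrable_argVar hg hg0)
    (intervalIntegrable_argVar hh hh0)]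
  refine intervalIntegral.integral_congr fun t ht => ?_
  rw [logDeriv_mul _ (hg0 t ht) (hh0 t ht) (hg _) (hh _), mul_add, add_im]

lemma argVar_prod_pow (Z : Finset ℂ) (m : ℂ → ℕ) {a e : ℂ} {t₀ t₁ : ℝ}
    (h : ∀ z ∈ Z, ∀ t ∈ uIcc t₀ t₁, a + t * e ≠ z) :
    argVar (fun s => ∏ z ∈ Z, (s - z) ^ m z) a e t₀ t₁ =
      ∑ z ∈ Z, m z * argVar (fun s => s - z) a e t₀ t₁ := by
  unfold argVar
  simp_rw [← intervalIntegral.integral_const_mul]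
  rw [← intervalIntegral.integral_finsetSum]
  · refine intervalIntegral.integral_congr fun t ht => ?_
    rw [logDeriv_prod (f := fun z s => (s - z) ^ m z) (fun z hz => pow_ne_zero _ (sub_ne_zero.2 (h z hz t ht)))
      (fun z _ => by fun_prop), Finset.mul_sum, im_sum]
    refine Finset.sum_congr rfl fun z _ => ?_
    rw [logDeriv_fun_pow (by fun_prop), mul_left_comm, ← ofReal_natCast, im_ofReal_mul]
  · intro z hz
    have hd : Differentiable ℂ fun s : ℂ => s - z := by fun_prop
    exact (intervalIntegrable_argVar hd
      (fun t ht => sub_ne_zero.2 (h z hz t ht))).const_mul (m z : ℝ)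

/-- Seen from `z`, a straight segment of any length subtends an angle of at most π; an arctangent
primitive makes this explicit. If `z` lies on the line of the path, the integrand vanishes
identically. -/
lemma abs_argVar_sub_const_le {z a e : ℂ} (he : e ≠ 0) (t₀ t₁ : ℝ) :
    |argVar (fun s => s - z) a e t₀ t₁| ≤ Real.pi := by
  set w := (a - z) / e with hw
  have key : ∀ t : ℝ, (e * logDeriv (fun s => s - z) (a + t * e)).im =
      -w.im / ((t + w.re) ^ 2 + w.im ^ 2) := by
    intro t
    have h1 : e * logDeriv (fun s => s - z) (a + t * e) = (t + w)⁻¹ := by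
      rw [logDeriv_apply]
      simp only [deriv_sub_const, deriv_id'']
      have : a + t * e - z = e * (t + w) := by rw [hw]; field_simp; ring
      rw [this]
      rw [mul_one_div, ← div_div, div_self he, one_div]
    rw [h1, inv_im, normSq_apply]
    simp
    ring_nf
  unfold argVar
  simp_rw [key]
  by_cases hq : w.im = 0
  · simp [hq, Real.pi_nonneg]
  · have hder : ∀ t ∈ uIcc t₀ t₁, HasDerivAt (fun t : ℝ => -Real.arctan ((t + w.re) / w.im))
        (-w.im / ((t + w.re) ^ 2 + w.im ^ 2)) t := by
      intro t _
      have h1 : HasDerivAt (fun t : ℝ => (t + w.re) / w.im) (1 / w.im) t :=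
        ((hasDerivAt_id t).add_const _).div_const _
      refine h1.arctan.neg.congr_deriv ?_
      have : 0 < w.im ^ 2 := by positivity
      have h2 : (t + w.re) ^ 2 + w.im ^ 2 ≠ 0 := by positivity
      have h3 : 1 + ((t + w.re) / w.im) ^ 2 = ((t + w.re) ^ 2 + w.im ^ 2) / w.im ^ 2 := by
        field_simp
        ring
      rw [h3]
      field_simp
    rw [intervalIntegral.integral_eq_sub_of_hasDerivAt hder]
    · have := Real.arctan_lt_pi_div_two ((t₀ + w.re) / w.im)
      have := Real.arctan_lt_pi_div_two ((t₁ + w.re) / w.im)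
      have := Real.neg_pi_div_two_lt_arctan ((t₀ + w.re) / w.im)
      have := Real.neg_pi_div_two_lt_arctan ((t₁ + w.re) / w.im)
      rw [abs_le]; constructor <;> linarith
    · refine Continuous.intervalIntegrable ?_ _ _
      refine Continuous.div (by fun_prop) (by fun_prop) fun t => ?_
      have : 0 < w.im ^ 2 := by positivity
      positivity

lemma abs_argVar_le {g : ℂ → ℂ} {a e : ℂ} {t₀ t₁ B : ℝ}
    (h : ∀ t ∈ uIcc t₀ t₁, ‖e * logDeriv g (a + t * e)‖ ≤ B) :
    |argVar g a e t₀ t₁| ≤ B * |t₁ - t₀| := by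
  unfold argVar
  rw [← Real.norm_eq_abs]
  refine intervalIntegral.norm_integral_le_of_norm_le_const fun t ht => ?_
  exact (Complex.abs_im_le_norm _).trans (h t (uIoc_subset_uIcc ht))

lemma argVar_exp {φ : ℂ → ℂ} (hφ : Differentiable ℂ φ) (a e : ℂ) (t₀ t₁ : ℝ) :
    argVar (fun s => exp (φ s)) a e t₀ t₁ = (φ (a + t₁ * e) - φ (a + t₀ * e)).im := by
  have hd : Continuous (deriv φ) := (hφ.contDiff (n := 1)).continuous_deriv le_rfl
  have key : ∀ t : ℝ, (e * logDeriv (fun s => exp (φ s)) (a + t * e)).im =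
      (e * deriv φ (a + t * e)).im := by
    intro t
    rw [logDeriv_apply, deriv_cexp (hφ _), mul_div_cancel_left₀ _ (exp_ne_zero _)]
  unfold argVar
  simp_rw [key]
  have hder : ∀ t ∈ uIcc t₀ t₁, HasDerivAt (fun t : ℝ => (φ (a + t * e)).im)
      (e * deriv φ (a + t * e)).im t := by
    intro t _
    have h1 : HasDerivAt (fun t : ℝ => a + (t : ℂ) * e) e t := by
      simpa using ((hasDerivAt_id t).ofReal_comp.mul_const e).const_add a
    have h2 := (hφ (a + t * e)).hasDerivAt.scomp t h1
    exact Complex.imCLM.hasFDerivAt.comp_hasDerivAt t h2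
  rw [intervalIntegral.integral_eq_sub_of_hasDerivAt hder
    (Continuous.intervalIntegrable (by fun_prop) _ _), sub_im]

/-- If `g / h` takes values in the right half plane on a segment, the variations of the arguments
of `g` and `h` differ by the change of `arg (g / h)`. -/
lemma argVar_eq_of_div_re_pos {g h : ℂ → ℂ} (hg : Differentiable ℂ g) (hh : Differentiable ℂ h)
    {a e : ℂ} {t₀ t₁ : ℝ} (hh0 : ∀ t ∈ uIcc t₀ t₁, h (a + t * e) ≠ 0)
    (hre : ∀ t ∈ uIcc t₀ t₁, 0 < (g (a + t * e) / h (a + t * e)).re) :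
    argVar g a e t₀ t₁ = argVar h a e t₀ t₁ + (arg (g (a + t₁ * e) / h (a + t₁ * e)) -
      arg (g (a + t₀ * e) / h (a + t₀ * e))) := by
  have hg0 : ∀ t ∈ uIcc t₀ t₁, g (a + t * e) ≠ 0 := by
    intro t ht h0
    have := hre t ht
    simp [h0] at this
  have hder : ∀ t ∈ uIcc t₀ t₁, HasDerivAt
      (fun t : ℝ => arg (g (a + t * e) / h (a + t * e)))
      ((e * logDeriv g (a + t * e)).im - (e * logDeriv h (a + t * e)).im) t := by
    intro t ht
    have h1 : HasDerivAt (fun t : ℝ => a + (t : ℂ) * e) e t := by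
      simpa using ((hasDerivAt_id t).ofReal_comp.mul_const e).const_add a
    have h2 : HasDerivAt (fun s => log (g s / h s))
        (logDeriv g (a + t * e) - logDeriv h (a + t * e)) (a + t * e) := by
      have := ((hg (a + t * e)).hasDerivAt.div (hh (a + t * e)).hasDerivAt (hh0 t ht)).clog
        (Or.inl (hre t ht))
      refine this.congr_deriv ?_
      have := hh0 t ht
      have := hg0 t ht
      rw [logDeriv_apply, logDeriv_apply, Pi.div_apply]
      field_simp
    have h3 := Complex.imCLM.hasFDerivAt.comp_hasDerivAt t (h2.scomp t h1)
    have h4 : HasDerivAt (fun t : ℝ => arg (g (a + t * e) / h (a + t * e)))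
        (e * (logDeriv g (a + t * e) - logDeriv h (a + t * e))).im t := by
      simpa only [Function.comp_def, imCLM_apply, log_im, smul_eq_mul] using h3
    rwa [mul_sub, sub_im] at h4
  have hint := intervalIntegral.integral_eq_sub_of_hasDerivAt hder
    ((intervalIntegrable_argVar hg hg0).sub (intervalIntegrable_argVar hh hh0))
  rw [intervalIntegral.integral_sub (intervalIntegrable_argVar hg hg0)
    (intervalIntegrable_argVar hh hh0)] at hint
  unfold argVar
  linarith

lemma re_pos_of_norm_sub_one_le {z : ℂ} (h : ‖z - 1‖ ≤ 1 / 2) : 0 < z.re := by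
  have := (abs_le.1 ((abs_re_le_norm _).trans h)).1
  simp at this
  linarith

/-- The argument of `g / h` starts and ends in (-π/2, π/2), so it cannot change by more than π. -/
lemma abs_argVar_sub_argVar_le {g h : ℂ → ℂ} (hg : Differentiable ℂ g) (hh : Differentiable ℂ h)
    {a e : ℂ} {t₀ t₁ : ℝ} (hh0 : ∀ t ∈ uIcc t₀ t₁, h (a + t * e) ≠ 0)
    (hre : ∀ t ∈ uIcc t₀ t₁, 0 < (g (a + t * e) / h (a + t * e)).re) :
    |argVar g a e t₀ t₁ - argVar h a e t₀ t₁| ≤ Real.pi := by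
  rw [argVar_eq_of_div_re_pos hg hh hh0 hre, add_sub_cancel_left]
  have h0 := abs_arg_lt_pi_div_two_iff.2 (Or.inl (hre t₀ left_mem_uIcc))
  have h1 := abs_arg_lt_pi_div_two_iff.2 (Or.inl (hre t₁ right_mem_uIcc))
  rw [abs_lt] at h0 h1
  rw [abs_le]
  constructor <;> linarith


/-! ### Local consequences of growth: number of zeros, lower bounds, argument variation -/

/-- A zero-free entire function on a disc is controlled by its growth. -/
lemma zeroFree_bounds {G : ℂ → ℂ} (hG : Differentiable ℂ G) {c : ℂ} {ρ L : ℝ} (hρ : 0 < ρ)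
    (hL : 0 < L) (h0 : ∀ s ∈ Metric.ball c ρ, G s ≠ 0)
    (hM : ∀ s ∈ Metric.ball c ρ, ‖G s‖ ≤ Real.exp L * ‖G c‖) :
    (∀ s ∈ Metric.closedBall c (ρ / 2), Real.exp (-(2 * L)) * ‖G c‖ ≤ ‖G s‖) ∧
    ∀ s ∈ Metric.closedBall c (ρ / 4), ‖logDeriv G s‖ ≤ 8 * L / ρ := by
  have hdl : DifferentiableOn ℂ (logDeriv G) (Metric.ball c ρ) := by
    intro s hs
    have h1 : DifferentiableAt ℂ (deriv G) s :=
      (hG.analyticAt s).deriv.differentiableAt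
    exact (h1.div (hG s) (h0 s hs)).differentiableWithinAt
  -- `φ` is the branch of log (G / G c) that vanishes at `c`, and the growth hypothesis reads Re φ ≤
  -- L. Borel–Carathéodory gives |φ| ≤ 2L on the half disc, and Cauchy's estimate with radius ρ/4
  -- gives |φ'| ≤ 8L/ρ.
  obtain ⟨φ, hφc, hφ⟩ := hdl.isExactOn_ball.with_val_at c 0
  have hcb : c ∈ Metric.ball c ρ := Metric.mem_ball_self hρ
  have hGφ : ∀ s ∈ Metric.ball c ρ, G s = G c * exp (φ s) := by
    have hconst : ∀ s ∈ Metric.ball c ρ, G s * exp (-φ s) = G c * exp (-φ c) := by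
      intro s hs
      have hder : ∀ t ∈ Metric.ball c ρ, HasDerivAt (fun t => G t * exp (-φ t)) 0 t := by
        intro t ht
        have := (hG t).hasDerivAt.mul (hφ t ht).neg.cexp
        refine this.congr_deriv ?_
        rw [logDeriv_apply]
        have := h0 t ht
        field_simp
        ring
      refine Metric.isOpen_ball.is_const_of_deriv_eq_zero
        (convex_ball c ρ).isPreconnected
        (fun t ht => (hder t ht).differentiableAt.differentiableWithinAt)
        (fun t ht => (hder t ht).deriv) hs hcb
    intro s hs
    have := hconst s hs
    rw [hφc, neg_zero, exp_zero, mul_one] at this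
    rw [← this, mul_assoc, ← exp_add, neg_add_cancel, exp_zero, mul_one]
  have hGc : 0 < ‖G c‖ := norm_pos_iff.2 (h0 c hcb)
  have hre : ∀ s ∈ Metric.ball c ρ, (φ s).re ≤ L := by
    intro s hs
    have := hM s hs
    rw [hGφ s hs, norm_mul, norm_exp, mul_comm] at this
    exact Real.exp_le_exp.1 (le_of_mul_le_mul_right this hGc)
  have hbc : ∀ s ∈ Metric.closedBall c (ρ / 2), ‖φ s‖ ≤ 2 * L := by
    intro s hs
    rw [Metric.mem_closedBall, dist_eq] at hs
    have hmem : ∀ z ∈ Metric.ball (0 : ℂ) ρ, c + z ∈ Metric.ball c ρ := by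
      intro z hz; simpa [dist_eq] using hz
    have := borelCaratheodory_zero (f := fun z => φ (c + z)) (R := ρ) (z := s - c) hL
      (fun z hz => by
        have h1 : DifferentiableAt ℂ φ (c + z) := (hφ _ (hmem z hz)).differentiableAt
        exact (h1.comp z (by fun_prop)).differentiableWithinAt)
      (fun z hz => hre _ (hmem z hz)) hρ (by simp; linarith) (by simpa using hφc)
    simp only [add_sub_cancel] at this
    refine this.trans ?_
    rw [div_le_iff₀ (by linarith)]
    nlinarith
  constructor
  · intro s hs
    have hsb : s ∈ Metric.ball c ρ := Metric.closedBall_subset_ball (by linarith) hs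
    rw [hGφ s hsb, norm_mul, norm_exp, mul_comm]
    have := (abs_le.1 ((abs_re_le_norm _).trans (hbc s hs))).1
    gcongr
  · intro s hs
    have hsub : Metric.closedBall s (ρ / 4) ⊆ Metric.closedBall c (ρ / 2) := by
      refine Metric.closedBall_subset_closedBall' ?_
      rw [Metric.mem_closedBall] at hs
      linarith
    have hsub' : Metric.closedBall c (ρ / 2) ⊆ Metric.ball c ρ :=
      Metric.closedBall_subset_ball (by linarith)
    have hsb : s ∈ Metric.ball c ρ := hsub' (hsub (Metric.mem_closedBall_self (by linarith)))
    rw [← (hφ s hsb).deriv]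
    have := norm_deriv_le_of_forall_mem_sphere_norm_le (c := s) (R := ρ / 4) (f := φ) (C := 2 * L)
      (by linarith) ?_ (fun z hz => hbc z (hsub (Metric.sphere_subset_closedBall hz)))
    · refine this.trans (le_of_eq ?_)
      field_simp
      ring
    · refine DifferentiableOn.diffContOnCl (s := Metric.ball s (ρ / 4)) fun z hz => ?_
      have hz' := hsub' (hsub (Metric.closure_ball_subset_closedBall hz))
      exact (hφ z hz').differentiableAt.differentiableWithinAt

/-- The zeros of `g` in a disc divided out, with control of the quotient. -/
theorem exists_local_factorization {g : ℂ → ℂ} (hg : Differentiable ℂ g) {c : ℂ} {R L : ℝ}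
    (hR : 0 < R) (hL : 0 < L) (hgc : g c ≠ 0)
    (hM : ∀ s ∈ Metric.closedBall c R, ‖g s‖ ≤ Real.exp L * ‖g c‖) :
    ∃ (Z : Finset ℂ) (m : ℂ → ℕ) (G : ℂ → ℂ), Differentiable ℂ G ∧
      (∀ a, a ∈ Z ↔ a ∈ Metric.closedBall c (R / 3) ∧ g a = 0) ∧
      (∀ a ∈ Z, 1 ≤ m a) ∧ (∑ a ∈ Z, m a = zerosIn g (Metric.closedBall c (R / 3))) ∧
      ((∑ a ∈ Z, m a : ℕ) : ℝ) ≤ 2 * L ∧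
      (∀ s, g s = (∏ a ∈ Z, (s - a) ^ m a) * G s) ∧
      (∀ s ∈ Metric.closedBall c (R / 3), G s ≠ 0) ∧
      (∀ s ∈ Metric.closedBall c (R / 6),
        Real.exp (-(2 * L)) * ‖g c‖ ≤ (R / 3) ^ (∑ a ∈ Z, m a) * ‖G s‖) ∧
      ∀ s ∈ Metric.closedBall c (R / 12), ‖logDeriv G s‖ ≤ 24 * L / R := by
  have h0 : g ≠ 0 := by rintro rfl; simp at hgc
  have hfin := finite_zeros hg h0 (Metric.isBounded_closedBall (x := c) (r := R / 3))
  set Z := hfin.toFinset with hZ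
  have hmemZ : ∀ a, a ∈ Z ↔ a ∈ Metric.closedBall c (R / 3) ∧ g a = 0 := by
    intro a; rw [hZ, Set.Finite.mem_toFinset]; rfl
  obtain ⟨G, hG, hGZ, hprod, -⟩ := exists_factorization hg h0 Z
  set m : ℂ → ℕ := analyticOrderNatAt g with hm
  set N := ∑ a ∈ Z, m a with hN
  have hG0 : ∀ s ∈ Metric.closedBall c (R / 3), G s ≠ 0 := by
    intro s hs h
    by_cases hsZ : s ∈ Z
    · exact hGZ s hsZ h
    · exact hsZ ((hmemZ s).2 ⟨hs, by rw [hprod, h, mul_zero]⟩)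
  have hgc0 : 0 < ‖g c‖ := norm_pos_iff.2 hgc
  have hcc : ‖g c‖ ≤ (R / 3) ^ N * ‖G c‖ := by
    rw [hprod c, norm_mul, norm_prod, hN, ← Finset.prod_pow_eq_pow_sum]
    gcongr with a ha
    rw [norm_pow]
    gcongr
    have := ((hmemZ a).1 ha).1
    rwa [Metric.mem_closedBall, dist_comm, dist_eq] at this
  -- Every divided zero is at distance at least 2R/3 from the sphere of radius R, but at most R/3
  -- from the centre. So each zero gains a factor 2, and the maximum principle carries the gain into
  -- the disc.
  have hsph : ∀ s ∈ frontier (Metric.ball c R),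
      ‖G s‖ ≤ Real.exp L * ‖g c‖ / (2 * (R / 3)) ^ N := by
    intro s hs
    rw [frontier_ball c hR.ne'] at hs
    have h1 := hM s (Metric.sphere_subset_closedBall hs)
    rw [le_div_iff₀ (by positivity)]
    refine le_trans ?_ h1
    rw [hprod s, norm_mul, norm_prod, hN, ← Finset.prod_pow_eq_pow_sum, mul_comm]
    gcongr with a ha
    rw [norm_pow]
    gcongr
    have h2 := ((hmemZ a).1 ha).1
    rw [Metric.mem_closedBall, dist_eq] at h2
    rw [Metric.mem_sphere, dist_eq] at hs
    have h3 := norm_sub_norm_le (s - c) (a - c)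
    rw [sub_sub_sub_cancel_right] at h3
    linarith
  have hball : ∀ s ∈ Metric.closedBall c R,
      ‖G s‖ ≤ Real.exp L * ‖g c‖ / (2 * (R / 3)) ^ N := by
    intro s hs
    refine norm_le_of_forall_mem_frontier_norm_le Metric.isBounded_ball
      hG.diffContOnCl hsph ?_
    rwa [closure_ball c hR.ne']
  have hball' : ∀ s ∈ Metric.closedBall c R, 2 ^ N * ‖G s‖ ≤ Real.exp L * ‖G c‖ := by
    intro s hs
    have h1 := hball s hs
    rw [le_div_iff₀ (by positivity), mul_pow] at h1
    have h2 : (0 : ℝ) < (R / 3) ^ N := by positivity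
    refine le_of_mul_le_mul_right ?_ h2
    calc 2 ^ N * ‖G s‖ * (R / 3) ^ N = ‖G s‖ * (2 ^ N * (R / 3) ^ N) := by ring
      _ ≤ Real.exp L * ‖g c‖ := h1
      _ ≤ Real.exp L * ((R / 3) ^ N * ‖G c‖) := by gcongr
      _ = _ := by ring
  have hcR : c ∈ Metric.closedBall c R := Metric.mem_closedBall_self hR.le
  have hGc : 0 < ‖G c‖ := norm_pos_iff.2 (hG0 c (Metric.mem_closedBall_self (by linarith)))
  -- At the centre itself the gain reads 2^N ≤ e^L, which bounds the number of zeros.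
  have h2N : (2 : ℝ) ^ N ≤ Real.exp L := le_of_mul_le_mul_right (hball' c hcR) hGc
  have hN2 : (N : ℝ) ≤ 2 * L := by
    have h1 := Real.log_le_log (by positivity) h2N
    rw [Real.log_exp, Real.log_pow] at h1
    have := Real.log_two_gt_d9
    nlinarith [Nat.cast_nonneg (α := ℝ) N]
  have hzf := zeroFree_bounds hG (c := c) (ρ := R / 3) (L := L) (by linarith) hL
    (fun s hs => hG0 s (Metric.ball_subset_closedBall hs)) (fun s hs => by
      refine le_trans ?_ (hball' s (Metric.closedBall_subset_closedBall (by linarith)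
        (Metric.ball_subset_closedBall hs)))
      exact le_mul_of_one_le_left (norm_nonneg _) (one_le_pow₀ (by norm_num)))
  refine ⟨Z, m, G, hG, hmemZ, ?_, ?_, hN2, hprod, hG0, ?_, ?_⟩
  · exact fun a ha => analyticOrderNatAt_pos hg h0 ((hmemZ a).1 ha).2
  · unfold zerosIn
    rw [← finsum_mem_inter_support, finsum_mem_eq_finite_toFinset_sum _
      (finite_inter_support hg h0 Metric.isBounded_closedBall)]
    refine Finset.sum_congr ?_ fun _ _ => rfl
    ext a
    rw [hmemZ, Set.Finite.mem_toFinset, mem_inter_iff, Function.mem_support]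
    refine and_congr_right fun _ => ⟨fun h => (analyticOrderNatAt_pos hg h0 h).ne',
      apply_eq_zero_of_analyticOrderNatAt_ne_zero⟩
  · intro s hs
    have := hzf.1 s (by convert hs using 2; ring)
    calc Real.exp (-(2 * L)) * ‖g c‖ ≤ Real.exp (-(2 * L)) * ((R / 3) ^ N * ‖G c‖) := by gcongr
      _ = (R / 3) ^ N * (Real.exp (-(2 * L)) * ‖G c‖) := by ring
      _ ≤ _ := by gcongr
  · intro s hs
    have := hzf.2 s (by convert hs using 2; ring)
    refine this.trans (le_of_eq ?_)
    field_simp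
    ring

lemma zerosIn_le_of_growth {g : ℂ → ℂ} (hg : Differentiable ℂ g) {c : ℂ} {R L : ℝ}
    (hR : 0 < R) (hL : 0 < L) (hgc : g c ≠ 0)
    (hM : ∀ s ∈ Metric.closedBall c R, ‖g s‖ ≤ Real.exp L * ‖g c‖) :
    (zerosIn g (Metric.closedBall c (R / 3)) : ℝ) ≤ 2 * L := by
  obtain ⟨Z, m, G, -, -, -, hsum, hN, -⟩ := exists_local_factorization hg hR hL hgc hM
  rwa [← hsum]

/-- Few zeros, as a finite set. -/
lemma exists_finset_zeros_of_growth {g : ℂ → ℂ} (hg : Differentiable ℂ g) {c : ℂ} {R L : ℝ}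
    (hR : 0 < R) (hL : 0 < L) (hgc : g c ≠ 0)
    (hM : ∀ s ∈ Metric.closedBall c R, ‖g s‖ ≤ Real.exp L * ‖g c‖) :
    ∃ Z : Finset ℂ, (∀ a, a ∈ Z ↔ a ∈ Metric.closedBall c (R / 3) ∧ g a = 0) ∧
      (Z.card : ℝ) ≤ 2 * L := by
  obtain ⟨Z, m, G, -, hZ, hm, hsum, hN, -⟩ := exists_local_factorization hg hR hL hgc hM
  refine ⟨Z, hZ, le_trans ?_ hN⟩
  rw [Finset.card_eq_sum_ones]
  exact_mod_cast Finset.sum_le_sum hm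

/-- Lower bound away from the zeros. -/
lemma norm_ge_of_growth {g : ℂ → ℂ} (hg : Differentiable ℂ g) {c : ℂ} {R L κ : ℝ}
    (hR : 0 < R) (hL : 0 < L) (hgc : g c ≠ 0)
    (hM : ∀ s ∈ Metric.closedBall c R, ‖g s‖ ≤ Real.exp L * ‖g c‖) (hκ : 0 < κ) (hκR : κ ≤ R)
    {s : ℂ} (hs : s ∈ Metric.closedBall c (R / 12))
    (hd : ∀ a ∈ Metric.closedBall c (R / 3), g a = 0 → κ ≤ ‖s - a‖) :
    Real.exp (-(2 * L * (1 + Real.log (R / κ)))) * ‖g c‖ ≤ ‖g s‖ := by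
  obtain ⟨Z, m, G, -, hZ, hm, hsum, hN, hprod, -, hlow, -⟩ :=
    exists_local_factorization hg hR hL hgc hM
  set N := ∑ a ∈ Z, m a
  have h1 := hlow s (Metric.closedBall_subset_closedBall (by linarith) hs)
  have h2 : κ ^ N * ‖G s‖ ≤ ‖g s‖ := by
    rw [hprod s, norm_mul, norm_prod, ← Finset.prod_pow_eq_pow_sum]
    gcongr with a ha
    rw [norm_pow]
    gcongr
    exact hd a ((hZ a).1 ha).1 ((hZ a).1 ha).2
  -- There are at most 2L zeros with multiplicity, and each costs at worst a factor κ / R.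
  have h3 : Real.exp (-(2 * L * Real.log (R / κ))) ≤ (κ / R) ^ N := by
    rw [← Real.exp_log (show 0 < (κ / R) ^ N by positivity), Real.log_pow, Real.exp_le_exp,
      ← inv_div R κ, Real.log_inv]
    have : 0 ≤ Real.log (R / κ) := Real.log_nonneg ((one_le_div hκ).2 hκR)
    nlinarith
  calc Real.exp (-(2 * L * (1 + Real.log (R / κ)))) * ‖g c‖
      = Real.exp (-(2 * L * Real.log (R / κ))) * (Real.exp (-(2 * L)) * ‖g c‖) := by
        rw [← mul_assoc, ← Real.exp_add]; ring_nf
    _ ≤ (κ / R) ^ N * ((R / 3) ^ N * ‖G s‖) := by gcongr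
    _ = κ ^ N * ‖G s‖ * (1 / 3) ^ N := by
        rw [div_pow, div_pow, div_pow, one_pow]; field_simp
    _ ≤ κ ^ N * ‖G s‖ * 1 := by
        gcongr
        exact pow_le_one₀ (by norm_num) (by norm_num)
    _ ≤ _ := by rwa [mul_one]

/-- The variation of the argument along a segment in a disc is bounded by the growth. -/
lemma abs_argVar_le_of_growth {g : ℂ → ℂ} (hg : Differentiable ℂ g) {c : ℂ} {R L : ℝ}
    (hR : 0 < R) (hL : 0 < L) (hgc : g c ≠ 0)
    (hM : ∀ s ∈ Metric.closedBall c R, ‖g s‖ ≤ Real.exp L * ‖g c‖) {a e : ℂ} (he : ‖e‖ = 1)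
    {t₀ t₁ : ℝ} (hs : ∀ t ∈ uIcc t₀ t₁, a + t * e ∈ Metric.closedBall c (R / 12))
    (h0 : ∀ t ∈ uIcc t₀ t₁, g (a + t * e) ≠ 0) :
    |argVar g a e t₀ t₁| ≤ 12 * L := by
  obtain ⟨Z, m, G, hG, hZ, hm, hsum, hN, hprod, hG0, -, hlog⟩ :=
    exists_local_factorization hg hR hL hgc hM
  have he0 : e ≠ 0 := by rintro rfl; simp at he
  have hne : ∀ z ∈ Z, ∀ t ∈ uIcc t₀ t₁, a + t * e ≠ z := by
    rintro z hz t ht rfl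
    exact h0 t ht ((hZ _).1 hz).2
  have hgeq : g = fun s => (∏ z ∈ Z, (s - z) ^ m z) * G s := funext hprod
  have hGs : ∀ t ∈ uIcc t₀ t₁, G (a + t * e) ≠ 0 := fun t ht =>
    hG0 _ (Metric.closedBall_subset_closedBall (by linarith) (hs t ht))
  rw [hgeq, argVar_mul (by fun_prop) hG
    (fun t ht => Finset.prod_ne_zero_iff.2 fun z hz => pow_ne_zero _ (sub_ne_zero.2 (hne z hz t ht)))
    hGs, argVar_prod_pow Z m hne]
  have hlen : |t₁ - t₀| ≤ R / 6 := by
    have h1 := hs t₀ left_mem_uIcc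
    have h2 := hs t₁ right_mem_uIcc
    rw [Metric.mem_closedBall] at h1 h2
    have h3 := dist_triangle_right (a + t₁ * e) (a + t₀ * e) c
    rw [dist_eq, add_sub_add_left_eq_sub, ← sub_mul, norm_mul, he, mul_one, ← ofReal_sub,
      norm_real, Real.norm_eq_abs] at h3
    linarith
  have hb1 : |∑ z ∈ Z, m z * argVar (fun s => s - z) a e t₀ t₁| ≤ 2 * L * Real.pi := by
    calc |∑ z ∈ Z, m z * argVar (fun s => s - z) a e t₀ t₁|
        ≤ ∑ z ∈ Z, |m z * argVar (fun s => s - z) a e t₀ t₁| := Finset.abs_sum_le_sum_abs _ _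
      _ ≤ ∑ z ∈ Z, m z * Real.pi := by
          gcongr with z hz
          rw [abs_mul, Nat.abs_cast]
          gcongr
          exact abs_argVar_sub_const_le he0 _ _
      _ = (∑ z ∈ Z, m z : ℕ) * Real.pi := by rw [Nat.cast_sum, Finset.sum_mul]
      _ ≤ _ := by gcongr
  have hb2 : |argVar G a e t₀ t₁| ≤ 24 * L / R * |t₁ - t₀| := by
    refine abs_argVar_le fun t ht => ?_
    rw [norm_mul, he, one_mul]
    exact hlog _ (hs t ht)
  have hb3 : 24 * L / R * |t₁ - t₀| ≤ 4 * L := by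
    calc 24 * L / R * |t₁ - t₀| ≤ 24 * L / R * (R / 6) := by gcongr
      _ = 4 * L := by field_simp; ring
  -- Each of the at most 2L zeros turns the argument by at most π, the zero-free factor by at most
  -- 4L in total, and 2π + 4 < 12.
  have := abs_add_le (∑ z ∈ Z, m z * argVar (fun s => s - z) a e t₀ t₁) (argVar G a e t₀ t₁)
  have := Real.pi_lt_d2
  nlinarith


/-! ### Argument principle and Rouché's theorem for rectangles -/

/-- The open rectangle with sides parallel to the axes. -/
def openBox (x₀ x₁ y₀ y₁ : ℝ) : Set ℂ := {s | x₀ < s.re ∧ s.re < x₁ ∧ y₀ < s.im ∧ s.im < y₁}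

/-- The boundary of the rectangle. -/
def boxBoundary (x₀ x₁ y₀ y₁ : ℝ) : Set ℂ :=
  {s | (x₀ ≤ s.re ∧ s.re ≤ x₁ ∧ y₀ ≤ s.im ∧ s.im ≤ y₁) ∧
    (s.re = x₀ ∨ s.re = x₁ ∨ s.im = y₀ ∨ s.im = y₁)}

lemma isBounded_re_im (x₀ x₁ y₀ y₁ : ℝ) :
    Bornology.IsBounded {s : ℂ | x₀ ≤ s.re ∧ s.re ≤ x₁ ∧ y₀ ≤ s.im ∧ s.im ≤ y₁} := by
  have h : Bornology.IsBounded (Icc x₀ x₁ ×ℂ Icc y₀ y₁) :=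
    (Metric.isBounded_Icc x₀ x₁).reProdIm (Metric.isBounded_Icc y₀ y₁)
  refine h.subset fun s hs => ?_
  rw [mem_reProdIm]
  exact ⟨⟨hs.1, hs.2.1⟩, hs.2.2.1, hs.2.2.2⟩

lemma isBounded_openBox (x₀ x₁ y₀ y₁ : ℝ) : Bornology.IsBounded (openBox x₀ x₁ y₀ y₁) :=
  (isBounded_re_im x₀ x₁ y₀ y₁).subset fun _ hs => ⟨hs.1.le, hs.2.1.le, hs.2.2.1.le, hs.2.2.2.le⟩

/-- The variation of the argument of `g` along the boundary of the rectangle. -/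
def rectVar (g : ℂ → ℂ) (x₀ x₁ y₀ y₁ : ℝ) : ℝ :=
  argVar g (y₀ * I) 1 x₀ x₁ + argVar g x₁ I y₀ y₁ - argVar g (y₁ * I) 1 x₀ x₁ -
    argVar g x₀ I y₀ y₁

lemma bottom_of_boxBoundary {x₀ x₁ y₀ y₁ : ℝ} {P : ℂ → Prop} (hx : x₀ ≤ x₁)
    (hy : y₀ ≤ y₁) (h : ∀ s ∈ boxBoundary x₀ x₁ y₀ y₁, P s) :
    ∀ t ∈ uIcc x₀ x₁, P (y₀ * I + t * 1) := by
  intro t ht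
  rw [uIcc_of_le hx] at ht
  exact h _ (by simp [boxBoundary, ht.1, ht.2, hy])

lemma top_of_boxBoundary {x₀ x₁ y₀ y₁ : ℝ} {P : ℂ → Prop} (hx : x₀ ≤ x₁)
    (hy : y₀ ≤ y₁) (h : ∀ s ∈ boxBoundary x₀ x₁ y₀ y₁, P s) :
    ∀ t ∈ uIcc x₀ x₁, P (y₁ * I + t * 1) := by
  intro t ht
  rw [uIcc_of_le hx] at ht
  exact h _ (by simp [boxBoundary, ht.1, ht.2, hy])

lemma left_of_boxBoundary {x₀ x₁ y₀ y₁ : ℝ} {P : ℂ → Prop} (hx : x₀ ≤ x₁)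
    (hy : y₀ ≤ y₁) (h : ∀ s ∈ boxBoundary x₀ x₁ y₀ y₁, P s) :
    ∀ t ∈ uIcc y₀ y₁, P (x₀ + t * I) := by
  intro t ht
  rw [uIcc_of_le hy] at ht
  exact h _ (by simp [boxBoundary, ht.1, ht.2, hx])

lemma right_of_boxBoundary {x₀ x₁ y₀ y₁ : ℝ} {P : ℂ → Prop} (hx : x₀ ≤ x₁)
    (hy : y₀ ≤ y₁) (h : ∀ s ∈ boxBoundary x₀ x₁ y₀ y₁, P s) :
    ∀ t ∈ uIcc y₀ y₁, P (x₁ + t * I) := by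
  intro t ht
  rw [uIcc_of_le hy] at ht
  exact h _ (by simp [boxBoundary, ht.1, ht.2, hx])

lemma arg_div_I {w : ℂ} (hre : 0 < w.re) (him : 0 < w.im) : arg w - arg (w / I) = Real.pi / 2 := by
  have hw : w ≠ 0 := by rintro rfl; simp at hre
  have h1 : arg w < Real.pi / 2 := (abs_lt.1 (abs_arg_lt_pi_div_two_iff.2 (Or.inl hre))).2
  have h2 : 0 ≤ arg w := arg_nonneg_iff.2 him.le
  have h3 : w / I = w * (-I) := by rw [div_eq_mul_inv, inv_I]
  rw [h3, arg_mul hw (by simp), arg_neg_I]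
  · ring
  · rw [arg_neg_I]
    have := Real.pi_pos
    constructor <;> linarith

lemma argVar_sub_const_eq {z k a e : ℂ} (hk : k ≠ 0) {t₀ t₁ : ℝ}
    (hre : ∀ t ∈ uIcc t₀ t₁, 0 < ((a + t * e - z) / k).re) :
    argVar (fun s => s - z) a e t₀ t₁ =
      arg ((a + t₁ * e - z) / k) - arg ((a + t₀ * e - z) / k) := by
  rw [argVar_eq_of_div_re_pos (h := fun _ => k) (by fun_prop) (by fun_prop)
    (fun _ _ => hk) hre]
  simp [argVar]

/-- On each side, s - z divided by one of -I, 1, I, -1 stays in the right half plane, so the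
variation is a difference of principal arguments. At each corner the two branches in use differ by
π/2, and the four corners add up to 2π. -/
lemma rectVar_sub_const {x₀ x₁ y₀ y₁ : ℝ} {z : ℂ} (hz : z ∈ openBox x₀ x₁ y₀ y₁) :
    rectVar (fun s => s - z) x₀ x₁ y₀ y₁ = 2 * Real.pi := by
  obtain ⟨h1, h2, h3, h4⟩ := hz
  unfold rectVar
  rw [argVar_sub_const_eq (k := -I) (by simp)
      (fun t _ => by simp [div_eq_mul_inv]; linarith),
    argVar_sub_const_eq (k := 1) (by simp) (fun t _ => by simp; linarith),
    argVar_sub_const_eq (k := I) (by simp)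
      (fun t _ => by simp [div_eq_mul_inv]; linarith),
    argVar_sub_const_eq (k := -1) (by simp)
      (fun t _ => by simp [div_neg]; linarith)]
  have ne := arg_div_I (w := (x₁ + y₁ * I - z) / 1) (by simp; linarith) (by simp; linarith)
  have nw := arg_div_I (w := (x₀ + y₁ * I - z) / I) (by simp [div_eq_mul_inv]; linarith)
    (by simp [div_eq_mul_inv]; linarith)
  have sw := arg_div_I (w := (x₀ + y₀ * I - z) / (-1)) (by simp [div_neg]; linarith)
    (by simp [div_neg]; linarith)
  have se := arg_div_I (w := (x₁ + y₀ * I - z) / (-I)) (by simp [div_eq_mul_inv]; linarith)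
    (by simp [div_eq_mul_inv]; linarith)
  rw [div_div] at ne nw sw se
  rw [one_mul] at ne
  rw [I_mul_I] at nw
  rw [neg_one_mul] at sw
  rw [neg_mul, I_mul_I, neg_neg] at se
  rw [mul_one, mul_one, add_comm ((y₀ : ℂ) * I) x₁, add_comm ((y₀ : ℂ) * I) x₀,
    add_comm ((y₁ : ℂ) * I) x₁, add_comm ((y₁ : ℂ) * I) x₀]
  linarith

/-- The imaginary part of Cauchy's theorem for the logarithmic derivative. -/
lemma rectVar_of_zeroFree {G : ℂ → ℂ} (hG : Differentiable ℂ G) {x₀ x₁ y₀ y₁ : ℝ}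
    (hx : x₀ ≤ x₁) (hy : y₀ ≤ y₁)
    (h0 : ∀ s : ℂ, x₀ ≤ s.re ∧ s.re ≤ x₁ ∧ y₀ ≤ s.im ∧ s.im ≤ y₁ → G s ≠ 0) :
    rectVar G x₀ x₁ y₀ y₁ = 0 := by
  have hb : ∀ s ∈ boxBoundary x₀ x₁ y₀ y₁, G s ≠ 0 := fun s hs => h0 s hs.1
  have key := integral_boundary_rect_eq_zero_of_differentiableOn (logDeriv G) (x₀ + y₀ * I)
    (x₁ + y₁ * I) (by
      intro s hs
      have hs' : G s ≠ 0 := by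
        simp only [add_re, ofReal_re, mul_re, I_re, mul_zero, ofReal_im, I_im, mul_one, sub_self,
          add_zero, add_im, mul_im, zero_add, mem_reProdIm, uIcc_of_le hx, uIcc_of_le hy] at hs
        exact h0 s ⟨hs.1.1, hs.1.2, hs.2.1, hs.2.2⟩
      have h1 : DifferentiableAt ℂ (deriv G) s := (hG.analyticAt s).deriv.differentiableAt
      exact (h1.div (hG s) hs').differentiableWithinAt)
  simp only [add_re, ofReal_re, mul_re, I_re, mul_zero, ofReal_im, I_im, mul_one, sub_self,
    add_zero, add_im, mul_im, zero_add, smul_eq_mul] at key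
  have hcont : ∀ (a e : ℂ) (t₀ t₁ : ℝ), (∀ t ∈ uIcc t₀ t₁, G (a + t * e) ≠ 0) →
      (e * ∫ t in t₀..t₁, logDeriv G (a + t * e)).im = argVar G a e t₀ t₁ := by
    intro a e t₀ t₁ h
    have hd : Continuous (deriv G) := (hG.contDiff (n := 1)).continuous_deriv le_rfl
    have hc := hG.continuous
    have hci : IntervalIntegrable (fun t : ℝ => e * logDeriv G (a + t * e))
        MeasureTheory.volume t₀ t₁ := by
      refine ContinuousOn.intervalIntegrable ?_
      unfold logDeriv
      simp only [Pi.div_apply]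
      exact continuousOn_const.mul (ContinuousOn.div (by fun_prop) (by fun_prop) h)
    unfold argVar
    rw [← intervalIntegral.integral_const_mul]
    exact (Complex.imCLM.intervalIntegral_comp_comm hci).symm
  have b1 := hcont _ _ _ _ (bottom_of_boxBoundary hx hy hb)
  have b2 := hcont _ _ _ _ (top_of_boxBoundary hx hy hb)
  have b3 := hcont _ _ _ _ (left_of_boxBoundary hx hy hb)
  have b4 := hcont _ _ _ _ (right_of_boxBoundary hx hy hb)
  simp only [mul_one, one_mul, add_comm ((y₀ : ℂ) * I), add_comm ((y₁ : ℂ) * I)] at b1 b2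
  have key' := congrArg Complex.im key
  simp only [add_im, sub_im, zero_im] at key'
  unfold rectVar
  linarith

/-- The argument principle for a rectangle. -/
theorem rectVar_eq_zerosIn {g : ℂ → ℂ} (hg : Differentiable ℂ g) {x₀ x₁ y₀ y₁ : ℝ}
    (hx : x₀ < x₁) (hy : y₀ < y₁) (hb : ∀ s ∈ boxBoundary x₀ x₁ y₀ y₁, g s ≠ 0) :
    rectVar g x₀ x₁ y₀ y₁ = 2 * Real.pi * zerosIn g (openBox x₀ x₁ y₀ y₁) := by
  have h0 : g ≠ 0 := by
    rintro rfl
    exact hb (x₀ + y₀ * I) (by simp [boxBoundary, hx.le, hy.le]) rfl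
  have hfin := finite_zeros hg h0 (isBounded_openBox x₀ x₁ y₀ y₁)
  set Z := hfin.toFinset with hZ
  have hmemZ : ∀ a, a ∈ Z ↔ a ∈ openBox x₀ x₁ y₀ y₁ ∧ g a = 0 := by
    intro a; rw [hZ, Set.Finite.mem_toFinset]; rfl
  obtain ⟨G, hG, hGZ, hprod, -⟩ := exists_factorization hg h0 Z
  set m : ℂ → ℕ := analyticOrderNatAt g with hm
  have hG0 : ∀ s : ℂ, x₀ ≤ s.re ∧ s.re ≤ x₁ ∧ y₀ ≤ s.im ∧ s.im ≤ y₁ → G s ≠ 0 := by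
    intro s hs h
    have hgs : g s = 0 := by rw [hprod, h, mul_zero]
    by_cases hsZ : s ∈ Z
    · exact hGZ s hsZ h
    · refine hb s ⟨hs, ?_⟩ hgs
      by_contra hcon
      push Not at hcon
      refine hsZ ((hmemZ s).2 ⟨⟨?_, ?_, ?_, ?_⟩, hgs⟩)
      · exact lt_of_le_of_ne hs.1 hcon.1.symm
      · exact lt_of_le_of_ne hs.2.1 hcon.2.1
      · exact lt_of_le_of_ne hs.2.2.1 hcon.2.2.1.symm
      · exact lt_of_le_of_ne hs.2.2.2 hcon.2.2.2
  have hsum : zerosIn g (openBox x₀ x₁ y₀ y₁) = ∑ a ∈ Z, m a := by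
    unfold zerosIn
    rw [← finsum_mem_inter_support, finsum_mem_eq_finite_toFinset_sum _
      (finite_inter_support hg h0 (isBounded_openBox _ _ _ _))]
    refine Finset.sum_congr ?_ fun _ _ => rfl
    ext a
    rw [hmemZ, Set.Finite.mem_toFinset, mem_inter_iff, Function.mem_support]
    exact and_congr_right fun _ => ⟨apply_eq_zero_of_analyticOrderNatAt_ne_zero,
      fun h => (analyticOrderNatAt_pos hg h0 h).ne'⟩
  have hside : ∀ (a e : ℂ) (t₀ t₁ : ℝ), (∀ t ∈ uIcc t₀ t₁, g (a + t * e) ≠ 0) →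
      argVar g a e t₀ t₁ = ∑ z ∈ Z, m z * argVar (fun s => s - z) a e t₀ t₁ +
        argVar G a e t₀ t₁ := by
    intro a e t₀ t₁ h
    have hne : ∀ z ∈ Z, ∀ t ∈ uIcc t₀ t₁, a + t * e ≠ z := by
      rintro z hz t ht rfl
      exact h t ht ((hmemZ _).1 hz).2
    have hGs : ∀ t ∈ uIcc t₀ t₁, G (a + t * e) ≠ 0 := fun t ht h' =>
      h t ht (by rw [hprod, h', mul_zero])
    have hgeq : g = fun s => (∏ z ∈ Z, (s - z) ^ m z) * G s := funext hprod
    rw [hgeq, argVar_mul (by fun_prop) hG (fun t ht => Finset.prod_ne_zero_iff.2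
      fun z hz => pow_ne_zero _ (sub_ne_zero.2 (hne z hz t ht))) hGs, argVar_prod_pow Z m hne]
  -- Each zero divided out contributes its multiplicity times 2π, and the remaining factor has no
  -- zeros in the closed rectangle.
  have hrect : rectVar g x₀ x₁ y₀ y₁ =
      ∑ z ∈ Z, m z * rectVar (fun s => s - z) x₀ x₁ y₀ y₁ + rectVar G x₀ x₁ y₀ y₁ := by
    unfold rectVar
    rw [hside _ _ _ _ (bottom_of_boxBoundary hx.le hy.le hb),
      hside _ _ _ _ (top_of_boxBoundary hx.le hy.le hb),
      hside _ _ _ _ (left_of_boxBoundary hx.le hy.le hb),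
      hside _ _ _ _ (right_of_boxBoundary hx.le hy.le hb)]
    simp only [mul_sub, mul_add, Finset.sum_sub_distrib, Finset.sum_add_distrib]
    ring
  rw [hrect, rectVar_of_zeroFree hG hx.le hy.le hG0, add_zero, hsum, Nat.cast_sum,
    Finset.mul_sum]
  refine Finset.sum_congr rfl fun z hz => ?_
  rw [rectVar_sub_const ((hmemZ z).1 hz).1]
  ring

/-- **Rouché's theorem** for a rectangle. -/
theorem zerosIn_openBox_eq {g h : ℂ → ℂ} (hg : Differentiable ℂ g) (hh : Differentiable ℂ h)
    {x₀ x₁ y₀ y₁ : ℝ} (hx : x₀ < x₁) (hy : y₀ < y₁)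
    (hh0 : ∀ s ∈ boxBoundary x₀ x₁ y₀ y₁, h s ≠ 0)
    (hre : ∀ s ∈ boxBoundary x₀ x₁ y₀ y₁, 0 < (g s / h s).re) :
    zerosIn g (openBox x₀ x₁ y₀ y₁) = zerosIn h (openBox x₀ x₁ y₀ y₁) := by
  have hg0 : ∀ s ∈ boxBoundary x₀ x₁ y₀ y₁, g s ≠ 0 := by
    intro s hs h0
    have := hre s hs
    simp [h0] at this
  -- The principal argument of g / h is continuous along the whole boundary, so its changes on the
  -- four sides cancel.
  have hrect : rectVar g x₀ x₁ y₀ y₁ = rectVar h x₀ x₁ y₀ y₁ := by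
    unfold rectVar
    rw [argVar_eq_of_div_re_pos hg hh (bottom_of_boxBoundary hx.le hy.le hh0)
        (bottom_of_boxBoundary hx.le hy.le hre),
      argVar_eq_of_div_re_pos hg hh (top_of_boxBoundary hx.le hy.le hh0)
        (top_of_boxBoundary hx.le hy.le hre),
      argVar_eq_of_div_re_pos hg hh (left_of_boxBoundary hx.le hy.le hh0)
        (left_of_boxBoundary hx.le hy.le hre),
      argVar_eq_of_div_re_pos hg hh (right_of_boxBoundary hx.le hy.le hh0)
        (right_of_boxBoundary hx.le hy.le hre)]
    simp only [mul_one, add_comm ((y₀ : ℂ) * I), add_comm ((y₁ : ℂ) * I)]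
    ring
  rw [rectVar_eq_zerosIn hg hx hy hg0, rectVar_eq_zerosIn hh hx hy hh0] at hrect
  exact_mod_cast mul_left_cancel₀ (by positivity) hrect


/-! ### Coefficient functions in the logarithmic plane -/

/-- An entire function of growth `O(x e^{dx})` in right half planes, such that every vertical
segment of length `8` contains a point from which the local growth is `O(e^{dx})`. -/
structure Tame (d : ℕ) (h : ℂ → ℂ) (C x₀ : ℝ) : Prop where
  entire : Differentiable ℂ h
  growth : ∀ s : ℂ, 1 ≤ s.re → ‖h s‖ ≤ Real.exp (C * (s.re * Real.exp (d * s.re)))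
  seed : ∀ l : ℝ, x₀ ≤ l → ∀ θ : ℝ, ∃ c : ℂ, c.re = l ∧ |c.im - θ| ≤ 4 ∧
    Real.exp (-(C * (l * Real.exp (d * l)))) ≤ ‖h c‖ ∧
    ∀ s ∈ Metric.closedBall c 120, ‖h s‖ ≤ Real.exp (C * Real.exp (d * l)) * ‖h c‖

lemma Tame.mono {d : ℕ} {h : ℂ → ℂ} {C C' x₀ x₀' : ℝ} (ht : Tame d h C x₀) (hC : C ≤ C')
    (hx : x₀ ≤ x₀') (hx' : 0 ≤ x₀') : Tame d h C' x₀' where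
  entire := ht.entire
  growth s hs := by
    refine (ht.growth s hs).trans (Real.exp_le_exp.2 ?_)
    have : 0 ≤ s.re * Real.exp (d * s.re) := mul_nonneg (by linarith) (Real.exp_nonneg _)
    gcongr
  seed l hl θ := by
    obtain ⟨c, h1, h2, h3, h4⟩ := ht.seed l (hx.trans hl) θ
    refine ⟨c, h1, h2, le_trans (Real.exp_le_exp.2 ?_) h3, fun s hs => (h4 s hs).trans ?_⟩
    · have : 0 ≤ l * Real.exp (d * l) := mul_nonneg (by linarith) (Real.exp_nonneg _)
      have := mul_le_mul_of_nonneg_right hC this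
      linarith
    · gcongr

lemma dist_le_of_re_im {s c : ℂ} {r₁ r₂ : ℝ} (h1 : |s.re - c.re| ≤ r₁) (h2 : |s.im - c.im| ≤ r₂) :
    s ∈ Metric.closedBall c (r₁ + r₂) := by
  rw [Metric.mem_closedBall, dist_eq]
  refine (norm_le_abs_re_add_abs_im _).trans ?_
  rw [sub_re, sub_im]
  linarith

/-- Local structure of a tame function around a point `l + iθ`. -/
lemma Tame.localStructure {d : ℕ} {h : ℂ → ℂ} {C x₀ : ℝ} (ht : Tame d h C x₀) (hC : 1 ≤ C) (q : ℕ)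
    {l : ℝ} (hl : x₀ ≤ l) (hl1 : 1 ≤ l) (θ : ℝ) :
    ∃ Z : Finset ℂ, (Z.card : ℝ) ≤ 2 * C * Real.exp (d * l) ∧
      (∀ s : ℂ, |s.re - l| ≤ 3 → |s.im - θ| ≤ 2 →
        (∀ a ∈ Z, Real.exp (-((q + 1) * l)) ≤ ‖s - a‖) →
        Real.exp (-((2 * q + 15) * C * (l * Real.exp (d * l)))) ≤ ‖h s‖) ∧
      (∀ (a e : ℂ) (t₀ t₁ : ℝ), ‖e‖ = 1 →
        (∀ t ∈ uIcc t₀ t₁, |(a + t * e).re - l| ≤ 3 ∧ |(a + t * e).im - θ| ≤ 2 ∧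
          h (a + t * e) ≠ 0) → |argVar h a e t₀ t₁| ≤ 12 * (C * Real.exp (d * l))) ∧
      ∀ A : Set ℂ, (∀ s ∈ A, |s.re - l| ≤ 3 ∧ |s.im - θ| ≤ 2) →
        (zerosIn h A : ℝ) ≤ 2 * C * Real.exp (d * l) := by
  obtain ⟨c, hcre, hcim, hlow, hup⟩ := ht.seed l hl θ
  have hE : 0 < Real.exp (d * l) := Real.exp_pos _
  have hL : 0 < C * Real.exp (d * l) := by positivity
  have hc0 : h c ≠ 0 := by
    rw [← norm_pos_iff]
    exact lt_of_lt_of_le (Real.exp_pos _) hlow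
  have h0 : h ≠ 0 := by rintro rfl; simp at hc0
  -- The seed lies within 4 of the height θ, so the region is within 3 + (2 + 4) of it; this fits
  -- into the disc of radius 120 / 12 on which the growth lemmas with R = 120 apply.
  have hreg : ∀ s : ℂ, |s.re - l| ≤ 3 → |s.im - θ| ≤ 2 → s ∈ Metric.closedBall c (120 / 12) := by
    intro s h1 h2
    refine Metric.closedBall_subset_closedBall (by norm_num : (3 : ℝ) + 6 ≤ 120 / 12)
      (dist_le_of_re_im (by rwa [hcre]) ?_)
    have := abs_sub_le s.im θ c.im
    rw [abs_sub_comm θ] at this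
    linarith
  obtain ⟨Z, hZ, hcard⟩ := exists_finset_zeros_of_growth ht.entire (by norm_num) hL hc0 hup
  refine ⟨Z, by linarith, ?_, ?_, ?_⟩
  · intro s h1 h2 h3
    have hκ1 : Real.exp (-((q + 1) * l)) ≤ 1 := by
      rw [Real.exp_le_one_iff]
      have : (0 : ℝ) ≤ (q + 1) * l := by positivity
      linarith
    have := norm_ge_of_growth ht.entire (by norm_num) hL hc0 hup (Real.exp_pos (-((q + 1) * l)))
      (by linarith) (hreg s h1 h2) (fun a ha ha0 => h3 a ((hZ a).2 ⟨ha, ha0⟩))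
    refine le_trans ?_ this
    refine le_trans ?_ (mul_le_mul_of_nonneg_left hlow (Real.exp_nonneg _))
    rw [← Real.exp_add, Real.exp_le_exp, Real.log_div (by norm_num) (Real.exp_ne_zero _),
      Real.log_exp]
    have hlog : Real.log 120 ≤ 5 := by
      rw [Real.log_le_iff_le_exp (by norm_num)]
      have h1 := Real.exp_one_gt_d9
      have h2 : Real.exp 5 = Real.exp 1 ^ 5 := by rw [← Real.exp_nat_mul]; norm_num
      rw [h2]
      calc (120 : ℝ) ≤ 2.7 ^ 5 := by norm_num
        _ ≤ _ := by gcongr; linarith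
    -- Twice q + 7, plus 1 for the lower bound at the seed itself, makes 2q + 15.
    have h5 : 1 + (Real.log 120 - -((q + 1) * l)) ≤ (q + 7) * l := by
      nlinarith
    have h6 : 2 * (C * Real.exp (d * l)) * (1 + (Real.log 120 - -((q + 1) * l))) ≤
        2 * (C * Real.exp (d * l)) * ((q + 7) * l) := by gcongr
    nlinarith
  · intro a e t₀ t₁ he ht'
    exact abs_argVar_le_of_growth ht.entire (by norm_num) hL hc0 hup he
      (fun t h => hreg _ (ht' t h).1 (ht' t h).2.1) (fun t h => (ht' t h).2.2)
  · intro A hA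
    have h1 := zerosIn_le_of_growth ht.entire (by norm_num) hL hc0 hup
    have h2 := zerosIn_mono ht.entire h0 (A := A)
      (Metric.isBounded_closedBall (x := c) (r := 120 / 3))
      (fun s hs _ => Metric.closedBall_subset_closedBall (by norm_num)
        (hreg s (hA s hs).1 (hA s hs).2))
    have h3 : (zerosIn h A : ℝ) ≤ zerosIn h (Metric.closedBall c (120 / 3)) := by exact_mod_cast h2
    linarith

/-- A point of an interval that keeps its distance from finitely many points. -/
lemma exists_generic {a b κ : ℝ} (hκ : 0 ≤ κ) (Z : Finset ℝ) {Z' : Set ℝ} (hZ' : Z'.Finite)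
    (h : 2 * κ * Z.card < b - a) :
    ∃ t, a < t ∧ t < b ∧ (∀ z ∈ Z, κ ≤ |t - z|) ∧ t ∉ Z' := by
  by_contra hcon
  push Not at hcon
  have hsub : Ioo a b ⊆ (⋃ z ∈ Z, Metric.ball z κ) ∪ Z' := by
    intro t ht
    by_cases h1 : ∀ z ∈ Z, κ ≤ |t - z|
    · exact Or.inr (hcon t ht.1 ht.2 h1)
    · push Not at h1
      obtain ⟨z, hz, hlt⟩ := h1
      refine Or.inl (mem_iUnion₂.2 ⟨z, hz, ?_⟩)
      rwa [Metric.mem_ball, Real.dist_eq]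
  have h1 := MeasureTheory.measure_mono (μ := MeasureTheory.volume) hsub
  have h2 : MeasureTheory.volume ((⋃ z ∈ Z, Metric.ball z κ) ∪ Z') ≤
      ENNReal.ofReal (2 * κ * Z.card) := by
    refine (MeasureTheory.measure_union_le _ _).trans ?_
    rw [hZ'.measure_zero, add_zero]
    refine (MeasureTheory.measure_biUnion_finset_le _ _).trans ?_
    simp only [Real.volume_ball, Finset.sum_const, nsmul_eq_mul]
    rw [mul_comm (2 * κ), ENNReal.ofReal_mul (p := (Z.card : ℝ)) (by positivity), ENNReal.ofReal_natCast]
  rw [Real.volume_Ioo] at h1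
  have h3 := h1.trans h2
  rw [ENNReal.ofReal_le_ofReal_iff (by positivity)] at h3
  linarith


/-! ### Exponential sums: the effect of a dominating exponent -/

/-- The sum `∑ h_v(s) exp(w_v e^{qs})`. -/
def expSum {ι : Type*} [Fintype ι] (q : ℕ) (w : ι → ℂ) (h : ι → ℂ → ℂ) : ℂ → ℂ :=
  fun s => ∑ v, h v s * exp (w v * exp (q * s))

/-- The real part of `a e^{iqy}`. -/
def dirRe (q : ℕ) (a : ℂ) (y : ℝ) : ℝ := (a * exp (q * y * I)).re

lemma dirRe_sub (q : ℕ) (a b : ℂ) (y : ℝ) : dirRe q (a - b) y = dirRe q a y - dirRe q b y := by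
  simp [dirRe, sub_mul]

lemma exp_nat_mul_eq (q : ℕ) (s : ℂ) :
    exp (q * s) = (Real.exp (q * s.re) : ℂ) * exp (q * s.im * I) := by
  rw [ofReal_exp, ← exp_add]
  congr 1
  conv_lhs => rw [← re_add_im s]
  push_cast
  ring

lemma re_mul_exp (q : ℕ) (a s : ℂ) :
    (a * exp (q * s)).re = Real.exp (q * s.re) * dirRe q a s.im := by
  rw [exp_nat_mul_eq, mul_left_comm, re_ofReal_mul, dirRe]

section

variable {ι : Type*} [Fintype ι] {q : ℕ} {w : ι → ℂ} {h : ι → ℂ → ℂ}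

lemma differentiable_expSum (hh : ∀ v, Differentiable ℂ (h v)) :
    Differentiable ℂ (expSum q w h) := by
  unfold expSum
  fun_prop

/-- After this normalisation the `j`-th summand is `h j` alone, while the other terms are small
wherever `w j` dominates. -/
lemma expSum_eq (j : ι) (s : ℂ) :
    expSum q w h s = expSum q (fun v => w v - w j) h s * exp (w j * exp (q * s)) := by
  unfold expSum
  rw [Finset.sum_mul]
  refine Finset.sum_congr rfl fun v _ => ?_
  rw [mul_assoc, ← exp_add]
  ring_nf

lemma zerosIn_expSum_sub (hh : ∀ v, Differentiable ℂ (h v)) (j : ι) (A : Set ℂ) :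
    zerosIn (expSum q (fun v => w v - w j) h) A = zerosIn (expSum q w h) A := by
  have : expSum q w h =
      fun s => expSum q (fun v => w v - w j) h s * exp (w j * exp (q * s)) :=
    funext (expSum_eq j)
  rw [this]
  exact (zerosIn_mul_exp _ _ (differentiable_expSum hh) (by fun_prop) A).symm

end

lemma norm_expSum_term_le {q d : ℕ} {h : ℂ → ℂ} {C x₀ : ℝ} (ht : Tame d h C x₀) (a s : ℂ)
    (hs : 1 ≤ s.re) : ‖h s * exp (a * exp (q * s))‖ ≤
      Real.exp (C * (s.re * Real.exp (d * s.re)) + Real.exp (q * s.re) * dirRe q a s.im) := by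
  rw [norm_mul, norm_exp, re_mul_exp, Real.exp_add]
  gcongr
  exact ht.growth s hs

/-- A bounded shift of the real part changes the error unit l e^{dl} only by a constant factor, so
one `l` can serve a whole box. -/
lemma mul_exp_le_shift {d : ℕ} {l x k : ℝ} (hl : 1 ≤ l) (hx : 0 ≤ x) (hk : 0 ≤ k)
    (hxl : x ≤ l + k) :
    x * Real.exp (d * x) ≤ (1 + k) * Real.exp (k * d) * (l * Real.exp (d * l)) := by
  have h1 : x ≤ (1 + k) * l := by nlinarith
  have h2 : Real.exp (d * x) ≤ Real.exp (k * d) * Real.exp (d * l) := by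
    rw [← Real.exp_add, Real.exp_le_exp]
    have : (d : ℝ) * x ≤ d * (l + k) := by gcongr
    linarith
  calc x * Real.exp (d * x) ≤ ((1 + k) * l) * (Real.exp (k * d) * Real.exp (d * l)) := by gcongr
    _ = _ := by ring

/-- The margin (in units of `l e^{-pl}`) by which an exponent has to dominate. -/
def domConst (C : ℝ) (q d n : ℕ) : ℝ :=
  Real.exp q * (3 * Real.exp (2 * d) * C + (2 * q + 15) * C + 2 * n + 1)

lemma domConst_pos {C : ℝ} (hC : 0 ≤ C) (q d n : ℕ) : 0 < domConst C q d n := by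
  unfold domConst; positivity

section

variable {ι : Type*} [Fintype ι] {p d q : ℕ} {w : ι → ℂ} {h : ι → ℂ → ℂ} {C x₀ : ℝ}

/-- The dominant term determines the sum up to a relative error `1/2`. -/
lemma norm_expSum_div_sub_one_le (hq : q = p + d) (ht : ∀ v, Tame d (h v) C x₀) (hC : 1 ≤ C)
    {j : ι} {l : ℝ} (hl : 2 ≤ l) {s : ℂ} (hs1 : l - 1 ≤ s.re) (hs2 : s.re ≤ l + 2)
    (hdom : ∀ v, v ≠ j → dirRe q (w v) s.im + domConst C q d (Fintype.card ι) *
      (l * Real.exp (-(p * l))) ≤ dirRe q (w j) s.im)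
    (hlow : Real.exp (-((2 * q + 15) * C * (l * Real.exp (d * l)))) ≤ ‖h j s‖) :
    ‖expSum q (fun v => w v - w j) h s / h j s - 1‖ ≤ 1 / 2 := by
  classical
  set n := Fintype.card ι with hn
  set E := l * Real.exp (d * l) with hE
  have hE1 : 1 ≤ E := by
    have : 1 ≤ Real.exp (d * l) := Real.one_le_exp (by positivity)
    nlinarith
  have hj0 : 0 < ‖h j s‖ := lt_of_lt_of_le (Real.exp_pos _) hlow
  have hjne : h j s ≠ 0 := norm_pos_iff.1 hj0
  have hsplit : expSum q (fun v => w v - w j) h s =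
      h j s + ∑ v ∈ Finset.univ.erase j, h v s * exp ((w v - w j) * exp (q * s)) := by
    unfold expSum
    rw [← Finset.add_sum_erase _ _ (Finset.mem_univ j)]
    simp
  rw [hsplit, add_div, div_self hjne, add_sub_cancel_left, norm_div, div_le_iff₀ hj0]
  -- Here `domConst` is used up: e^q because Re s may drop to l - 1, 3e^{2d}C for the growth of `h
  -- v` up to Re s = l + 2, (2q + 15)C for the lower bound of `h j`, and 2n to beat the number of
  -- terms. Since e^{ql} e^{-pl} = e^{dl}, a margin measured in l e^{-pl} becomes an exponent
  -- measured in l e^{dl}.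
  have hterm : ∀ v ∈ Finset.univ.erase j, ‖h v s * exp ((w v - w j) * exp (q * s))‖ ≤
      Real.exp (-(((2 * q + 15) * C + 2 * n) * E)) := by
    intro v hv
    refine (norm_expSum_term_le (ht v) _ s (by linarith)).trans (Real.exp_le_exp.2 ?_)
    have h1 := mul_exp_le_shift (d := d) (l := l) (x := s.re) (k := 2) (by linarith)
      (by linarith) (by norm_num) hs2
    have h2 := hdom v (Finset.ne_of_mem_erase hv)
    have h3 : Real.exp (q * s.re) * dirRe q (w v - w j) s.im ≤
        -((3 * Real.exp (2 * d) * C + (2 * q + 15) * C + 2 * n + 1) * E) := by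
      have h4 : dirRe q (w v - w j) s.im ≤ -(domConst C q d n * (l * Real.exp (-(p * l)))) := by
        rw [dirRe_sub]; linarith
      have h5 : Real.exp (q * (l - 1)) ≤ Real.exp (q * s.re) := by gcongr
      have h6 : 0 ≤ domConst C q d n * (l * Real.exp (-(p * l))) :=
        mul_nonneg (domConst_pos (by linarith) _ _ _).le (by positivity)
      calc Real.exp (q * s.re) * dirRe q (w v - w j) s.im
          ≤ Real.exp (q * s.re) * -(domConst C q d n * (l * Real.exp (-(p * l)))) := by gcongr
        _ ≤ -(Real.exp (q * (l - 1)) * (domConst C q d n * (l * Real.exp (-(p * l))))) := by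
          rw [mul_neg, neg_le_neg_iff]; gcongr
        _ = _ := by
          unfold domConst
          rw [hE]
          have : Real.exp (q * (l - 1)) * Real.exp q * Real.exp (-(p * l)) = Real.exp (d * l) := by
            rw [← Real.exp_add, ← Real.exp_add, hq]
            push_cast
            ring_nf
          rw [← this]
          ring
    have h7 : C * (s.re * Real.exp (d * s.re)) ≤ C * ((1 + 2) * Real.exp (2 * d) * E) := by
      gcongr
    nlinarith
  have hsum := norm_sum_le_of_le _ hterm
  refine hsum.trans ?_
  rw [Finset.sum_const, nsmul_eq_mul]
  have hcard : ((Finset.univ.erase j).card : ℝ) ≤ n := by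
    exact_mod_cast Finset.card_le_univ _
  have hnexp : (n : ℝ) * Real.exp (-(2 * n * E)) ≤ 1 / 2 := by
    have h1 : 2 * (n : ℝ) ≤ Real.exp (2 * n * E) := by
      have := Real.add_one_le_exp (2 * (n : ℝ) * E)
      have : (2 * (n : ℝ)) * 1 ≤ 2 * n * E := by gcongr
      linarith
    rw [Real.exp_neg, ← div_eq_mul_inv, div_le_iff₀ (Real.exp_pos _)]
    linarith
  calc ((Finset.univ.erase j).card : ℝ) * Real.exp (-(((2 * q + 15) * C + 2 * n) * E))
      ≤ n * Real.exp (-(((2 * q + 15) * C + 2 * n) * E)) := by gcongr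
    _ = n * Real.exp (-(2 * n * E)) * Real.exp (-((2 * q + 15) * C * E)) := by
        rw [mul_assoc, ← Real.exp_add]; ring_nf
    _ ≤ 1 / 2 * ‖h j s‖ := by gcongr

/-- Lipschitz continuity in the direction. Applied to `w v - w j`, it limits how far another
exponent can overtake `w j` close to a direction in which `w j` is maximal. -/
lemma dirRe_le_of_close (q : ℕ) (a : ℂ) (y θ : ℝ) :
    dirRe q a y ≤ dirRe q a θ + ‖a‖ * (q * |y - θ|) := by
  have h1 : dirRe q a y - dirRe q a θ =
      (a * (exp (q * θ * I) * (exp (q * (y - θ) * I) - 1))).re := by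
    unfold dirRe
    rw [← sub_re, mul_sub, ← exp_add, ← mul_sub, mul_one]
    congr 4
    ring
  have h2 : ‖exp (q * (y - θ) * I) - 1‖ ≤ q * |y - θ| := by
    have := Real.norm_exp_I_mul_ofReal_sub_one_le (x := q * (y - θ))
    rw [Real.norm_eq_abs, abs_mul, Nat.abs_cast] at this
    convert this using 4
    push_cast
    ring
  have h3 : ‖exp ((q : ℂ) * θ * I)‖ = 1 := by
    have := norm_exp_ofReal_mul_I (q * θ)
    push_cast at this
    exact this
  have h4 := re_le_norm (a * (exp (q * θ * I) * (exp (q * (y - θ) * I) - 1)))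
  rw [norm_mul, norm_mul, h3, one_mul, ← h1] at h4
  have : ‖a‖ * ‖exp (q * (y - θ) * I) - 1‖ ≤ ‖a‖ * (q * |y - θ|) := by gcongr
  linarith

/-- Upper bound for the normalized sum near a direction in which `w_j` is maximal. -/
lemma norm_expSum_le_of_close (hq : q = p + d) (ht : ∀ v, Tame d (h v) C x₀) (hC : 1 ≤ C)
    {A : ℝ} (hA : ∀ v, ‖w v‖ ≤ A) {j : ι} {θ : ℝ}
    (hmax : ∀ v, dirRe q (w v) θ ≤ dirRe q (w j) θ) {l ρ : ℝ} (hl : 2 ≤ l) (hρ : 0 ≤ ρ) {s : ℂ}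
    (hs1 : 1 ≤ s.re) (hs2 : s.re ≤ l + 3) (him : |s.im - θ| ≤ ρ * (l * Real.exp (-(p * l)))) :
    ‖expSum q (fun v => w v - w j) h s‖ ≤ Fintype.card ι *
      Real.exp ((4 * Real.exp (3 * d) * C + Real.exp (3 * q) * (2 * A * q * ρ)) *
        (l * Real.exp (d * l))) := by
  have hA0 : 0 ≤ A := (norm_nonneg _).trans (hA j)
  unfold expSum
  have hterm : ∀ v ∈ Finset.univ, ‖h v s * exp ((w v - w j) * exp (q * s))‖ ≤
      Real.exp ((4 * Real.exp (3 * d) * C + Real.exp (3 * q) * (2 * A * q * ρ)) *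
        (l * Real.exp (d * l))) := by
    intro v _
    refine (norm_expSum_term_le (ht v) _ s hs1).trans (Real.exp_le_exp.2 ?_)
    have h1 := mul_exp_le_shift (d := d) (l := l) (x := s.re) (k := 3) (by linarith)
      (by linarith) (by norm_num) hs2
    have h2 : C * (s.re * Real.exp (d * s.re)) ≤
        C * ((1 + 3) * Real.exp (3 * d) * (l * Real.exp (d * l))) := by gcongr
    have h3 := dirRe_le_of_close q (w v - w j) s.im θ
    have h4 : dirRe q (w v - w j) θ ≤ 0 := by rw [dirRe_sub]; linarith [hmax v]
    have h5 : ‖w v - w j‖ ≤ 2 * A := (norm_sub_le _ _).trans (by linarith [hA v, hA j])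
    have h6 : ‖w v - w j‖ * (q * |s.im - θ|) ≤
        2 * A * (q * (ρ * (l * Real.exp (-(p * l))))) := by gcongr
    have h7 : Real.exp (q * s.re) ≤ Real.exp (q * (l + 3)) := by gcongr
    have h8 : Real.exp (q * s.re) * dirRe q (w v - w j) s.im ≤
        Real.exp (q * (l + 3)) * (2 * A * (q * (ρ * (l * Real.exp (-(p * l)))))) := by
      calc Real.exp (q * s.re) * dirRe q (w v - w j) s.im
          ≤ Real.exp (q * s.re) * (2 * A * (q * (ρ * (l * Real.exp (-(p * l)))))) := by
            gcongr; linarith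
        _ ≤ _ := by gcongr
    have h9 : Real.exp (q * (l + 3)) * (2 * A * (q * (ρ * (l * Real.exp (-(p * l)))))) =
        Real.exp (3 * q) * (2 * A * q * ρ) * (l * Real.exp (d * l)) := by
      have : Real.exp (q * (l + 3)) * Real.exp (-(p * l)) =
          Real.exp (3 * q) * Real.exp (d * l) := by
        rw [← Real.exp_add, ← Real.exp_add, hq]
        push_cast
        ring_nf
      linear_combination (2 * A * q * ρ * l) * this
    linarith
  refine (norm_sum_le_of_le _ hterm).trans (le_of_eq ?_)
  rw [Finset.sum_const, nsmul_eq_mul, Finset.card_univ]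

end


/-- N intervals of length 2e^{-(q+1)l} cannot fill an interval of length e^{-pl} when N = O(e^{dl}),
because q = p + d leaves a spare factor e^{-l}. This is what makes it possible to choose sides of
boxes away from the zeros of the coefficients. -/
lemma exp_gap {p d q : ℕ} (hq : q = p + d) {C l N : ℝ} (hl : 8 * C ≤ l)
    (hN : N ≤ 4 * C * Real.exp (d * l)) :
    2 * Real.exp (-((q + 1) * l)) * N < Real.exp (-(p * l)) := by
  have h1 : 2 * Real.exp (-((q + 1) * l)) * N ≤
      2 * Real.exp (-((q + 1) * l)) * (4 * C * Real.exp (d * l)) := by gcongr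
  refine h1.trans_lt ?_
  have h2 : Real.exp (-((q + 1) * l)) * Real.exp (d * l) = Real.exp (-(p * l)) * Real.exp (-l) := by
    rw [← Real.exp_add, ← Real.exp_add, hq]; push_cast; ring_nf
  have h3 : 8 * C < Real.exp l := by linarith [Real.add_one_le_exp l]
  have h4 : 8 * C * Real.exp (-l) < 1 := by
    rw [Real.exp_neg, ← div_eq_mul_inv, div_lt_one (Real.exp_pos _)]; exact h3
  calc 2 * Real.exp (-((q + 1) * l)) * (4 * C * Real.exp (d * l))
      = 8 * C * (Real.exp (-((q + 1) * l)) * Real.exp (d * l)) := by ring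
    _ = (8 * C * Real.exp (-l)) * Real.exp (-(p * l)) := by rw [h2]; ring
    _ < 1 * Real.exp (-(p * l)) := by gcongr
    _ = _ := one_mul _

lemma half_le_norm_of_norm_sub_one_le {z : ℂ} (h : ‖z - 1‖ ≤ 1 / 2) : 1 / 2 ≤ ‖z‖ := by
  have := norm_sub_norm_le (1 : ℂ) z
  rw [norm_one, norm_sub_rev] at this
  linarith

/-! ### Rouché where one term dominates, and argument variation across a critical ray -/

section

variable {ι : Type*} [Fintype ι] {p d q : ℕ} {w : ι → ℂ} {h : ι → ℂ → ℂ} {C x₀ : ℝ}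

/-- In a region where one exponent dominates there are few zeros. -/
lemma zerosIn_expSum_le_of_dominant (hq : q = p + d) (ht : ∀ v, Tame d (h v) C x₀) (hC : 1 ≤ C)
    {j : ι} {l θ A B : ℝ} (hl0 : x₀ ≤ l) (hl2 : 2 ≤ l) (hl8 : 8 * C ≤ l)
    (hA : θ - 1 ≤ A) (hB : B ≤ θ + 1) (hAB : A + 2 * Real.exp (-(p * l)) ≤ B)
    (hη : Real.exp (-(p * l)) ≤ 1)
    (hdom : ∀ y, A ≤ y → y ≤ B → ∀ v, v ≠ j → dirRe q (w v) y +
      domConst C q d (Fintype.card ι) * (l * Real.exp (-(p * l))) ≤ dirRe q (w j) y) :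
    (zerosIn (expSum q w h) {s | l ≤ s.re ∧ s.re ≤ l + 1 ∧ A + Real.exp (-(p * l)) ≤ s.im ∧
      s.im ≤ B - Real.exp (-(p * l))} : ℝ) ≤ 2 * C * Real.exp (d * l) := by
  classical
  set η := Real.exp (-(p * l)) with hηdef
  have hη0 : 0 < η := Real.exp_pos _
  obtain ⟨Z, hZc, hlow, -, hcnt⟩ := (ht j).localStructure hC q hl0 (by linarith) θ
  set κ := Real.exp (-((q + 1) * l)) with hκ
  have hgap : ∀ f : ℂ → ℝ, 2 * κ * (Z.image f).card < η := by
    intro f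
    refine exp_gap hq hl8 ?_
    have h1 : ((Z.image f).card : ℝ) ≤ Z.card := by exact_mod_cast Finset.card_image_le
    have : 0 ≤ C * Real.exp (d * l) := by positivity
    linarith
  -- Each side is moved by less than η, to a line that keeps its distance from the zeros of `h j`.
  -- The box still contains the counted region, and its heights stay in [A, B], where `w j`
  -- dominates.
  obtain ⟨X₀, h1, h2, h3, -⟩ := exists_generic (a := l - η) (b := l) (Real.exp_nonneg _)
    (Z.image re) finite_empty (by linarith [hgap re])
  obtain ⟨X₁, h4, h5, h6, -⟩ := exists_generic (a := l + 1) (b := l + 1 + η) (Real.exp_nonneg _)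
    (Z.image re) finite_empty (by linarith [hgap re])
  obtain ⟨Y₀, h7, h8, h9, -⟩ := exists_generic (a := A) (b := A + η) (Real.exp_nonneg _)
    (Z.image im) finite_empty (by linarith [hgap im])
  obtain ⟨Y₁, h10, h11, h12, -⟩ := exists_generic (a := B - η) (b := B) (Real.exp_nonneg _)
    (Z.image im) finite_empty (by linarith [hgap im])
  have hclose : ∀ s ∈ boxBoundary X₀ X₁ Y₀ Y₁,
      ‖expSum q (fun v => w v - w j) h s / h j s - 1‖ ≤ 1 / 2 ∧ h j s ≠ 0 := by
    rintro s ⟨⟨hs1, hs2, hs3, hs4⟩, hs5⟩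
    have hlow' := hlow s (by rw [abs_le]; constructor <;> linarith)
      (by rw [abs_le]; constructor <;> linarith) (by
        intro a ha
        have hre := abs_re_le_norm (s - a)
        have him := abs_im_le_norm (s - a)
        rw [sub_re] at hre
        rw [sub_im] at him
        rcases hs5 with hs | hs | hs | hs
        · exact (h3 _ (Finset.mem_image_of_mem re ha)).trans (hs ▸ hre)
        · exact (h6 _ (Finset.mem_image_of_mem re ha)).trans (hs ▸ hre)
        · exact (h9 _ (Finset.mem_image_of_mem im ha)).trans (hs ▸ him)
        · exact (h12 _ (Finset.mem_image_of_mem im ha)).trans (hs ▸ him))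
    refine ⟨norm_expSum_div_sub_one_le hq ht hC hl2 (by linarith) (by linarith)
      (hdom s.im (by linarith) (by linarith)) hlow', ?_⟩
    exact norm_pos_iff.1 (lt_of_lt_of_le (Real.exp_pos _) hlow')
  have hent : ∀ v, Differentiable ℂ (h v) := fun v => (ht v).entire
  have hrouche := zerosIn_openBox_eq (differentiable_expSum (q := q) (w := fun v => w v - w j) hent)
    (hent j) (by linarith : X₀ < X₁) (by linarith : Y₀ < Y₁) (fun s hs => (hclose s hs).2)
    (fun s hs => re_pos_of_norm_sub_one_le (hclose s hs).1)
  have hF0 : expSum q (fun v => w v - w j) h ≠ 0 := by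
    intro h0
    have := (hclose (X₀ + Y₀ * I) (by simp [boxBoundary]; constructor <;> linarith)).1
    rw [h0] at this
    norm_num at this
  rw [← zerosIn_expSum_sub hent j]
  have hmono := zerosIn_mono (differentiable_expSum hent) hF0
    (A := {s | l ≤ s.re ∧ s.re ≤ l + 1 ∧ A + η ≤ s.im ∧ s.im ≤ B - η})
    (isBounded_openBox X₀ X₁ Y₀ Y₁) (fun s hs _ =>
      ⟨by linarith [hs.1], by linarith [hs.2.1], by linarith [hs.2.2.1], by linarith [hs.2.2.2]⟩)
  rw [hrouche] at hmono
  refine le_trans (by exact_mod_cast hmono) (hcnt _ ?_)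
  rintro s ⟨hs1, hs2, hs3, hs4⟩
  constructor <;> rw [abs_le] <;> constructor <;> linarith

/-- The constant in the bound for the variation of the argument across a critical ray. -/
def vertConst (C A κ : ℝ) (q d n : ℕ) : ℝ :=
  12 * (4 * Real.exp (3 * d) * C +
    Real.exp (3 * q) * (2 * A * q * (13 * (domConst C q d n / κ))) + n + (2 * q + 15) * C + 1) +
    12 * C + 4

lemma exists_eq_add_sign_mul {σ θ u₀ u₁ t : ℝ} (hσ : σ = 1 ∨ σ = -1) (hu : u₀ ≤ u₁)
    (ht : t ∈ uIcc (θ + σ * u₀) (θ + σ * u₁)) : ∃ u, u₀ ≤ u ∧ u ≤ u₁ ∧ t = θ + σ * u := by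
  refine ⟨σ * (t - θ), ?_⟩
  rcases hσ with rfl | rfl
  · rw [uIcc_of_le (by linarith)] at ht
    exact ⟨by linarith [ht.1], by linarith [ht.2], by ring⟩
  · rw [uIcc_of_ge (by linarith)] at ht
    exact ⟨by linarith [ht.2], by linarith [ht.1], by ring⟩

/-- The variation of the argument on a vertical segment that starts at a critical ray. -/
lemma abs_argVar_vertical_le (hq : q = p + d) (ht : ∀ v, Tame d (h v) C x₀) (hC : 1 ≤ C)
    {A : ℝ} (hA : ∀ v, ‖w v‖ ≤ A) {j : ι} {θ κ U σ : ℝ} (hκ : 0 < κ) (hσ : σ = 1 ∨ σ = -1)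
    (hmax : ∀ v, dirRe q (w v) θ ≤ dirRe q (w j) θ)
    (hdom : ∀ u, 0 ≤ u → u ≤ U → ∀ v, v ≠ j →
      dirRe q (w v) (θ + σ * u) + κ * u ≤ dirRe q (w j) (θ + σ * u))
    {l x : ℝ} (hl3 : 3 ≤ l) (hU : U ≤ 1)
    (hsm : 12 * (domConst C q d (Fintype.card ι) / κ * (l * Real.exp (-(p * l)))) ≤ U)
    (hx1 : l - 1 ≤ x) (hx2 : x ≤ l + 2)
    (hlow : ∀ y : ℝ, |y - θ| ≤ 2 →
      Real.exp (-((2 * q + 15) * C * (l * Real.exp (d * l)))) ≤ ‖h j (x + y * I)‖)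
    (hvar : ∀ (a e : ℂ) (t₀ t₁ : ℝ), ‖e‖ = 1 →
      (∀ t ∈ uIcc t₀ t₁, |(a + t * e).re - l| ≤ 3 ∧ |(a + t * e).im - θ| ≤ 2 ∧
        h j (a + t * e) ≠ 0) → |argVar (h j) a e t₀ t₁| ≤ 12 * (C * Real.exp (d * l)))
    (hF0 : ∀ y : ℝ, |y - θ| ≤ 2 → expSum q (fun v => w v - w j) h (x + y * I) ≠ 0) :
    |argVar (expSum q (fun v => w v - w j) h) x I θ (θ + σ * U)| ≤
      vertConst C A κ q d (Fintype.card ι) * (l * Real.exp (d * l)) := by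
  set n := Fintype.card ι with hn
  set c' := domConst C q d n / κ with hc'
  set E := l * Real.exp (d * l) with hE
  set δ := c' * (l * Real.exp (-(p * l))) with hδ
  set Fj := expSum q (fun v => w v - w j) h with hFj
  have hA0 : 0 ≤ A := (norm_nonneg _).trans (hA j)
  have hc'0 : 0 < c' := div_pos (domConst_pos (by linarith) _ _ _) hκ
  have hδ0 : 0 < δ := by positivity
  have hσ1 : |σ| = 1 := by rcases hσ with rfl | rfl <;> simp
  have hexpd : 1 ≤ Real.exp (d * l) := Real.one_le_exp (by positivity)
  have hE1 : 1 ≤ E := by nlinarith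
  have hn1 : (1 : ℝ) ≤ n := by
    rw [hn]
    exact_mod_cast Fintype.card_pos_iff.2 ⟨j⟩
  have hent : ∀ v, Differentiable ℂ (h v) := fun v => (ht v).entire
  have hFd : Differentiable ℂ Fj := differentiable_expSum hent
  have habs : ∀ u, 0 ≤ u → u ≤ U → |θ + σ * u - θ| ≤ 2 := by
    intro u h1 h2
    rw [add_sub_cancel_left, abs_mul, hσ1, one_mul, abs_of_nonneg h1]
    linarith
  have hclose : ∀ u, δ ≤ u → u ≤ U → ‖Fj (x + (θ + σ * u : ℝ) * I) / h j (x + (θ + σ * u : ℝ) * I)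
      - 1‖ ≤ 1 / 2 := by
    intro u h1 h2
    have hy := habs u (by linarith) h2
    refine norm_expSum_div_sub_one_le hq ht hC (by linarith) (s := x + (θ + σ * u : ℝ) * I)
      (by simpa using hx1) (by simpa using hx2) ?_ (hlow _ hy)
    intro v hv
    have h3 := hdom u (by linarith) h2 v hv
    have h4 : domConst C q d n * (l * Real.exp (-(p * l))) = κ * δ := by
      rw [hδ, hc']; field_simp
    have h5 : κ * δ ≤ κ * u := by gcongr
    have h6 : ((x : ℂ) + (θ + σ * u : ℝ) * I).im = θ + σ * u := by simp
    rw [h6, h4]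
    linarith
  have hhj : ∀ y : ℝ, |y - θ| ≤ 2 → h j (x + y * I) ≠ 0 := fun y hy =>
    norm_pos_iff.1 (lt_of_lt_of_le (Real.exp_pos _) (hlow y hy))
  have hsub : ∀ u₀ u₁, 0 ≤ u₀ → u₀ ≤ u₁ → u₁ ≤ U → ∀ t ∈ uIcc (θ + σ * u₀) (θ + σ * u₁),
      Fj (x + t * I) ≠ 0 := by
    intro u₀ u₁ h0 h1 h2 t htt
    obtain ⟨u, h3, h4, rfl⟩ := exists_eq_add_sign_mul hσ h1 htt
    exact hF0 _ (habs u (by linarith) (by linarith))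
  -- the part near the critical ray
  have hδU : 12 * δ ≤ U := hsm
  -- The centre is the first point of the segment where the domination of `w j` is guaranteed, so
  -- the sum is bounded below there. Radius 12δ places all of [θ, θ + σδ] in the twelfth of the disc
  -- required by `abs_argVar_le_of_growth`.
  set c : ℂ := x + (θ + σ * δ : ℝ) * I with hc
  have hcn := half_le_norm_of_norm_sub_one_le (hclose δ le_rfl (by linarith))
  have hlowc := hlow (θ + σ * δ) (habs δ hδ0.le (by linarith))
  have hFc : 1 / 2 * Real.exp (-((2 * q + 15) * C * E)) ≤ ‖Fj c‖ := by
    rw [norm_div, le_div_iff₀ (lt_of_lt_of_le (Real.exp_pos _) hlowc)] at hcn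
    linarith
  -- In order: the coefficients up to Re s = l + 3, the exponentials within 13δ of the ray (offset δ
  -- of the centre plus radius 12δ), the number of terms, the lower bound at the centre, and a spare
  -- 1.
  set K₁ := 4 * Real.exp (3 * d) * C + Real.exp (3 * q) * (2 * A * q * (13 * c')) + n +
    (2 * q + 15) * C + 1 with hK₁
  have hK₁0 : 0 < K₁ := by positivity
  have hgrow : ∀ s ∈ Metric.closedBall c (12 * δ), ‖Fj s‖ ≤ Real.exp (K₁ * E) * ‖Fj c‖ := by
    intro s hs
    rw [Metric.mem_closedBall, dist_eq] at hs
    have hre := (abs_re_le_norm (s - c)).trans hs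
    have him := (abs_im_le_norm (s - c)).trans hs
    rw [abs_le] at hre
    have hcre : c.re = x := by simp [hc]
    have hcim : c.im = θ + σ * δ := by simp [hc]
    rw [sub_re, hcre] at hre
    rw [sub_im, hcim] at him
    have him' : |s.im - θ| ≤ 13 * c' * (l * Real.exp (-(p * l))) := by
      have h1 : s.im - θ = (s.im - (θ + σ * δ)) + σ * δ := by ring
      have h2 := abs_add_le (s.im - (θ + σ * δ)) (σ * δ)
      rw [abs_mul, hσ1, one_mul, abs_of_pos hδ0, ← h1] at h2
      linarith
    have h1 := norm_expSum_le_of_close hq ht hC hA hmax (l := l) (ρ := 13 * c') (s := s)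
      (by linarith) (by positivity) (by linarith) (by linarith) him'
    refine h1.trans ?_
    have h2 : (n : ℝ) ≤ Real.exp (n * E - Real.log 2) := by
      have h3 := Real.add_one_le_exp (n * E - Real.log 2)
      have h4 := Real.log_two_lt_d9
      have h5 : (n : ℝ) * 1 ≤ n * E := by gcongr
      linarith
    have h6 : Real.exp (K₁ * E) * (1 / 2 * Real.exp (-((2 * q + 15) * C * E))) ≤
        Real.exp (K₁ * E) * ‖Fj c‖ := by gcongr
    refine le_trans ?_ h6
    have h7 : (1 : ℝ) / 2 = Real.exp (-Real.log 2) := by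
      rw [Real.exp_neg, Real.exp_log (by norm_num), one_div]
    rw [h7, ← Real.exp_add, ← Real.exp_add]
    refine (mul_le_mul_of_nonneg_right h2 (Real.exp_nonneg _)).trans ?_
    rw [← Real.exp_add, Real.exp_le_exp, hK₁]
    nlinarith
  have hFc0 : Fj c ≠ 0 := hF0 _ (habs δ hδ0.le (by linarith))
  have hnear : |argVar Fj x I θ (θ + σ * δ)| ≤ 12 * (K₁ * E) := by
    have h0 : θ = θ + σ * 0 := by ring
    refine abs_argVar_le_of_growth hFd (c := c) (R := 12 * δ) (by positivity) (by positivity)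
      hFc0 hgrow norm_I ?_ ?_
    · intro t htt
      rw [h0] at htt
      obtain ⟨u, h3, h4, rfl⟩ := exists_eq_add_sign_mul hσ hδ0.le (by simpa using htt)
      rw [Metric.mem_closedBall, dist_eq, hc, add_sub_add_left_eq_sub, ← sub_mul, norm_mul, norm_I,
        mul_one, ← ofReal_sub, norm_real, Real.norm_eq_abs, add_sub_add_left_eq_sub, ← mul_sub,
        abs_mul, hσ1, one_mul, abs_sub_comm, abs_of_nonneg (by linarith)]
      linarith
    · have := hsub 0 δ le_rfl hδ0.le (by linarith)
      rwa [← h0] at this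
  -- From distance δ on, the normalised sum follows `h j` up to an angle π, and the argument of `h
  -- j` varies only by O(e^{dl}).
  have hfar : |argVar Fj x I (θ + σ * δ) (θ + σ * U)| ≤ 12 * (C * Real.exp (d * l)) + Real.pi := by
    have h1 := abs_argVar_sub_argVar_le hFd (hent j) (a := x) (e := I) (t₀ := θ + σ * δ)
      (t₁ := θ + σ * U) (fun t htt => by
        obtain ⟨u, h3, h4, rfl⟩ := exists_eq_add_sign_mul hσ (by linarith) htt
        exact hhj _ (habs u (by linarith) h4)) (fun t htt => by
        obtain ⟨u, h3, h4, rfl⟩ := exists_eq_add_sign_mul hσ (by linarith) htt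
        exact re_pos_of_norm_sub_one_le (hclose u h3 h4))
    have h2 := hvar x I (θ + σ * δ) (θ + σ * U) norm_I (fun t htt => by
        obtain ⟨u, h3, h4, rfl⟩ := exists_eq_add_sign_mul hσ (by linarith) htt
        refine ⟨?_, ?_, hhj _ (habs u (by linarith) h4)⟩
        · simp only [add_re, ofReal_re, mul_re, I_re, mul_zero, ofReal_im, I_im, mul_one, sub_self,
            add_zero]
          rw [abs_le]; constructor <;> linarith
        · have := habs u (by linarith) h4
          simpa using this)
    have h3 := abs_sub_abs_le_abs_sub (argVar Fj x I (θ + σ * δ) (θ + σ * U))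
      (argVar (h j) x I (θ + σ * δ) (θ + σ * U))
    linarith
  have hadd := argVar_add hFd (a := x) (e := I) (t₀ := θ) (t₁ := θ + σ * δ) (t₂ := θ + σ * U)
    (by simpa using hsub 0 δ le_rfl hδ0.le (by linarith))
    (hsub δ U hδ0.le (by linarith) le_rfl)
  rw [← hadd]
  refine (abs_add_le _ _).trans ?_
  have hpi := Real.pi_lt_d2
  have h8 : C * Real.exp (d * l) ≤ C * E := by
    have : Real.exp (d * l) ≤ E := by rw [hE]; exact le_mul_of_one_le_left (by positivity) (by linarith)
    gcongr
  have h9 : vertConst C A κ q d n = 12 * K₁ + 12 * C + 4 := rfl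
  rw [h9]
  nlinarith

end


/-! ### Counting zeros in a box around a critical ray -/

/-- `w_j` dominates on `[θ - ε, θ]` and `w_k` dominates on `[θ, θ + ε]`. -/
structure DominantPair {ι : Type*} (q : ℕ) (w : ι → ℂ) (θ κ ε : ℝ) (j k : ι) : Prop where
  kappa_pos : 0 < κ
  eps_pos : 0 < ε
  eps_le : ε ≤ 1
  below : ∀ u, 0 ≤ u → u ≤ ε → ∀ v, v ≠ j →
    dirRe q (w v) (θ - u) + κ * u ≤ dirRe q (w j) (θ - u)
  above : ∀ u, 0 ≤ u → u ≤ ε → ∀ v, v ≠ k →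
    dirRe q (w v) (θ + u) + κ * u ≤ dirRe q (w k) (θ + u)
  diff : (w k - w j) * exp (q * θ * I) = -I * (‖w k - w j‖ : ℂ)

lemma DominantPair.max_left {ι : Type*} {q : ℕ} {w : ι → ℂ} {θ κ ε : ℝ} {j k : ι}
    (hp : DominantPair q w θ κ ε j k) (v : ι) : dirRe q (w v) θ ≤ dirRe q (w j) θ := by
  rcases eq_or_ne v j with rfl | hv
  · exact le_rfl
  · simpa using hp.below 0 le_rfl hp.eps_pos.le v hv

lemma DominantPair.max_right {ι : Type*} {q : ℕ} {w : ι → ℂ} {θ κ ε : ℝ} {j k : ι}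
    (hp : DominantPair q w θ κ ε j k) (v : ι) : dirRe q (w v) θ ≤ dirRe q (w k) θ := by
  rcases eq_or_ne v k with rfl | hv
  · exact le_rfl
  · simpa using hp.above 0 le_rfl hp.eps_pos.le v hv

/-- The source of the main term. On the critical ray the two leading exponents have equal real part,
and by `diff` their difference is i |w_j - w_k| e^{qx}; the sign reflects that `j` dominates below
the ray and `k` above it. -/
lemma DominantPair.im_sub {ι : Type*} {q : ℕ} {w : ι → ℂ} {θ κ ε : ℝ} {j k : ι}
    (hp : DominantPair q w θ κ ε j k) (x : ℝ) :
    (w j * exp (q * (x + θ * I))).im - (w k * exp (q * (x + θ * I))).im =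
      ‖w j - w k‖ * Real.exp (q * x) := by
  rw [← sub_im, ← sub_mul, mul_add, exp_add, mul_left_comm, ← neg_sub (w k), neg_mul,
    ← mul_assoc (q : ℂ), hp.diff]
  have : (q : ℂ) * x = ((q * x : ℝ) : ℂ) := by push_cast; rfl
  rw [this, ← ofReal_exp, im_ofReal_mul, norm_neg]
  simp [mul_comm]

section

variable {ι : Type*} [Fintype ι] {p d q : ℕ} {w : ι → ℂ} {h : ι → ℂ → ℂ} {C x₀ : ℝ}

lemma argVar_expSum (hh : ∀ v, Differentiable ℂ (h v)) (j : ι) {a e : ℂ} {t₀ t₁ : ℝ}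
    (h0 : ∀ t ∈ uIcc t₀ t₁, expSum q (fun v => w v - w j) h (a + t * e) ≠ 0) :
    argVar (expSum q w h) a e t₀ t₁ = argVar (expSum q (fun v => w v - w j) h) a e t₀ t₁ +
      (w j * exp (q * (a + t₁ * e)) - w j * exp (q * (a + t₀ * e))).im := by
  have : expSum q w h =
      fun s => expSum q (fun v => w v - w j) h s * exp (w j * exp (q * s)) :=
    funext (expSum_eq j)
  rw [this, argVar_mul (h := fun s => exp (w j * exp (q * s))) (differentiable_expSum hh) (by fun_prop) h0
      (fun t _ => exp_ne_zero _),
    argVar_exp (φ := fun s => w j * exp (q * s)) (by fun_prop)]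

lemma expSum_sub_ne_zero {j : ι} {s : ℂ} (hs : expSum q w h s ≠ 0) :
    expSum q (fun v => w v - w j) h s ≠ 0 := by
  intro h0
  exact hs (by rw [expSum_eq j, h0, zero_mul])

/-- The variation of the argument on a horizontal segment in a dominated region. -/
lemma abs_argVar_horizontal_le (hq : q = p + d) (ht : ∀ v, Tame d (h v) C x₀) (hC : 1 ≤ C)
    {j : ι} {l θ y X₀ X₁ : ℝ} (hl : 3 ≤ l) (hy : |y - θ| ≤ 1) (hX : X₀ ≤ X₁) (hX₀ : l - 1 ≤ X₀)
    (hX₁ : X₁ ≤ l + 2)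
    (hdom : ∀ v, v ≠ j → dirRe q (w v) y + domConst C q d (Fintype.card ι) *
      (l * Real.exp (-(p * l))) ≤ dirRe q (w j) y)
    (hlow : ∀ x : ℝ, |x - l| ≤ 3 →
      Real.exp (-((2 * q + 15) * C * (l * Real.exp (d * l)))) ≤ ‖h j (x + y * I)‖)
    (hvar : ∀ (a e : ℂ) (t₀ t₁ : ℝ), ‖e‖ = 1 →
      (∀ t ∈ uIcc t₀ t₁, |(a + t * e).re - l| ≤ 3 ∧ |(a + t * e).im - θ| ≤ 2 ∧
        h j (a + t * e) ≠ 0) → |argVar (h j) a e t₀ t₁| ≤ 12 * (C * Real.exp (d * l))) :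
    |argVar (expSum q (fun v => w v - w j) h) (y * I) 1 X₀ X₁| ≤
      (12 * C + 4) * (l * Real.exp (d * l)) := by
  have hent : ∀ v, Differentiable ℂ (h v) := fun v => (ht v).entire
  have hpt : ∀ t ∈ uIcc X₀ X₁, |t - l| ≤ 3 ∧ (y * I + t * 1 : ℂ) = t + y * I := by
    intro t htt
    rw [uIcc_of_le hX] at htt
    exact ⟨by rw [abs_le]; constructor <;> linarith [htt.1, htt.2], by ring⟩
  have hne : ∀ t ∈ uIcc X₀ X₁, h j (y * I + t * 1) ≠ 0 := by
    intro t htt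
    rw [(hpt t htt).2]
    exact norm_pos_iff.1 (lt_of_lt_of_le (Real.exp_pos _) (hlow t (hpt t htt).1))
  have h1 := abs_argVar_sub_argVar_le (differentiable_expSum (q := q)
    (w := fun v => w v - w j) hent) (hent j) (a := y * I) (e := 1) (t₀ := X₀) (t₁ := X₁) hne
    (fun t htt => by
      have h2 := hpt t htt
      rw [h2.2]
      rw [uIcc_of_le hX] at htt
      refine re_pos_of_norm_sub_one_le (norm_expSum_div_sub_one_le hq ht hC (l := l) (by linarith)
        ?_ ?_ ?_ (hlow t h2.1))
      · simp only [add_re, ofReal_re, mul_re, I_re, mul_zero, ofReal_im, I_im, mul_one, sub_self,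
          add_zero]
        linarith [htt.1]
      · simp only [add_re, ofReal_re, mul_re, I_re, mul_zero, ofReal_im, I_im, mul_one, sub_self,
          add_zero]
        linarith [htt.2]
      · simpa using hdom)
  have h2 := hvar (y * I) 1 X₀ X₁ norm_one (fun t htt => ⟨by simpa using (hpt t htt).1,
    by simp; linarith, hne t htt⟩)
  have h3 := abs_sub_abs_le_abs_sub (argVar (expSum q (fun v => w v - w j) h) (y * I) 1 X₀ X₁)
    (argVar (h j) (y * I) 1 X₀ X₁)
  have hpi := Real.pi_lt_d2
  have hE : Real.exp (d * l) ≤ l * Real.exp (d * l) :=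
    le_mul_of_one_le_left (by positivity) (by linarith)
  have hE1 : 1 ≤ Real.exp (d * l) := Real.one_le_exp (by positivity)
  have h8 : C * Real.exp (d * l) ≤ C * (l * Real.exp (d * l)) := by gcongr
  linarith

set_option maxHeartbeats 800000 in
/-- The number of zeros in a box around a critical ray. -/
lemma exists_box_count (hq : q = p + d) (ht : ∀ v, Tame d (h v) C x₀) (hC : 1 ≤ C)
    {A : ℝ} (hA : ∀ v, ‖w v‖ ≤ A) {j k : ι} {θ κ ε : ℝ} (hp : DominantPair q w θ κ ε j k)
    (hF : expSum q w h ≠ 0) {l a b : ℝ} (hl0 : x₀ ≤ l) (hl3 : 3 ≤ l) (hl8 : 8 * C ≤ l)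
    (hsm : 48 * ((domConst C q d (Fintype.card ι) / κ + 1) * (l * Real.exp (-(p * l)))) ≤ ε)
    (ha : l - 1 ≤ a) (hab : a + Real.exp (-(p * l)) ≤ b) (hb : b + Real.exp (-(p * l)) ≤ l + 2) :
    ∃ X₀ X₁ Y₀ Y₁ : ℝ, a < X₀ ∧ X₀ < a + Real.exp (-(p * l)) ∧ b < X₁ ∧
      X₁ < b + Real.exp (-(p * l)) ∧ θ - ε / 2 < Y₀ ∧ Y₀ < θ - ε / 4 ∧ θ + ε / 4 < Y₁ ∧
      Y₁ < θ + ε / 2 ∧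
      |(zerosIn (expSum q w h) (openBox X₀ X₁ Y₀ Y₁) : ℝ) -
        ‖w j - w k‖ * (Real.exp (q * X₁) - Real.exp (q * X₀)) / (2 * Real.pi)| ≤
        vertConst C A κ q d (Fintype.card ι) * (l * Real.exp (d * l)) := by
  classical
  have hκ := hp.kappa_pos
  have hε := hp.eps_pos
  have hε1 := hp.eps_le
  set n := Fintype.card ι with hn
  set D := domConst C q d n with hD
  have hD0 : 0 < D := domConst_pos (by linarith) _ _ _
  set η := Real.exp (-(p * l)) with hηdef
  have hη0 : 0 < η := Real.exp_pos _
  have hlη : η ≤ l * η := by nlinarith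
  have hDκ : 0 < D / κ := div_pos hD0 hκ
  have hsm1 : 48 * (l * η) ≤ ε := by nlinarith [mul_pos hDκ (by positivity : 0 < l * η)]
  have hsm2 : 48 * (D / κ * (l * η)) ≤ ε := by nlinarith [(by positivity : 0 < l * η)]
  have hsm3 : 48 * (D * (l * η)) ≤ κ * ε := by
    have : D * (l * η) = κ * (D / κ * (l * η)) := by field_simp
    rw [this]
    nlinarith
  have hent : ∀ v, Differentiable ℂ (h v) := fun v => (ht v).entire
  have hFd : Differentiable ℂ (expSum q w h) := differentiable_expSum hent
  obtain ⟨Zj, hZjc, hlowj, hvarj, -⟩ := (ht j).localStructure hC q hl0 (by linarith) θ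
  obtain ⟨Zk, hZkc, hlowk, hvark, -⟩ := (ht k).localStructure hC q hl0 (by linarith) θ
  set r := Real.exp (-((q + 1) * l)) with hr
  have hr0 : 0 < r := Real.exp_pos _
  have hgap : ∀ f : ℂ → ℝ, 2 * r * ((Zj ∪ Zk).image f).card < η := by
    intro f
    refine exp_gap hq hl8 ?_
    have h1 : (((Zj ∪ Zk).image f).card : ℝ) ≤ Zj.card + Zk.card := by
      exact_mod_cast Finset.card_image_le.trans (Finset.card_union_le _ _)
    linarith
  -- No term dominates where a vertical side crosses the ray, so the zeros of the sum itself must be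
  -- avoided there too; this excludes finitely many abscissas. On the horizontal sides domination
  -- already rules out zeros.
  have hfin := finite_zeros hFd hF (isBounded_re_im (l - 1) (l + 2) (θ - 2) (θ + 2))
  have hfinre := hfin.image re
  obtain ⟨X₀, h1, h2, h3, h3'⟩ := exists_generic (a := a) (b := a + η) hr0.le
    ((Zj ∪ Zk).image re) hfinre (by linarith [hgap re])
  obtain ⟨X₁, h4, h5, h6, h6'⟩ := exists_generic (a := b) (b := b + η) hr0.le
    ((Zj ∪ Zk).image re) hfinre (by linarith [hgap re])
  obtain ⟨Y₀, h7, h8, h9, -⟩ := exists_generic (a := θ - ε / 2) (b := θ - ε / 4)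
    hr0.le ((Zj ∪ Zk).image im) finite_empty (by linarith [hgap im])
  obtain ⟨Y₁, h10, h11, h12, -⟩ := exists_generic (a := θ + ε / 4) (b := θ + ε / 2)
    hr0.le ((Zj ∪ Zk).image im) finite_empty (by linarith [hgap im])
  refine ⟨X₀, X₁, Y₀, Y₁, h1, h2, h4, h5, h7, h8, h10, h11, ?_⟩
  -- genericity of the sides
  have hvertical : ∀ x : ℝ, (∀ z ∈ (Zj ∪ Zk).image re, r ≤ |x - z|) → ∀ y : ℝ,
      ∀ a ∈ Zj ∪ Zk, r ≤ ‖(x + y * I : ℂ) - a‖ := by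
    intro x hx y a ha
    refine (hx _ (Finset.mem_image_of_mem re ha)).trans ?_
    have := abs_re_le_norm ((x + y * I : ℂ) - a)
    simpa using this
  have hhoriz : ∀ y : ℝ, (∀ z ∈ (Zj ∪ Zk).image im, r ≤ |y - z|) → ∀ x : ℝ,
      ∀ a ∈ Zj ∪ Zk, r ≤ ‖(x + y * I : ℂ) - a‖ := by
    intro y hy x a ha
    refine (hy _ (Finset.mem_image_of_mem im ha)).trans ?_
    have := abs_im_le_norm ((x + y * I : ℂ) - a)
    simpa using this
  have hFv : ∀ x : ℝ, l - 1 ≤ x → x ≤ l + 2 →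
      x ∉ re '' {s | s ∈ {s : ℂ | l - 1 ≤ s.re ∧ s.re ≤ l + 2 ∧ θ - 2 ≤ s.im ∧ s.im ≤ θ + 2} ∧
        expSum q w h s = 0} → ∀ y : ℝ, |y - θ| ≤ 2 → expSum q w h (x + y * I) ≠ 0 := by
    intro x hx1 hx2 hx y hy h0
    rw [abs_le] at hy
    exact hx ⟨x + y * I, ⟨⟨by simpa using hx1, by simpa using hx2, by simp; linarith,
      by simp; linarith⟩, h0⟩, by simp⟩
  have hX₀l : l - 1 ≤ X₀ := by linarith
  have hX₁l : X₁ ≤ l + 2 := by linarith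
  have hX : X₀ < X₁ := by linarith
  have hF₀ := hFv X₀ hX₀l (by linarith) h3'
  have hF₁ := hFv X₁ (by linarith) hX₁l h6'
  have vert : ∀ x : ℝ, l - 1 ≤ x → x ≤ l + 2 → (∀ z ∈ (Zj ∪ Zk).image re, r ≤ |x - z|) →
      (∀ y : ℝ, |y - θ| ≤ 2 → expSum q w h (x + y * I) ≠ 0) →
      |argVar (expSum q (fun v => w v - w j) h) x I θ Y₀| ≤
        vertConst C A κ q d n * (l * Real.exp (d * l)) ∧
      |argVar (expSum q (fun v => w v - w k) h) x I θ Y₁| ≤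
        vertConst C A κ q d n * (l * Real.exp (d * l)) := by
    intro x hx1 hx2 hgen hne
    have hxl : |((x : ℂ)).re - l| ≤ 3 := by
      rw [ofReal_re, abs_le]; constructor <;> linarith
    constructor
    · have := abs_argVar_vertical_le (U := θ - Y₀) (x := x) hq ht hC hA hκ (Or.inr rfl) hp.max_left
        (fun u hu0 hu1 v hv => by
          have := hp.below u hu0 (by linarith) v hv
          rwa [neg_one_mul, ← sub_eq_add_neg]) hl3 (by linarith)
        (by linarith) hx1 hx2
        (fun y hy => hlowj _ (by simpa using hxl) (by simpa using hy)
          fun a ha => hvertical x hgen y a (Finset.mem_union_left _ ha)) hvarj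
        (fun y hy => expSum_sub_ne_zero (hne y hy))
      rwa [show θ + -1 * (θ - Y₀) = Y₀ by ring] at this
    · have := abs_argVar_vertical_le (U := Y₁ - θ) (x := x) hq ht hC hA hκ (Or.inl rfl) hp.max_right
        (fun u hu0 hu1 v hv => by
          have := hp.above u hu0 (by linarith) v hv
          rwa [one_mul]) hl3 (by linarith)
        (by linarith) hx1 hx2
        (fun y hy => hlowk _ (by simpa using hxl) (by simpa using hy)
          fun a ha => hvertical x hgen y a (Finset.mem_union_right _ ha)) hvark
        (fun y hy => expSum_sub_ne_zero (hne y hy))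
      rwa [show θ + 1 * (Y₁ - θ) = Y₁ by ring] at this
  -- domination on the horizontal sides
  have hdomj : ∀ v, v ≠ j → dirRe q (w v) Y₀ + D * (l * η) ≤ dirRe q (w j) Y₀ := by
    intro v hv
    have h := hp.below (θ - Y₀) (by linarith) (by linarith) v hv
    rw [sub_sub_cancel] at h
    nlinarith
  have hdomk : ∀ v, v ≠ k → dirRe q (w v) Y₁ + D * (l * η) ≤ dirRe q (w k) Y₁ := by
    intro v hv
    have h := hp.above (Y₁ - θ) (by linarith) (by linarith) v hv
    rw [add_sub_cancel] at h
    nlinarith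
  have hY₀θ : |Y₀ - θ| ≤ 1 := by rw [abs_le]; constructor <;> linarith
  have hY₁θ : |Y₁ - θ| ≤ 1 := by rw [abs_le]; constructor <;> linarith
  have hlowY₀ : ∀ x : ℝ, |x - l| ≤ 3 →
      Real.exp (-((2 * q + 15) * C * (l * Real.exp (d * l)))) ≤ ‖h j (x + Y₀ * I)‖ := fun x hx =>
    hlowj _ (by simpa using hx) (by simp; linarith)
      fun a ha => hhoriz Y₀ h9 x a (Finset.mem_union_left _ ha)
  have hlowY₁ : ∀ x : ℝ, |x - l| ≤ 3 →
      Real.exp (-((2 * q + 15) * C * (l * Real.exp (d * l)))) ≤ ‖h k (x + Y₁ * I)‖ := fun x hx =>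
    hlowk _ (by simpa using hx) (by simp; linarith)
      fun a ha => hhoriz Y₁ h12 x a (Finset.mem_union_right _ ha)
  have hbot := abs_argVar_horizontal_le hq ht hC hl3 hY₀θ hX.le hX₀l hX₁l hdomj hlowY₀ hvarj
  have htop := abs_argVar_horizontal_le hq ht hC hl3 hY₁θ hX.le hX₀l hX₁l hdomk hlowY₁ hvark
  obtain ⟨hv1, hv2⟩ := vert X₀ hX₀l (by linarith) h3 hF₀
  obtain ⟨hv3, hv4⟩ := vert X₁ (by linarith) hX₁l h6 hF₁
  -- nonvanishing on the boundary
  have hFh : ∀ (i : ι) (Y : ℝ), (∀ v, v ≠ i → dirRe q (w v) Y + D * (l * η) ≤ dirRe q (w i) Y) →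
      (∀ x : ℝ, |x - l| ≤ 3 →
        Real.exp (-((2 * q + 15) * C * (l * Real.exp (d * l)))) ≤ ‖h i (x + Y * I)‖) →
      ∀ x : ℝ, X₀ ≤ x → x ≤ X₁ → expSum q w h (x + Y * I) ≠ 0 := by
    intro i Y hd hlo x hx1 hx2 h0
    have h1 := norm_expSum_div_sub_one_le hq ht hC (l := l) (s := x + Y * I) (by linarith)
      (by simp; linarith) (by simp; linarith) (by simpa using hd)
      (hlo x (by rw [abs_le]; constructor <;> linarith))
    rw [expSum_eq i] at h0
    rw [(mul_eq_zero.1 h0).resolve_right (exp_ne_zero _)] at h1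
    norm_num at h1
  have hbd : ∀ s ∈ boxBoundary X₀ X₁ Y₀ Y₁, expSum q w h s ≠ 0 := by
    rintro s ⟨⟨hs1, hs2, hs3, hs4⟩, hs5⟩
    rw [← re_add_im s]
    rcases hs5 with hs | hs | hs | hs <;> rw [hs]
    · exact hF₀ _ (by rw [abs_le]; constructor <;> linarith)
    · exact hF₁ _ (by rw [abs_le]; constructor <;> linarith)
    · exact hFh j Y₀ hdomj hlowY₀ _ hs1 hs2
    · exact hFh k Y₁ hdomk hlowY₁ _ hs1 hs2
  have hY : Y₀ < Y₁ := by linarith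
  have hAP := rectVar_eq_zerosIn hFd hX hY hbd
  have hFside : ∀ x : ℝ, (∀ y : ℝ, |y - θ| ≤ 2 → expSum q w h (x + y * I) ≠ 0) →
      ∀ y₀ y₁ : ℝ, |y₀ - θ| ≤ 1 → |y₁ - θ| ≤ 1 → ∀ t ∈ uIcc y₀ y₁,
        expSum q w h (x + t * I) ≠ 0 := by
    intro x hne y₀ y₁ h0 h1 t htt
    rw [abs_le] at h0 h1
    refine hne t ?_
    rw [abs_le]
    rcases le_total y₀ y₁ with hle | hle
    · rw [uIcc_of_le hle] at htt
      constructor <;> linarith [htt.1, htt.2]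
    · rw [uIcc_of_ge hle] at htt
      constructor <;> linarith [htt.1, htt.2]
  have hθθ : |θ - θ| ≤ 1 := by simp
  -- Both halves are measured from the critical ray, with `w j` divided out below it and `w k` above
  -- it. The two phases do not match at θ, and their mismatch is what survives.
  have hvsplit : ∀ x : ℝ, (∀ y : ℝ, |y - θ| ≤ 2 → expSum q w h (x + y * I) ≠ 0) →
      argVar (expSum q w h) x I Y₀ Y₁ =
        -(argVar (expSum q (fun v => w v - w j) h) x I θ Y₀ +
          (w j * exp (q * (x + Y₀ * I)) - w j * exp (q * (x + θ * I))).im) +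
        (argVar (expSum q (fun v => w v - w k) h) x I θ Y₁ +
          (w k * exp (q * (x + Y₁ * I)) - w k * exp (q * (x + θ * I))).im) := by
    intro x hne
    rw [← argVar_add hFd (hFside x hne Y₀ θ hY₀θ hθθ) (hFside x hne θ Y₁ hθθ hY₁θ),
      argVar_symm _ _ _ θ Y₀,
      argVar_expSum hent j (fun t htt => expSum_sub_ne_zero (hFside x hne θ Y₀ hθθ hY₀θ t htt)),
      argVar_expSum hent k (fun t htt => expSum_sub_ne_zero (hFside x hne θ Y₁ hθθ hY₁θ t htt))]
  have hb0 := argVar_expSum (q := q) (w := w) hent j (fun t htt => expSum_sub_ne_zero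
    (bottom_of_boxBoundary hX.le hY.le hbd t htt))
  have ht0 := argVar_expSum (q := q) (w := w) hent k (fun t htt => expSum_sub_ne_zero
    (top_of_boxBoundary hX.le hY.le hbd t htt))
  have hmain : ∀ x : ℝ, (w j * exp (q * (x + θ * I))).im - (w k * exp (q * (x + θ * I))).im =
      ‖w j - w k‖ * Real.exp (q * x) := by
    intro x
    exact hp.im_sub x
  have hm0 := hmain X₀
  have hm1 := hmain X₁
  unfold rectVar at hAP
  rw [hb0, ht0, hvsplit X₀ hF₀, hvsplit X₁ hF₁] at hAP
  simp only [mul_one, add_comm ((Y₀ : ℂ) * I), add_comm ((Y₁ : ℂ) * I), sub_im] at hAP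
  set V := vertConst C A κ q d n * (l * Real.exp (d * l)) with hV
  -- The phases at the four corners cancel against those of the horizontal sides; only the values at
  -- height θ remain, evaluated by `im_sub`.
  have hlin : 2 * Real.pi * (zerosIn (expSum q w h) (openBox X₀ X₁ Y₀ Y₁) : ℝ) -
      ‖w j - w k‖ * (Real.exp (q * X₁) - Real.exp (q * X₀)) =
      argVar (expSum q (fun v => w v - w j) h) (Y₀ * I) 1 X₀ X₁ -
      argVar (expSum q (fun v => w v - w k) h) (Y₁ * I) 1 X₀ X₁ -
      argVar (expSum q (fun v => w v - w j) h) X₁ I θ Y₀ +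
      argVar (expSum q (fun v => w v - w k) h) X₁ I θ Y₁ +
      argVar (expSum q (fun v => w v - w j) h) X₀ I θ Y₀ -
      argVar (expSum q (fun v => w v - w k) h) X₀ I θ Y₁ := by
    linarith
  have hA0 : 0 ≤ A := (norm_nonneg _).trans (hA j)
  have hVE : (12 * C + 4) * (l * Real.exp (d * l)) ≤ V := by
    rw [hV]
    have : (12 * C + 4) ≤ vertConst C A κ q d n := by
      unfold vertConst
      have : 0 ≤ 12 * (4 * Real.exp (3 * d) * C +
        Real.exp (3 * q) * (2 * A * q * (13 * (domConst C q d n / κ))) + n + (2 * q + 15) * C + 1) := by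
        positivity
      linarith
    gcongr
  rw [abs_le] at hbot htop hv1 hv2 hv3 hv4
  have hpi : (3 : ℝ) < Real.pi := Real.pi_gt_three
  have hdiv : ∀ u v : ℝ, u - v / (2 * Real.pi) = (2 * Real.pi * u - v) / (2 * Real.pi) := by
    intro u v
    field_simp
  have hV0 : 0 ≤ V := le_trans (by positivity) hVE
  rw [hdiv, abs_div, abs_of_pos (by positivity : 0 < 2 * Real.pi), div_le_iff₀ (by positivity),
    hlin, abs_le]
  -- Six variations of normalised sums remain, each at most V in absolute value, and 6 < 2π.
  have : 6 * V ≤ V * (2 * Real.pi) := by linarith [mul_le_mul_of_nonneg_left hpi.le hV0]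
  constructor <;> linarith

end


/-! ### Exponential polynomials are tame -/

lemma Polynomial.norm_eval_le_of_natDegree_le (P : Polynomial ℂ) {N : ℕ} (hN : P.natDegree ≤ N) :
    ∃ A : ℝ, 0 ≤ A ∧ ∀ z : ℂ, 1 ≤ ‖z‖ → ‖P.eval z‖ ≤ A * ‖z‖ ^ N := by
  refine ⟨∑ i ∈ Finset.range (N + 1), ‖P.coeff i‖, by positivity, fun z hz => ?_⟩
  rw [Polynomial.eval_eq_sum_range' (Nat.lt_succ_of_le hN), Finset.sum_mul]
  refine norm_sum_le_of_le _ fun i hi => ?_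
  rw [norm_mul, norm_pow]
  have : i ≤ N := Nat.lt_succ_iff.1 (Finset.mem_range.1 hi)
  gcongr

lemma Polynomial.norm_eval_ge (P : Polynomial ℂ) (hP : P ≠ 0) :
    ∃ a r₀ : ℝ, 0 < a ∧ 1 ≤ r₀ ∧ ∀ z : ℂ, r₀ ≤ ‖z‖ → a * ‖z‖ ^ P.natDegree ≤ ‖P.eval z‖ := by
  have hdeg : (Polynomial.X * P.eraseLead).natDegree ≤ P.natDegree := by
    rcases P.eraseLead_natDegree_lt_or_eraseLead_eq_zero with h | h
    · exact Polynomial.natDegree_mul_le.trans (by rw [Polynomial.natDegree_X]; omega)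
    · rw [h]; simp
  obtain ⟨A, hA0, hA⟩ := Polynomial.norm_eval_le_of_natDegree_le _ hdeg
  have hlead : 0 < ‖P.leadingCoeff‖ := norm_pos_iff.2 (Polynomial.leadingCoeff_ne_zero.2 hP)
  refine ⟨‖P.leadingCoeff‖ / 2, max 1 (2 * A / ‖P.leadingCoeff‖), by positivity, le_max_left _ _,
    fun z hz => ?_⟩
  have hz1 : 1 ≤ ‖z‖ := (le_max_left _ _).trans hz
  have hz2 : 2 * A ≤ ‖z‖ * ‖P.leadingCoeff‖ := (div_le_iff₀ hlead).1 ((le_max_right _ _).trans hz)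
  have h1 := hA z hz1
  rw [Polynomial.eval_mul, Polynomial.eval_X, norm_mul] at h1
  have h2 : P.eval z = P.eraseLead.eval z + P.leadingCoeff * z ^ P.natDegree := by
    have := congrArg (Polynomial.eval z) P.eraseLead_add_monomial_natDegree_leadingCoeff
    rw [Polynomial.eval_add, Polynomial.eval_monomial] at this
    exact this.symm
  have h3 : ‖P.eraseLead.eval z‖ ≤ ‖P.leadingCoeff‖ / 2 * ‖z‖ ^ P.natDegree := by
    have h4 : ‖z‖ * ‖P.eraseLead.eval z‖ ≤
        ‖z‖ * (‖P.leadingCoeff‖ / 2 * ‖z‖ ^ P.natDegree) := by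
      refine h1.trans ?_
      have : A * ‖z‖ ^ P.natDegree ≤ (‖z‖ * ‖P.leadingCoeff‖ / 2) * ‖z‖ ^ P.natDegree := by
        gcongr; linarith
      linarith
    exact le_of_mul_le_mul_left h4 (by linarith)
  have h5 : ‖P.leadingCoeff‖ * ‖z‖ ^ P.natDegree ≤ ‖P.eval z‖ + ‖P.eraseLead.eval z‖ := by
    rw [← norm_pow, ← norm_mul]
    have : P.leadingCoeff * z ^ P.natDegree = P.eval z - P.eraseLead.eval z := by rw [h2]; ring
    rw [this]
    exact norm_sub_le _ _
  linarith

lemma IsExpPolyOfOrderLE.differentiable {d : ℕ} {g : ℂ → ℂ} (hg : IsExpPolyOfOrderLE d g) :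
    Differentiable ℂ g := by
  obtain ⟨n, P, Q, -, h⟩ := hg
  rw [show g = _ from funext h]
  fun_prop

lemma IsExpPolyOfOrderLE.growth {d : ℕ} {g : ℂ → ℂ} (hg : IsExpPolyOfOrderLE d g) :
    ∃ B : ℝ, 1 ≤ B ∧ ∀ s : ℂ, 0 ≤ s.re →
      ‖g (exp s)‖ ≤ Real.exp (B * (1 + s.re + Real.exp (d * s.re))) := by
  obtain ⟨n, P, Q, hQ, h⟩ := hg
  choose A hA0 hA using fun j => (P j).norm_eval_le_of_natDegree_le le_rfl
  choose B hB0 hB using fun j => (Q j).norm_eval_le_of_natDegree_le (hQ j)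
  set T := 1 + ∑ j, (A j + (P j).natDegree + B j + 1) with hT
  have hTj : ∀ j, A j + (P j).natDegree + B j + 1 ≤ T := by
    intro j
    have := Finset.single_le_sum (f := fun j => A j + ((P j).natDegree : ℝ) + B j + 1)
      (fun i _ => by have := hA0 i; have := hB0 i; positivity) (Finset.mem_univ j)
    linarith
  have hTn : (n : ℝ) ≤ T := by
    have : ∑ j : Fin n, (1 : ℝ) ≤ ∑ j, (A j + (P j).natDegree + B j + 1) := by
      gcongr with j
      have := hA0 j; have := hB0 j
      have : (0 : ℝ) ≤ (P j).natDegree := by positivity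
      linarith
    simp at this
    linarith
  have hT0 : 1 ≤ T := by
    have : 0 ≤ ∑ j, (A j + ((P j).natDegree : ℝ) + B j + 1) :=
      Finset.sum_nonneg fun i _ => by have := hA0 i; have := hB0 i; positivity
    linarith
  refine ⟨3 * T, by linarith, fun s hs => ?_⟩
  have hns : ‖exp s‖ = Real.exp s.re := norm_exp s
  have h1 : 1 ≤ ‖exp s‖ := by rw [hns]; exact Real.one_le_exp hs
  have hterm : ∀ j ∈ Finset.univ, ‖(P j).eval (exp s) * exp ((Q j).eval (exp s))‖ ≤
      Real.exp (T * (1 + s.re + Real.exp (d * s.re))) := by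
    intro j _
    have hT' := hTj j
    have := hA0 j; have := hB0 j
    have hN0 : (0 : ℝ) ≤ (P j).natDegree := by positivity
    rw [norm_mul, norm_exp]
    have hp := hA j (exp s) h1
    have hq := (re_le_norm _).trans (hB j (exp s) h1)
    rw [hns, ← Real.exp_nat_mul] at hp hq
    have hAe : A j ≤ Real.exp (A j) := by linarith [Real.add_one_le_exp (A j)]
    calc ‖(P j).eval (exp s)‖ * Real.exp ((Q j).eval (exp s)).re
        ≤ (Real.exp (A j) * Real.exp ((P j).natDegree * s.re)) *
          Real.exp (B j * Real.exp (d * s.re)) := by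
          gcongr
          exact hp.trans (by gcongr)
      _ = Real.exp (A j + (P j).natDegree * s.re + B j * Real.exp (d * s.re)) := by
          rw [← Real.exp_add, ← Real.exp_add]
      _ ≤ _ := by
          rw [Real.exp_le_exp]
          have e1 : A j ≤ T := by linarith
          have e2 : (P j).natDegree * s.re ≤ T * s.re := by gcongr; linarith
          have e3 : B j * Real.exp (d * s.re) ≤ T * Real.exp (d * s.re) := by gcongr; linarith
          linarith
  rw [h]
  refine (norm_sum_le_of_le _ hterm).trans ?_
  rw [Finset.sum_const, nsmul_eq_mul, Finset.card_univ, Fintype.card_fin]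
  have hn' : (n : ℝ) ≤ Real.exp T := hTn.trans (by linarith [Real.add_one_le_exp T])
  have hE := Real.exp_pos (d * s.re)
  calc (n : ℝ) * Real.exp (T * (1 + s.re + Real.exp (d * s.re)))
      ≤ Real.exp T * Real.exp (T * (1 + s.re + Real.exp (d * s.re))) := by gcongr
    _ ≤ _ := by
      rw [← Real.exp_add, Real.exp_le_exp]
      have : T * 1 ≤ T * (1 + s.re + Real.exp (d * s.re)) := by gcongr; linarith
      nlinarith

/-- The logarithms of `z` are spaced vertically by 2π, so one of them is within π < 4 of the height
θ. -/
lemma exists_log_near {z : ℂ} (hz : z ≠ 0) (θ : ℝ) :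
    ∃ s : ℂ, exp s = z ∧ s.re = Real.log ‖z‖ ∧ |s.im - θ| ≤ 4 := by
  set n := round ((θ - arg z) / (2 * Real.pi)) with hn
  have hπ := Real.pi_pos
  refine ⟨log z + n * (2 * Real.pi * I), ?_, ?_, ?_⟩
  · rw [exp_add, exp_log hz, exp_int_mul_two_pi_mul_I, mul_one]
  · simp [log_re]
  · have h1 := abs_sub_round ((θ - arg z) / (2 * Real.pi))
    rw [← hn] at h1
    have h2 : (log z + n * (2 * Real.pi * I)).im = arg z + n * (2 * Real.pi) := by
      simp [log_im]
    rw [h2]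
    have h3 : arg z + n * (2 * Real.pi) - θ =
        -((θ - arg z) / (2 * Real.pi) - n) * (2 * Real.pi) := by
      field_simp
      ring
    rw [h3, abs_mul, abs_neg, abs_of_pos (by positivity : 0 < 2 * Real.pi)]
    have := Real.pi_lt_d2
    nlinarith [abs_nonneg ((θ - arg z) / (2 * Real.pi) - n)]

/-- For d ≥ 1 a maximum point on the circle of radius e^l is a seed: the modulus there is bounded
below by a fixed constant, and the linear term in the growth bound is absorbed by e^{dl}. For d = 0
that linear term would cost a factor l. But then `g` is a polynomial, and far out its size at any
point of the circle is comparable with its size in the whole disc of radius 120. -/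
lemma IsExpPolyOfOrderLE.tame {d : ℕ} {g : ℂ → ℂ} (hg : IsExpPolyOfOrderLE d g) (h0 : g ≠ 0) :
    ∃ C x₀ : ℝ, 1 ≤ C ∧ 1 ≤ x₀ ∧ Tame d (fun s => g (exp s)) C x₀ := by
  obtain ⟨B, hB1, hB⟩ := hg.growth
  have hgd := hg.differentiable
  have hgrowth : ∀ C, 3 * B ≤ C → ∀ s : ℂ, 1 ≤ s.re →
      ‖g (exp s)‖ ≤ Real.exp (C * (s.re * Real.exp (d * s.re))) := by
    intro C hC s hs
    refine (hB s (by linarith)).trans (Real.exp_le_exp.2 ?_)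
    have hE : 1 ≤ Real.exp (d * s.re) := Real.one_le_exp (by positivity)
    have h1 : 1 + s.re + Real.exp (d * s.re) ≤ 3 * (s.re * Real.exp (d * s.re)) := by nlinarith
    have h2 : 0 ≤ s.re * Real.exp (d * s.re) := by positivity
    nlinarith
  have hball : ∀ (l : ℝ) (c : ℂ), c.re = l → ∀ s ∈ Metric.closedBall c 120,
      l - 120 ≤ s.re ∧ s.re ≤ l + 120 := by
    intro l c hc s hs
    rw [Metric.mem_closedBall, dist_eq] at hs
    have := (abs_re_le_norm (s - c)).trans hs
    rw [abs_le, sub_re, hc] at this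
    constructor <;> linarith
  rcases Nat.eq_zero_or_pos d with rfl | hd
  · -- polynomials
    obtain ⟨n, P, Q, hQ, h⟩ := hg
    set R : Polynomial ℂ := ∑ j, P j * Polynomial.C (exp ((Q j).coeff 0)) with hR
    have hgR : ∀ z, g z = R.eval z := by
      intro z
      rw [h z, hR, Polynomial.eval_finsetSum]
      refine Finset.sum_congr rfl fun j _ => ?_
      have h1 := Polynomial.eq_C_of_natDegree_le_zero (hQ j)
      have h2 : (Q j).eval z = (Q j).coeff 0 := by rw [h1]; simp
      rw [Polynomial.eval_mul, Polynomial.eval_C, h2]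
    have hR0 : R ≠ 0 := by
      intro hR0
      exact h0 (funext fun z => by rw [hgR z, hR0]; simp)
    obtain ⟨a, r₀, ha, hr₀, hlow⟩ := R.norm_eval_ge hR0
    obtain ⟨A, hA0, hA⟩ := R.norm_eval_le_of_natDegree_le le_rfl
    set N := R.natDegree with hN
    set C := 3 * B + |Real.log a| + A + 120 * N with hC
    refine ⟨C, 121 + Real.log r₀, ?_, ?_, ?_, hgrowth C ?_, ?_⟩
    · have := abs_nonneg (Real.log a)
      have : (0 : ℝ) ≤ 120 * N := by positivity
      linarith
    · linarith [Real.log_nonneg hr₀]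
    · exact hgd.comp differentiable_exp
    · have := abs_nonneg (Real.log a)
      have : (0 : ℝ) ≤ 120 * N := by positivity
      linarith
    · intro l hl θ
      have hl' := Real.log_nonneg hr₀
      have hlr : r₀ ≤ Real.exp l := by
        rw [← Real.log_le_iff_le_exp (by linarith)]; linarith
      have hCl : -C ≤ Real.log a := by
        have := neg_abs_le (Real.log a)
        have : (0 : ℝ) ≤ 120 * N := by positivity
        linarith
      have hlowc : a * Real.exp (N * l) ≤ ‖g (exp (l + θ * I))‖ := by
        have := hlow (exp (l + θ * I)) (by rw [norm_exp]; simpa using hlr)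
        rw [hgR, Real.exp_nat_mul]
        rw [norm_exp] at this
        simpa using this
      have hae : Real.exp (Real.log a) = a := Real.exp_log ha
      refine ⟨l + θ * I, by simp, by simp, ?_, ?_⟩
      · refine le_trans ?_ hlowc
        rw [← hae, ← Real.exp_add, Real.exp_le_exp]
        simp only [CharP.cast_eq_zero, zero_mul, Real.exp_zero, mul_one]
        have h1 : 0 ≤ N * l := by have : 0 ≤ l := by linarith
                                  positivity
        have h2 : C ≤ C * l := by
          have : 0 ≤ C := by
            have := abs_nonneg (Real.log a)
            have : (0 : ℝ) ≤ 120 * N := by positivity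
            linarith
          nlinarith
        linarith
      · intro s hs
        obtain ⟨hs1, hs2⟩ := hball l _ (by simp) s hs
        have h1 := hA (exp s) (by rw [norm_exp]; exact Real.one_le_exp (by linarith))
        rw [norm_exp, ← Real.exp_nat_mul] at h1
        rw [hgR (exp s)]
        refine h1.trans (le_trans ?_ (mul_le_mul_of_nonneg_left hlowc (Real.exp_nonneg _)))
        have h2 : A ≤ Real.exp A := by linarith [Real.add_one_le_exp A]
        refine (mul_le_mul_of_nonneg_right h2 (Real.exp_nonneg _)).trans ?_
        rw [← hae, ← Real.exp_add, ← Real.exp_add, ← Real.exp_add, Real.exp_le_exp]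
        simp only [CharP.cast_eq_zero, zero_mul, Real.exp_zero, mul_one]
        have h3 : (N : ℝ) * s.re ≤ N * (l + 120) := by gcongr
        have := neg_abs_le (Real.log a)
        rw [hC]
        linarith
  · obtain ⟨z₁, hz₁⟩ := Function.ne_iff.1 h0
    have hm0 : 0 < ‖g z₁‖ := norm_pos_iff.2 hz₁
    set M := |Real.log ‖g z₁‖| with hM
    have hMm : Real.exp (-M) ≤ ‖g z₁‖ := by
      rw [← Real.exp_log hm0, Real.exp_le_exp]
      exact neg_abs_le _
    have hM0 : 0 ≤ M := abs_nonneg _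
    set C := 3 * B + M + B * (122 + Real.exp (d * 120)) with hC
    have hBe : 0 ≤ B * (122 + Real.exp (d * 120)) := by positivity
    refine ⟨C, 121 + ‖z₁‖, by linarith, by linarith [norm_nonneg z₁], hgd.comp differentiable_exp,
      hgrowth C (by linarith), ?_⟩
    intro l hl θ
    have hl0 := norm_nonneg z₁
    have hlz : ‖z₁‖ < Real.exp l := by linarith [Real.add_one_le_exp l]
    -- The argument of the maximum point is not under control, but one of its logarithms lies close
    -- to the prescribed height θ.
    obtain ⟨z, hz, hmax⟩ := exists_mem_frontier_isMaxOn_norm (f := g) (U := Metric.ball 0 (Real.exp l))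
      Metric.isBounded_ball ⟨0, by simp [Real.exp_pos]⟩ hgd.diffContOnCl
    rw [frontier_ball _ (Real.exp_ne_zero _), mem_sphere_zero_iff_norm] at hz
    have hgz : ‖g z₁‖ ≤ ‖g z‖ := hmax (subset_closure (by simpa using hlz))
    have hz0 : z ≠ 0 := by
      rintro rfl
      rw [norm_zero] at hz
      exact (Real.exp_ne_zero l) hz.symm
    obtain ⟨c, hc1, hc2, hc3⟩ := exists_log_near hz0 θ
    rw [hz, Real.log_exp] at hc2
    have hlow : Real.exp (-M) ≤ ‖g (exp c)‖ := by rw [hc1]; exact hMm.trans hgz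
    have hE1 : 1 ≤ Real.exp (d * l) := Real.one_le_exp (by have : 0 ≤ l := by linarith
                                                           positivity)
    have hlE : l ≤ Real.exp (d * l) := by
      have h1 : l ≤ d * l := by
        have : (1 : ℝ) ≤ d := by exact_mod_cast hd
        nlinarith
      linarith [Real.add_one_le_exp (d * l)]
    refine ⟨c, hc2, hc3, le_trans (Real.exp_le_exp.2 ?_) hlow, ?_⟩
    · have h1 : 1 ≤ l * Real.exp (d * l) := by nlinarith
      have h2 : M ≤ C := by linarith
      nlinarith
    · intro s hs
      obtain ⟨hs1, hs2⟩ := hball l c hc2 s hs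
      refine (hB s (by linarith)).trans ?_
      refine le_trans ?_ (mul_le_mul_of_nonneg_left hlow (Real.exp_nonneg _))
      rw [← Real.exp_add, Real.exp_le_exp]
      have h1 : Real.exp (d * s.re) ≤ Real.exp (d * 120) * Real.exp (d * l) := by
        rw [← Real.exp_add, Real.exp_le_exp]
        have : (d : ℝ) * s.re ≤ d * (l + 120) := by gcongr
        linarith
      have h2 : 1 + s.re + Real.exp (d * s.re) ≤ (122 + Real.exp (d * 120)) * Real.exp (d * l) := by
        nlinarith
      have h3 : B * (1 + s.re + Real.exp (d * s.re)) ≤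
          B * ((122 + Real.exp (d * 120)) * Real.exp (d * l)) := by gcongr
      have h4 : M ≤ M * Real.exp (d * l) := by nlinarith
      have h5 : 0 ≤ B * Real.exp (d * l) := by positivity
      rw [hC]
      nlinarith


/-! ### Dominating exponents on the two sides of a direction -/

lemma dirRe_add (q : ℕ) (a : ℂ) (θ u : ℝ) : dirRe q a (θ + u) =
    (a * exp (q * θ * I)).re * Real.cos (q * u) - (a * exp (q * θ * I)).im * Real.sin (q * u) := by
  have h1 : exp (q * (θ + u : ℝ) * I) = exp (q * θ * I) * exp ((q * u : ℝ) * I) := by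
    rw [← exp_add]; push_cast; ring_nf
  rw [dirRe, h1, ← mul_assoc, mul_re, exp_ofReal_mul_I_re, exp_ofReal_mul_I_im]

lemma dirRe_conj_neg (q : ℕ) (a : ℂ) (y : ℝ) :
    dirRe q ((starRingEnd ℂ) a) (-y) = dirRe q a y := by
  unfold dirRe
  have : (starRingEnd ℂ) a * exp (q * (-y : ℝ) * I) = (starRingEnd ℂ) (a * exp (q * y * I)) := by
    rw [map_mul, ← exp_conj]
    simp
  rw [this, conj_re]

lemma im_conj_mul_exp_neg (q : ℕ) (a : ℂ) (y : ℝ) :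
    ((starRingEnd ℂ) a * exp (q * (-y : ℝ) * I)).im = -(a * exp (q * y * I)).im := by
  have : (starRingEnd ℂ) a * exp (q * (-y : ℝ) * I) = (starRingEnd ℂ) (a * exp (q * y * I)) := by
    rw [map_mul, ← exp_conj]
    simp
  rw [this, conj_im]

lemma continuous_dirRe (q : ℕ) (a : ℂ) : Continuous (dirRe q a) := by
  unfold dirRe
  fun_prop

/-- One-sided lower bound for `Re (B e^{iqu})`. -/
lemma exists_linear_lower_bound {q : ℕ} (hq : 1 ≤ q) {b₁ b₂ : ℝ}
    (hb : 0 < b₁ ∨ b₁ = 0 ∧ b₂ < 0) :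
    ∃ ε, 0 < ε ∧ ∀ u, 0 ≤ u → u ≤ ε → ε * u ≤ b₁ * Real.cos (q * u) - b₂ * Real.sin (q * u) := by
  have hq' : (1 : ℝ) ≤ q := by exact_mod_cast hq
  -- Either the value at 0 is positive and stays so, or it is 0 and the derivative -q b₂ at 0 is
  -- positive.
  rcases hb with hb | ⟨rfl, hb⟩
  · have hcont : Continuous fun u : ℝ => b₁ * Real.cos (q * u) - b₂ * Real.sin (q * u) := by
      fun_prop
    have hev : ∀ᶠ u in 𝓝 (0 : ℝ), b₁ / 2 < b₁ * Real.cos (q * u) - b₂ * Real.sin (q * u) := by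
      refine hcont.continuousAt.eventually_const_lt ?_
      simp
      linarith
    obtain ⟨δ, hδ, hball⟩ := Metric.eventually_nhds_iff.1 hev
    refine ⟨min (δ / 2) (min 1 (b₁ / 2)), by positivity, fun u hu0 hu => ?_⟩
    have h1 : u ≤ δ / 2 := hu.trans (min_le_left _ _)
    have h2 : u ≤ 1 := hu.trans ((min_le_right _ _).trans (min_le_left _ _))
    have h3 : min (δ / 2) (min 1 (b₁ / 2)) ≤ b₁ / 2 :=
      (min_le_right _ _).trans (min_le_right _ _)
    have h4 := hball (y := u) (by rw [Real.dist_eq, sub_zero, abs_of_nonneg hu0]; linarith)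
    have h5 : min (δ / 2) (min 1 (b₁ / 2)) * u ≤ b₁ / 2 * 1 := by gcongr
    linarith
  · refine ⟨min (1 / q) (-b₂ / 2), by
      have : 0 < -b₂ / 2 := by linarith
      positivity, fun u hu0 hu => ?_⟩
    have h1 : q * u ≤ 1 := by
      have : u ≤ 1 / q := hu.trans (min_le_left _ _)
      rwa [le_div_iff₀ (by linarith), mul_comm] at this
    have h2 : u / 2 ≤ Real.sin (q * u) := by
      have h3 := Real.mul_le_sin (x := q * u) (by positivity) (by linarith [Real.pi_gt_three])
      have h4 : 1 / 2 * u ≤ 2 / Real.pi * (q * u) := by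
        have h5 : (1 : ℝ) / 2 ≤ 2 / Real.pi := by
          rw [div_le_div_iff₀ (by norm_num) Real.pi_pos]; linarith [Real.pi_lt_d2]
        have h6 : u ≤ q * u := by nlinarith
        gcongr
      linarith
    have h3 : min (1 / (q : ℝ)) (-b₂ / 2) * u ≤ -b₂ / 2 * u := by
      gcongr; exact min_le_right _ _
    nlinarith

section

variable {ι : Type*} [Fintype ι] [Nonempty ι] {q : ℕ} {w : ι → ℂ}

/-- On the right of any direction, one exponent dominates. -/
lemma exists_dominant_right (hq : 1 ≤ q) (hw : Function.Injective w) (θ : ℝ) :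
    ∃ k, (∀ v, v ≠ k → dirRe q (w v) θ = dirRe q (w k) θ →
        (w k * exp (q * θ * I)).im < (w v * exp (q * θ * I)).im) ∧
      ∃ ε, 0 < ε ∧ ε ≤ 1 ∧ ∀ u, 0 ≤ u → u ≤ ε → ∀ v, v ≠ k →
        dirRe q (w v) (θ + u) + ε * u ≤ dirRe q (w k) (θ + u) := by
  classical
  obtain ⟨k₀, hk₀⟩ := Finite.exists_max fun v => dirRe q (w v) θ
  -- The derivative of Re(w e^{iqy}) at θ is -q Im(w e^{iqθ}). So among the maximisers at θ the one
  -- of smallest imaginary part wins to the right.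
  obtain ⟨k, hk, hkmin⟩ := Finset.exists_min_image
    (Finset.univ.filter fun v => dirRe q (w v) θ = dirRe q (w k₀) θ)
    (fun v => (w v * exp (q * θ * I)).im) ⟨k₀, by simp⟩
  rw [Finset.mem_filter] at hk
  have hmax : ∀ v, dirRe q (w v) θ ≤ dirRe q (w k) θ := fun v => by rw [hk.2]; exact hk₀ v
  have hlex : ∀ v, v ≠ k → dirRe q (w v) θ = dirRe q (w k) θ →
      (w k * exp (q * θ * I)).im < (w v * exp (q * θ * I)).im := by
    intro v hv heq
    refine lt_of_le_of_ne (hkmin v (by simp [heq, hk.2])) fun him => hv ?_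
    have : w v * exp (q * θ * I) = w k * exp (q * θ * I) := Complex.ext heq him.symm
    exact hw (mul_right_cancel₀ (exp_ne_zero _) this)
  refine ⟨k, hlex, ?_⟩
  have hev : ∀ v, ∃ ε, 0 < ε ∧ (v ≠ k → ∀ u, 0 ≤ u → u ≤ ε →
      dirRe q (w v) (θ + u) + ε * u ≤ dirRe q (w k) (θ + u)) := by
    intro v
    by_cases hv : v = k
    · exact ⟨1, one_pos, fun h => absurd hv h⟩
    · obtain ⟨ε, hε, h⟩ := exists_linear_lower_bound hq
        (b₁ := (w k * exp (q * θ * I)).re - (w v * exp (q * θ * I)).re)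
        (b₂ := (w k * exp (q * θ * I)).im - (w v * exp (q * θ * I)).im) (by
          rcases (hmax v).lt_or_eq with h | h
          · left; exact sub_pos.2 h
          · right
            refine ⟨sub_eq_zero.2 h.symm, sub_neg.2 (hlex v hv h)⟩)
      refine ⟨ε, hε, fun _ u hu0 hu => ?_⟩
      have := h u hu0 hu
      rw [dirRe_add, dirRe_add]
      linarith
  choose ε hε h using hev
  obtain ⟨v₀, hv₀⟩ := Finite.exists_min ε
  refine ⟨min 1 (ε v₀), lt_min one_pos (hε v₀), min_le_left _ _, fun u hu0 hu v hv => ?_⟩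
  have h1 : min 1 (ε v₀) ≤ ε v := (min_le_right _ _).trans (hv₀ v)
  have h2 := h v hv u hu0 (hu.trans h1)
  have h3 : min 1 (ε v₀) * u ≤ ε v * u := by gcongr
  linarith

/-- On the left of any direction, one exponent dominates. -/
lemma exists_dominant_left (hq : 1 ≤ q) (hw : Function.Injective w) (θ : ℝ) :
    ∃ j, (∀ v, v ≠ j → dirRe q (w v) θ = dirRe q (w j) θ →
        (w v * exp (q * θ * I)).im < (w j * exp (q * θ * I)).im) ∧
      ∃ ε, 0 < ε ∧ ε ≤ 1 ∧ ∀ u, 0 ≤ u → u ≤ ε → ∀ v, v ≠ j →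
        dirRe q (w v) (θ - u) + ε * u ≤ dirRe q (w j) (θ - u) := by
  -- Complex conjugation reflects directions and thereby exchanges left and right.
  obtain ⟨j, h1, ε, hε, hε1, h2⟩ := exists_dominant_right hq
    (w := fun v => (starRingEnd ℂ) (w v)) ((starRingEnd ℂ).injective.comp hw) (-θ)
  refine ⟨j, fun v hv heq => ?_, ε, hε, hε1, fun u hu0 hu v hv => ?_⟩
  · have := h1 v hv (by rwa [dirRe_conj_neg, dirRe_conj_neg])
    rw [im_conj_mul_exp_neg, im_conj_mul_exp_neg] at this
    linarith
  · have := h2 u hu0 hu v hv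
    rwa [show -θ + u = -(θ - u) by ring, dirRe_conj_neg, dirRe_conj_neg] at this

lemma eq_neg_I_mul_norm {z : ℂ} (hre : z.re = 0) (him : z.im ≤ 0) : z = -I * (‖z‖ : ℂ) := by
  have h1 : ‖z‖ = -z.im := by
    rw [← abs_of_nonpos him, ← abs_im_eq_norm.2 hre]
  rw [h1]
  apply Complex.ext <;> simp [hre]

/-- The dominating exponents on the two sides of a critical direction. -/
lemma exists_dominantPair (hq : 1 ≤ q) (hw : Function.Injective w) {θ : ℝ}
    (hθ : IsCriticalAngle q (range w) θ) :
    ∃ j k ε, j ≠ k ∧ DominantPair q w θ ε ε j k ∧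
      (∀ v, v ≠ j → dirRe q (w v) θ = dirRe q (w j) θ →
        (w v * exp (q * θ * I)).im < (w j * exp (q * θ * I)).im) ∧
      (∀ v, v ≠ k → dirRe q (w v) θ = dirRe q (w k) θ →
        (w k * exp (q * θ * I)).im < (w v * exp (q * θ * I)).im) := by
  obtain ⟨k, hk, ε₁, hε₁, hε₁1, hdk⟩ := exists_dominant_right hq hw θ
  obtain ⟨j, hj, ε₂, hε₂, hε₂1, hdj⟩ := exists_dominant_left hq hw θ
  have hkmax : ∀ v, dirRe q (w v) θ ≤ dirRe q (w k) θ := by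
    intro v
    rcases eq_or_ne v k with rfl | hv
    · exact le_rfl
    · simpa using hdk 0 le_rfl hε₁.le v hv
  have hjmax : ∀ v, dirRe q (w v) θ ≤ dirRe q (w j) θ := by
    intro v
    rcases eq_or_ne v j with rfl | hv
    · exact le_rfl
    · simpa using hdj 0 le_rfl hε₂.le v hv
  have hjk : dirRe q (w j) θ = dirRe q (w k) θ := le_antisymm (hkmax j) (hjmax k)
  refine ⟨j, k, min ε₁ ε₂, ?_, ⟨lt_min hε₁ hε₂, lt_min hε₁ hε₂, (min_le_left _ _).trans hε₁1,
    ?_, ?_, ?_⟩, hj, hk⟩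
  -- If the two indices agreed, a second maximiser, supplied by criticality, would have an imaginary
  -- part both strictly larger and strictly smaller than theirs.
  · rintro rfl
    obtain ⟨_, ⟨a, rfl⟩, _, ⟨b, rfl⟩, hab, heq, hmax⟩ := hθ
    have ha : dirRe q (w a) θ = dirRe q (w j) θ := le_antisymm (hkmax a) (hmax _ ⟨j, rfl⟩)
    have hb : dirRe q (w b) θ = dirRe q (w j) θ := heq.symm.trans ha
    by_cases haj : a = j
    · have hbj : b ≠ j := by rintro rfl; exact hab (by rw [haj])
      exact lt_asymm (hk b hbj hb) (hj b hbj hb)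
    · exact lt_asymm (hk a haj ha) (hj a haj ha)
  · intro u hu0 hu v hv
    have h1 := hdj u hu0 (hu.trans (min_le_right _ _)) v hv
    have h2 : min ε₁ ε₂ * u ≤ ε₂ * u := by gcongr; exact min_le_right _ _
    linarith
  · intro u hu0 hu v hv
    have h1 := hdk u hu0 (hu.trans (min_le_left _ _)) v hv
    have h2 : min ε₁ ε₂ * u ≤ ε₁ * u := by gcongr; exact min_le_left _ _
    linarith
  · have h1 : ((w k - w j) * exp (q * θ * I)).re = 0 := by
      rw [sub_mul, sub_re]; exact sub_eq_zero.2 hjk.symm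
    have h2 : ((w k - w j) * exp (q * θ * I)).im ≤ 0 := by
      rw [sub_mul, sub_im]
      rcases eq_or_ne j k with rfl | hne
      · simp
      · linarith [hk j hne hjk]
    have h3 := eq_neg_I_mul_norm h1 h2
    rw [norm_mul] at h3
    have h4 : ‖exp ((q : ℂ) * θ * I)‖ = 1 := by
      have := norm_exp_ofReal_mul_I (q * θ)
      push_cast at this
      exact this
    rwa [h4, mul_one] at h3

/-- Near a direction that is not critical one exponent dominates by a fixed margin. -/
lemma exists_dominant_of_not_critical {θ : ℝ} (hw : Function.Injective w)
    (hθ : ¬ IsCriticalAngle q (range w) θ) :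
    ∃ j δ ε, 0 < δ ∧ 0 < ε ∧ ε ≤ 1 ∧ ∀ y, |y - θ| ≤ ε → ∀ v, v ≠ j →
      dirRe q (w v) y + δ ≤ dirRe q (w j) y := by
  obtain ⟨j, hj⟩ := Finite.exists_max fun v => dirRe q (w v) θ
  have hlt : ∀ v, v ≠ j → dirRe q (w v) θ < dirRe q (w j) θ := by
    intro v hv
    refine lt_of_le_of_ne (hj v) fun heq => hθ ?_
    refine ⟨w j, ⟨j, rfl⟩, w v, ⟨v, rfl⟩, fun h => hv (hw h).symm, heq.symm, ?_⟩
    rintro _ ⟨v', rfl⟩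
    exact hj v'
  have hev : ∀ v, ∃ δ, 0 < δ ∧ (v ≠ j → ∀ y, |y - θ| ≤ δ →
      dirRe q (w v) y + δ ≤ dirRe q (w j) y) := by
    intro v
    by_cases hv : v = j
    · exact ⟨1, one_pos, fun h => absurd hv h⟩
    · have hcont : Continuous fun y => dirRe q (w j) y - dirRe q (w v) y :=
        (continuous_dirRe q _).sub (continuous_dirRe q _)
      have hpos := sub_pos.2 (hlt v hv)
      have hev := hcont.continuousAt.eventually_const_lt
        (half_lt_self hpos : (dirRe q (w j) θ - dirRe q (w v) θ) / 2 < _)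
      obtain ⟨δ, hδ, hball⟩ := Metric.eventually_nhds_iff.1 hev
      refine ⟨min (δ / 2) ((dirRe q (w j) θ - dirRe q (w v) θ) / 2), by positivity,
        fun _ y hy => ?_⟩
      have h1 := hball (y := y) (by
        rw [Real.dist_eq]
        have := hy.trans (min_le_left _ _)
        linarith)
      have h2 := min_le_right (δ / 2) ((dirRe q (w j) θ - dirRe q (w v) θ) / 2)
      linarith
  choose δ hδ h using hev
  obtain ⟨v₀, hv₀⟩ := Finite.exists_min δ
  refine ⟨j, δ v₀, min 1 (δ v₀), hδ v₀, lt_min one_pos (hδ v₀), min_le_left _ _,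
    fun y hy v hv => ?_⟩
  have h1 := h v hv y (hy.trans ((min_le_right _ _).trans (hv₀ v)))
  have h2 := hv₀ v
  linarith

end


/-! ### Zero counts in unit slabs of the logarithmic plane -/

lemma eventually_mul_exp_neg_le {p : ℕ} (hp : 1 ≤ p) {δ : ℝ} (hδ : 0 < δ) :
    ∀ᶠ l : ℝ in atTop, l * Real.exp (-(p * l)) ≤ δ := by
  have h := (Real.tendsto_pow_mul_exp_neg_atTop_nhds_zero 1).eventually_le_const hδ
  filter_upwards [h, eventually_ge_atTop 0] with l hl hl0
  refine le_trans ?_ hl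
  rw [pow_one]
  have hp' : (1 : ℝ) ≤ p := by exact_mod_cast hp
  gcongr
  nlinarith

/-- The image of a logarithmic strip in the logarithmic coordinate. -/
def rayStrip (p : ℕ) (θ c : ℝ) : Set ℂ := {s | |s.im - θ| < c * (s.re * Real.exp (-(p * s.re)))}

section

variable {ι : Type*} [Fintype ι] {p d q : ℕ} {w : ι → ℂ} {h : ι → ℂ → ℂ} {C x₀ : ℝ}

lemma isBounded_subset_re_im {S : Set ℂ} {a b y₀ y₁ : ℝ}
    (h : ∀ s ∈ S, (a ≤ s.re ∧ s.re ≤ b) ∧ y₀ ≤ s.im ∧ s.im ≤ y₁) : Bornology.IsBounded S :=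
  (isBounded_re_im a b y₀ y₁).subset fun s hs =>
    ⟨(h s hs).1.1, (h s hs).1.2, (h s hs).2.1, (h s hs).2.2⟩

/-- Few zeros outside a wide strip around a critical ray. -/
lemma eventually_zerosIn_band_le (hp1 : 1 ≤ p) (hq : q = p + d) (ht : ∀ v, Tame d (h v) C x₀)
    (hC : 1 ≤ C) {j k : ι} {θ κ ε : ℝ} (hp : DominantPair q w θ κ ε j k)
    (hF : expSum q w h ≠ 0) :
    ∃ c₁, 0 < c₁ ∧ ∀ᶠ l : ℝ in atTop, (zerosIn (expSum q w h)
      {s | l ≤ s.re ∧ s.re ≤ l + 1 ∧ |s.im - θ| ≤ ε / 2 ∧ s ∉ rayStrip p θ c₁} : ℝ) ≤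
      4 * C * Real.exp (d * l) := by
  set D := domConst C q d (Fintype.card ι) with hD
  have hD0 : 0 < D := domConst_pos (by linarith) _ _ _
  have hκ := hp.kappa_pos
  have hε := hp.eps_pos
  have hε1 := hp.eps_le
  have hent : ∀ v, Differentiable ℂ (h v) := fun v => (ht v).entire
  have hDκ : 0 < D / κ := div_pos hD0 hκ
  -- At distance D/κ times l e^{-pl} from the ray the linear lead κu reaches the required margin.
  -- The extra 1 pays for the η lost in placing the sides, and e^p for the decrease of e^{-px}
  -- across the slab.
  refine ⟨(D / κ + 1) * Real.exp p, by positivity, ?_⟩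
  filter_upwards [eventually_ge_atTop x₀, eventually_ge_atTop 2, eventually_ge_atTop (8 * C),
    eventually_mul_exp_neg_le hp1 (show 0 < ε / (8 * (D / κ + 1)) by positivity)]
    with l hl0 hl2 hl8 hsm
  set η := Real.exp (-(p * l)) with hη
  have hη0 : 0 < η := Real.exp_pos _
  rw [le_div_iff₀ (by positivity)] at hsm
  have hlη : η ≤ l * η := by nlinarith
  have hsm1 : 8 * (l * η) ≤ ε := by
    have : 0 ≤ l * η * (D / κ) := by positivity
    nlinarith
  have hsm2 : 8 * (D / κ * (l * η)) ≤ ε := by nlinarith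
  have hη1 : η ≤ 1 := by linarith
  have hκD : ∀ u, D / κ * (l * η) ≤ u → D * (l * η) ≤ κ * u := by
    intro u hu
    have : D * (l * η) = κ * (D / κ * (l * η)) := by field_simp
    rw [this]
    gcongr
  have hk := zerosIn_expSum_le_of_dominant (j := k) (θ := θ) (A := θ + D / κ * (l * η)) (B := θ + ε)
    hq ht hC hl0 hl2 hl8 (by have : 0 ≤ D / κ * (l * η) := by positivity
                             linarith) (by linarith) (by linarith) hη1
    (fun y hy1 hy2 v hv => by
      have h1 := hp.above (y - θ) (by
        have : 0 ≤ D / κ * (l * η) := by positivity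
        linarith) (by linarith) v hv
      rw [add_sub_cancel] at h1
      have h2 := hκD (y - θ) (by linarith)
      linarith)
  have hj := zerosIn_expSum_le_of_dominant (j := j) (θ := θ) (A := θ - ε) (B := θ - D / κ * (l * η))
    hq ht hC hl0 hl2 hl8 (by linarith) (by have : 0 ≤ D / κ * (l * η) := by positivity
                                           linarith) (by linarith) hη1
    (fun y hy1 hy2 v hv => by
      have h1 := hp.below (θ - y) (by
        have : 0 ≤ D / κ * (l * η) := by positivity
        linarith) (by linarith) v hv
      rw [sub_sub_cancel] at h1
      have h2 := hκD (θ - y) (by linarith)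
      linarith)
  have hFd : Differentiable ℂ (expSum q w h) := differentiable_expSum hent
  have hb1 : Bornology.IsBounded {s : ℂ | l ≤ s.re ∧ s.re ≤ l + 1 ∧
      θ + D / κ * (l * η) + η ≤ s.im ∧ s.im ≤ θ + ε - η} :=
    isBounded_subset_re_im fun s hs => ⟨⟨hs.1, hs.2.1⟩, hs.2.2⟩
  have hb2 : Bornology.IsBounded {s : ℂ | l ≤ s.re ∧ s.re ≤ l + 1 ∧
      θ - ε + η ≤ s.im ∧ s.im ≤ θ - D / κ * (l * η) - η} :=
    isBounded_subset_re_im fun s hs => ⟨⟨hs.1, hs.2.1⟩, hs.2.2⟩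
  have hmono := (zerosIn_mono hFd hF (A := {s | l ≤ s.re ∧ s.re ≤ l + 1 ∧ |s.im - θ| ≤ ε / 2 ∧
      s ∉ rayStrip p θ ((D / κ + 1) * Real.exp p)}) (hb1.union hb2) ?_).trans
    (zerosIn_union_le hFd hF hb1 hb2)
  · have hcast := (Nat.cast_le (α := ℝ)).2 hmono
    push_cast at hcast
    linarith
  · rintro s ⟨h1, h2, h3, h4⟩ -
    simp only [rayStrip, mem_ofPred_eq, not_lt] at h4
    have h5 : (D / κ + 1) * (l * η) ≤ |s.im - θ| := by
      refine le_trans ?_ h4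
      have h6 : η ≤ Real.exp p * Real.exp (-(p * s.re)) := by
        rw [hη, ← Real.exp_add, Real.exp_le_exp]
        have : (p : ℝ) * s.re ≤ p * (l + 1) := by gcongr
        linarith
      have hre : 0 ≤ s.re := by linarith
      have h7 : l * η ≤ s.re * (Real.exp p * Real.exp (-(p * s.re))) := by gcongr
      calc (D / κ + 1) * (l * η) ≤
          (D / κ + 1) * (s.re * (Real.exp p * Real.exp (-(p * s.re)))) := by gcongr
        _ = _ := by ring
    rcases le_total 0 (s.im - θ) with hs | hs
    · rw [abs_of_nonneg hs] at h3 h5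
      left
      exact ⟨h1, h2, by linarith, by linarith⟩
    · rw [abs_of_nonpos hs] at h3 h5
      right
      exact ⟨h1, h2, by linarith, by linarith⟩

/-- Few zeros near a direction that is not critical. -/
lemma eventually_zerosIn_sector_le (hp1 : 1 ≤ p) (hq : q = p + d) (ht : ∀ v, Tame d (h v) C x₀)
    (hC : 1 ≤ C) {j : ι} {θ δ ε : ℝ} (hδ : 0 < δ) (hε : 0 < ε) (hε1 : ε ≤ 1)
    (hdom : ∀ y, |y - θ| ≤ ε → ∀ v, v ≠ j → dirRe q (w v) y + δ ≤ dirRe q (w j) y)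
    (hF : expSum q w h ≠ 0) :
    ∀ᶠ l : ℝ in atTop, (zerosIn (expSum q w h)
      {s | l ≤ s.re ∧ s.re ≤ l + 1 ∧ |s.im - θ| ≤ ε / 2} : ℝ) ≤ 2 * C * Real.exp (d * l) := by
  set D := domConst C q d (Fintype.card ι) with hD
  have hD0 : 0 < D := domConst_pos (by linarith) _ _ _
  filter_upwards [eventually_ge_atTop x₀, eventually_ge_atTop 2, eventually_ge_atTop (8 * C),
    eventually_mul_exp_neg_le hp1 (show 0 < ε / 2 by positivity),
    eventually_mul_exp_neg_le hp1 (show 0 < δ / D by positivity)] with l hl0 hl2 hl8 hsm hsm'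
  set η := Real.exp (-(p * l)) with hη
  have hη0 : 0 < η := Real.exp_pos _
  rw [le_div_iff₀ hD0] at hsm'
  have hlη : η ≤ l * η := by nlinarith
  have hj := zerosIn_expSum_le_of_dominant (j := j) (θ := θ) (A := θ - ε) (B := θ + ε)
    hq ht hC hl0 hl2 hl8 (by linarith) (by linarith) (by linarith) (by linarith)
    (fun y hy1 hy2 v hv => by
      have := hdom y (by rw [abs_le]; constructor <;> linarith) v hv
      linarith)
  have hFd : Differentiable ℂ (expSum q w h) := differentiable_expSum fun v => (ht v).entire
  have hmono := zerosIn_mono hFd hF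
    (A := {s | l ≤ s.re ∧ s.re ≤ l + 1 ∧ |s.im - θ| ≤ ε / 2})
    (B := {s | l ≤ s.re ∧ s.re ≤ l + 1 ∧ θ - ε + η ≤ s.im ∧ s.im ≤ θ + ε - η})
    (isBounded_subset_re_im fun s hs => ⟨⟨hs.1, hs.2.1⟩, hs.2.2⟩) (by
      rintro s ⟨h1, h2, h3⟩ -
      rw [abs_le] at h3
      exact ⟨h1, h2, by linarith, by linarith⟩)
  exact le_trans (by exact_mod_cast hmono) hj

/-- The derivative q e^{qt} times a shift e^{-pl} is O(e^{dl}), so moving the ends of a box to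
generic positions changes the main term only within the error. -/
lemma abs_exp_sub_exp_le {p d q : ℕ} (hq : q = p + d) {l t t₀ : ℝ} (ht : t ≤ l + 2)
    (ht₀ : t₀ ≤ l + 2) (h : |t - t₀| ≤ Real.exp (-(p * l))) :
    |Real.exp (q * t) - Real.exp (q * t₀)| ≤ q * Real.exp (2 * q) * Real.exp (d * l) := by
  have key : ∀ a b : ℝ, a ≤ b → b ≤ l + 2 → b - a ≤ Real.exp (-(p * l)) →
      Real.exp (q * b) - Real.exp (q * a) ≤ q * Real.exp (2 * q) * Real.exp (d * l) := by
    intro a b hab hb hba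
    have h1 := Real.add_one_le_exp (q * (a - b))
    have h2 : Real.exp (q * a) = Real.exp (q * b) * Real.exp (q * (a - b)) := by
      rw [← Real.exp_add]; ring_nf
    have h3 : Real.exp (q * b) - Real.exp (q * a) ≤ Real.exp (q * b) * (q * (b - a)) := by
      rw [h2]
      nlinarith [Real.exp_pos (q * b)]
    have h4 : Real.exp (q * b) ≤ Real.exp (q * (l + 2)) := by gcongr
    refine h3.trans ?_
    calc Real.exp (q * b) * (q * (b - a))
        ≤ Real.exp (q * (l + 2)) * (q * Real.exp (-(p * l))) := by
          have : 0 ≤ b - a := by linarith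
          gcongr
      _ = q * Real.exp (2 * q) * Real.exp (d * l) := by
          have : Real.exp (q * (l + 2)) * Real.exp (-(p * l)) =
              Real.exp (2 * q) * Real.exp (d * l) := by
            rw [← Real.exp_add, ← Real.exp_add, hq]; push_cast; ring_nf
          linear_combination (q : ℝ) * this
  rcases le_total t t₀ with hle | hle
  · rw [abs_sub_comm, abs_of_nonneg (sub_nonneg.2 (Real.exp_le_exp.2 (by gcongr)))]
    rw [abs_sub_comm, abs_of_nonneg (by linarith)] at h
    exact key t t₀ hle ht₀ h
  · rw [abs_of_nonneg (sub_nonneg.2 (Real.exp_le_exp.2 (by gcongr)))]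
    rw [abs_of_nonneg (by linarith)] at h
    exact key t₀ t hle ht h

/-- The number of zeros in a unit piece of a strip around a critical ray. -/
lemma eventually_zerosIn_strip (hp1 : 1 ≤ p) (hq : q = p + d) (ht : ∀ v, Tame d (h v) C x₀)
    (hC : 1 ≤ C) {j k : ι} {θ κ ε : ℝ} (hp : DominantPair q w θ κ ε j k)
    (hF : expSum q w h ≠ 0) {c c₁ : ℝ} (hc₁ : c₁ ≤ c) (hc : 0 < c)
    (hband : ∀ᶠ l : ℝ in atTop, (zerosIn (expSum q w h)
      {s | l ≤ s.re ∧ s.re ≤ l + 1 ∧ |s.im - θ| ≤ ε / 2 ∧ s ∉ rayStrip p θ c₁} : ℝ) ≤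
      4 * C * Real.exp (d * l)) :
    ∃ K, 0 ≤ K ∧ ∀ᶠ l : ℝ in atTop, |(zerosIn (expSum q w h)
      {s | l ≤ s.re ∧ s.re < l + 1 ∧ s ∈ rayStrip p θ c} : ℝ) -
      ‖w j - w k‖ * (Real.exp (q * (l + 1)) - Real.exp (q * l)) / (2 * Real.pi)| ≤
      K * (l * Real.exp (d * l)) := by
  obtain ⟨A, hA⟩ : ∃ A, ∀ v, ‖w v‖ ≤ A :=
    ⟨∑ v, ‖w v‖, fun v => Finset.single_le_sum (f := fun v => ‖w v‖)
      (fun _ _ => norm_nonneg _) (Finset.mem_univ v)⟩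
  set D := domConst C q d (Fintype.card ι) with hD
  have hD0 : 0 < D := domConst_pos (by linarith) _ _ _
  have hκ := hp.kappa_pos
  have hε := hp.eps_pos
  have hε1 := hp.eps_le
  have hDκ : 0 < D / κ := div_pos hD0 hκ
  set V := vertConst C A κ q d (Fintype.card ι) with hV
  have hA0 : 0 ≤ A := (norm_nonneg _).trans (hA j)
  have hV0 : 0 ≤ V := by
    rw [hV]; unfold vertConst
    positivity
  set W := ‖w j - w k‖ with hW
  have hW0 : 0 ≤ W := norm_nonneg _
  have hent : ∀ v, Differentiable ℂ (h v) := fun v => (ht v).entire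
  have hFd : Differentiable ℂ (expSum q w h) := differentiable_expSum hent
  -- The error of the box count, the cost of moving the ends of the box, and the zeros between the
  -- strip and the box.
  refine ⟨V + W * (q * Real.exp (2 * q)) + 4 * C, by positivity, ?_⟩
  filter_upwards [eventually_ge_atTop x₀, eventually_ge_atTop 3, eventually_ge_atTop (8 * C),
    eventually_mul_exp_neg_le hp1 (show 0 < ε / (48 * (D / κ + 1)) by positivity),
    eventually_mul_exp_neg_le hp1 (show 0 < ε / (16 * c) by positivity), hband]
    with l hl0 hl3 hl8 hsm hsmc hbl
  set η := Real.exp (-(p * l)) with hη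
  have hη0 : 0 < η := Real.exp_pos _
  have hlη : η ≤ l * η := by nlinarith
  rw [le_div_iff₀ (by positivity)] at hsm hsmc
  have hsm' : 48 * ((D / κ + 1) * (l * η)) ≤ ε := by linarith
  have hη3 : 48 * η ≤ 1 := by
    have : 0 ≤ D / κ * (l * η) := by positivity
    nlinarith
  set E := l * Real.exp (d * l) with hE
  have hdE : Real.exp (d * l) ≤ E := le_mul_of_one_le_left (Real.exp_nonneg _) (by linarith)
  have hdE0 : 0 < Real.exp (d * l) := Real.exp_pos _
  -- the strip is contained in thin boxes
  have hstrip : ∀ s ∈ rayStrip p θ c, l ≤ s.re → s.re < l + 1 → |s.im - θ| < ε / 4 := by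
    intro s hs h1 h2
    refine lt_of_lt_of_le hs ?_
    have h3 : Real.exp (-(p * s.re)) ≤ η := by
      rw [hη]; gcongr
    have h4 : s.re * Real.exp (-(p * s.re)) ≤ (2 * l) * η := by
      gcongr
      linarith
    calc c * (s.re * Real.exp (-(p * s.re))) ≤ c * ((2 * l) * η) := by gcongr
      _ ≤ ε / 4 := by nlinarith
  have hpi : 1 ≤ 2 * Real.pi := by linarith [Real.pi_gt_three]
  have hcmp : ∀ X₀ X₁ : ℝ, |X₀ - l| ≤ η → |X₁ - (l + 1)| ≤ η →
      |W * (Real.exp (q * X₁) - Real.exp (q * X₀)) / (2 * Real.pi) -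
        W * (Real.exp (q * (l + 1)) - Real.exp (q * l)) / (2 * Real.pi)| ≤
      W * (q * Real.exp (2 * q)) * E := by
    intro X₀ X₁ h0 h1
    have e0 := abs_exp_sub_exp_le hq (l := l) (t := X₀) (t₀ := l)
      (by linarith [(abs_le.1 h0).2]) (by linarith) h0
    have e1 := abs_exp_sub_exp_le hq (l := l) (t := X₁) (t₀ := l + 1)
      (by linarith [(abs_le.1 h1).2]) (by linarith) h1
    rw [← sub_div, ← mul_sub, abs_div, abs_mul, abs_of_nonneg hW0,
      abs_of_pos (by positivity : 0 < 2 * Real.pi), div_le_iff₀ (by positivity)]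
    have e2 : |Real.exp (q * X₁) - Real.exp (q * X₀) -
        (Real.exp (q * (l + 1)) - Real.exp (q * l))| ≤
        2 * (q * Real.exp (2 * q) * Real.exp (d * l)) := by
      rw [abs_le] at e0 e1 ⊢
      constructor <;> linarith
    calc W * |Real.exp (q * X₁) - Real.exp (q * X₀) -
        (Real.exp (q * (l + 1)) - Real.exp (q * l))|
        ≤ W * (2 * (q * Real.exp (2 * q) * Real.exp (d * l))) := by gcongr
      _ ≤ W * (2 * (q * Real.exp (2 * q) * E)) := by gcongr
      _ = W * (q * Real.exp (2 * q)) * E * 2 := by ring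
      _ ≤ _ := by
        have : 0 ≤ W * (q * Real.exp (2 * q)) * E := by positivity
        have := Real.pi_gt_three
        gcongr
        linarith
  set S : Set ℂ := {s | l ≤ s.re ∧ s.re < l + 1 ∧ s ∈ rayStrip p θ c} with hS
  have hSb : Bornology.IsBounded S := isBounded_subset_re_im
    (a := l) (b := l + 1) (y₀ := θ - ε / 4) (y₁ := θ + ε / 4) fun s hs => by
      have := abs_lt.1 (hstrip s hs.2.2 hs.1 hs.2.1)
      exact ⟨⟨hs.1, hs.2.1.le⟩, by linarith, by linarith⟩
  -- Sandwich: a slightly longer box contains the piece of the strip, and a slightly shorter one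
  -- exceeds it only by zeros outside the narrower strip of parameter c₁, of which there are few.
  obtain ⟨X₀, X₁, Y₀, Y₁, a1, a2, a3, a4, a5, a6, a7, a8, hup⟩ := exists_box_count hq ht hC hA hp
    hF (l := l) (a := l - η) (b := l + 1) hl0 hl3 hl8 hsm' (by linarith) (by linarith)
    (by linarith)
  obtain ⟨X₀', X₁', Y₀', Y₁', b1, b2, b3, b4, b5, b6, b7, b8, hdn⟩ := exists_box_count hq ht hC hA
    hp hF (l := l) (a := l) (b := l + 1 - η) hl0 hl3 hl8 hsm' (by linarith) (by linarith)
    (by linarith)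
  have hmono1 := zerosIn_mono hFd hF (A := S) (isBounded_openBox X₀ X₁ Y₀ Y₁) (by
    rintro s ⟨h1, h2, h3⟩ -
    have := abs_lt.1 (hstrip s h3 h1 h2)
    exact ⟨by linarith, by linarith, by linarith, by linarith⟩)
  set T : Set ℂ := {s | l ≤ s.re ∧ s.re ≤ l + 1 ∧ |s.im - θ| ≤ ε / 2 ∧ s ∉ rayStrip p θ c₁} with hT
  have hTb : Bornology.IsBounded T := isBounded_subset_re_im
    (a := l) (b := l + 1) (y₀ := θ - ε / 2) (y₁ := θ + ε / 2) fun s hs => by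
      have := abs_le.1 hs.2.2.1
      exact ⟨⟨hs.1, hs.2.1⟩, by linarith, by linarith⟩
  have hmono2 := (zerosIn_mono hFd hF (A := openBox X₀' X₁' Y₀' Y₁') (hSb.union hTb) (by
    rintro s ⟨h1, h2, h3, h4⟩ -
    by_cases hs : s ∈ rayStrip p θ c
    · exact Or.inl ⟨by linarith, by linarith, hs⟩
    · refine Or.inr ⟨by linarith, by linarith, by rw [abs_le]; constructor <;> linarith, ?_⟩
      intro hs'
      have h5 : 0 ≤ s.re := by linarith
      have hlt : |s.im - θ| < c₁ * (s.re * Real.exp (-(p * s.re))) := hs'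
      exact hs (show |s.im - θ| < c * (s.re * Real.exp (-(p * s.re))) from
        lt_of_lt_of_le hlt (by gcongr)))).trans (zerosIn_union_le hFd hF hSb hTb)
  have hm1 : (zerosIn (expSum q w h) S : ℝ) ≤ zerosIn (expSum q w h) (openBox X₀ X₁ Y₀ Y₁) := by
    exact_mod_cast hmono1
  have hm2 : (zerosIn (expSum q w h) (openBox X₀' X₁' Y₀' Y₁') : ℝ) ≤
      zerosIn (expSum q w h) S + zerosIn (expSum q w h) T := by exact_mod_cast hmono2
  have c1 := hcmp X₀ X₁ (by rw [abs_le]; constructor <;> linarith)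
    (by rw [abs_le]; constructor <;> linarith)
  have c2 := hcmp X₀' X₁' (by rw [abs_le]; constructor <;> linarith)
    (by rw [abs_le]; constructor <;> linarith)
  have hCE : 4 * C * Real.exp (d * l) ≤ 4 * C * E := by gcongr
  rw [abs_le] at hup hdn c1 c2 ⊢
  have hCE0 : 0 ≤ 4 * C * E := by positivity
  rw [add_mul, add_mul]
  constructor <;> linarith

end


/-! ### Nonvanishing, and summation over slabs -/

section

variable {ι : Type*} [Fintype ι] {p d q : ℕ} {w : ι → ℂ} {h : ι → ℂ → ℂ} {C x₀ : ℝ}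

/-- At a point where one exponent dominates and which keeps away from the zeros of its coefficient,
the normalised sum divided by that coefficient is within 1/2 of 1. -/
lemma expSum_ne_zero [Nonempty ι] (hp1 : 1 ≤ p) (hq : q = p + d)
    (ht : ∀ v, Tame d (h v) C x₀) (hC : 1 ≤ C) (hw : Function.Injective w) :
    expSum q w h ≠ 0 := by
  intro hzero
  obtain ⟨k, -, ε, hε, hε1, hdom⟩ := exists_dominant_right (q := q) (by omega) hw 0
  have hD0 : 0 < domConst C q d (Fintype.card ι) := domConst_pos (by linarith) _ _ _
  obtain ⟨l, hl0, hl2, hl8, hsm, hsm'⟩ := ((eventually_ge_atTop x₀).and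
    ((eventually_ge_atTop 2).and ((eventually_ge_atTop (8 * C)).and
    ((eventually_mul_exp_neg_le hp1 (show 0 < ε / 2 by positivity)).and
    (eventually_mul_exp_neg_le hp1 (show 0 < ε * (ε / 2) / domConst C q d (Fintype.card ι) by
      positivity)))))).exists
  rw [le_div_iff₀ hD0] at hsm'
  obtain ⟨Z, hZc, hlow, -, -⟩ := (ht k).localStructure hC q hl0 (by linarith) 0
  have hη : Real.exp (-(p * l)) ≤ l * Real.exp (-(p * l)) := by
    have := Real.exp_pos (-(p * l))
    nlinarith
  obtain ⟨y, h1, h2, h3, -⟩ := exists_generic (a := ε / 2) (b := ε)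
    (Real.exp_nonneg (-((q + 1) * l))) (Z.image im) finite_empty (by
      have h1 : ((Z.image im).card : ℝ) ≤ Z.card := by exact_mod_cast Finset.card_image_le
      have h2 : 0 ≤ C * Real.exp (d * l) := by positivity
      have := exp_gap hq hl8 (N := (Z.image im).card) (by linarith)
      linarith)
  set s : ℂ := ⟨l, y⟩ with hs
  have hlow' := hlow s (by simp [hs]) (by
    simp only [hs, sub_zero]; rw [abs_le]; constructor <;> linarith) (by
      intro a ha
      refine (h3 _ (Finset.mem_image_of_mem im ha)).trans ?_
      simpa [hs] using abs_im_le_norm (s - a))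
  have hle := norm_expSum_div_sub_one_le (j := k) (l := l) (s := s) (w := w) hq ht hC hl2
    (by simp [hs]) (by simp [hs]) (by
      intro v hv
      have := hdom y (by linarith) h2.le v hv
      rw [zero_add] at this
      have h4 : ε * (ε / 2) ≤ ε * y := by gcongr
      simp only [hs]
      linarith) hlow'
  have hF : expSum q (fun v => w v - w k) h s = 0 := by
    have := expSum_eq (q := q) (w := w) (h := h) k s
    rw [hzero] at this
    simpa using this.symm
  rw [hF] at hle
  norm_num at hle

/-- For d ≥ 1 each term is at most half of the preceding one, and the additional last term makes the
induction telescope. The summand `n` is there for d = 0, where every term is 1. -/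
lemma sum_exp_le (d : ℕ) (X : ℝ) (n : ℕ) :
    ∑ i ∈ Finset.range n, Real.exp (d * (X - (i + 1))) + Real.exp (d * (X - n)) ≤
      Real.exp (d * X) + n := by
  induction n with
  | zero => simp
  | succ n ih =>
    rw [Finset.sum_range_succ]
    push_cast
    rcases Nat.eq_zero_or_pos d with rfl | hd
    · simp at ih ⊢
      linarith
    · have h1 : 2 * Real.exp (d * (X - (n + 1))) ≤ Real.exp (d * (X - n)) := by
        have h2 : (d : ℝ) * (X - n) = d + d * (X - (n + 1)) := by ring
        have hd' : (1 : ℝ) ≤ d := by exact_mod_cast hd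
        have h3 : 2 ≤ Real.exp d := by linarith [Real.add_one_le_exp (d : ℝ)]
        rw [h2, Real.exp_add]
        gcongr
      linarith

/-- Summation of unit pieces of the logarithmic plane. -/
lemma abs_zerosIn_sub_le {F : ℂ → ℂ} (hF : Differentiable ℂ F) (h0 : F ≠ 0) {S : Set ℂ}
    (hS : ∀ a b : ℝ, Bornology.IsBounded {s : ℂ | a ≤ s.re ∧ s.re < b ∧ s ∈ S})
    {B : ℝ → ℝ} {K x₁ X : ℝ} (hK : 0 ≤ K)
    (hunit : ∀ l, x₁ ≤ l → l + 1 ≤ X → |(zerosIn F {s | l ≤ s.re ∧ s.re < l + 1 ∧ s ∈ S} : ℝ) -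
      (B (l + 1) - B l)| ≤ K * Real.exp (d * l)) {n : ℕ} (hn : x₁ ≤ X - n) :
    |(zerosIn F {s | X - n ≤ s.re ∧ s.re < X ∧ s ∈ S} : ℝ) - (B X - B (X - n))| ≤
      K * (Real.exp (d * X) + n) := by
  have key : ∀ n : ℕ, x₁ ≤ X - n →
      |(zerosIn F {s | X - n ≤ s.re ∧ s.re < X ∧ s ∈ S} : ℝ) - (B X - B (X - n))| ≤
      K * ∑ i ∈ Finset.range n, Real.exp (d * (X - (i + 1))) := by
    intro n
    induction n with
    | zero =>
      intro _
      have : {s : ℂ | X ≤ s.re ∧ s.re < X ∧ s ∈ S} = ∅ :=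
        eq_empty_of_forall_notMem fun s hs => by
          have := hs.1.trans_lt hs.2.1
          exact lt_irrefl _ this
      simp [this, zerosIn]
    | succ n ih =>
      intro hn
      push_cast at hn ⊢
      have hsplit : {s : ℂ | X - (n + 1) ≤ s.re ∧ s.re < X ∧ s ∈ S} =
          {s | X - (n + 1) ≤ s.re ∧ s.re < X - (n + 1) + 1 ∧ s ∈ S} ∪
          {s | X - n ≤ s.re ∧ s.re < X ∧ s ∈ S} := by
        ext s
        simp only [mem_union, mem_ofPred_eq]
        constructor
        · rintro ⟨h1, h2, h3⟩
          rcases lt_or_ge s.re (X - (n + 1) + 1) with h | h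
          · exact Or.inl ⟨h1, h, h3⟩
          · exact Or.inr ⟨by linarith, h2, h3⟩
        · have : (0 : ℝ) ≤ n := Nat.cast_nonneg n
          rintro (⟨h1, h2, h3⟩ | ⟨h1, h2, h3⟩)
          · exact ⟨h1, by linarith, h3⟩
          · exact ⟨by linarith, h2, h3⟩
      rw [hsplit, zerosIn_union_disjoint hF h0 (hS _ _) (hS _ _), Finset.sum_range_succ]
      · have h1 := ih (by linarith)
        have h2 := hunit (X - (n + 1)) hn (by
          have : (0 : ℝ) ≤ n := Nat.cast_nonneg n
          linarith)
        rw [show X - (n + 1 : ℝ) + 1 = X - n by ring] at h2 ⊢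
        push_cast
        rw [abs_le] at h1 h2 ⊢
        rw [mul_add]
        constructor <;> linarith
      · rw [Set.disjoint_left]
        rintro s ⟨_, h1, _⟩ ⟨h2, _, _⟩
        linarith
  refine (key n hn).trans ?_
  gcongr
  linarith [sum_exp_le d X n, Real.exp_pos (d * (X - n))]

end

/-! ### Strips and angles as images under the exponential map -/

lemma logStrip_eq_image (p : ℕ) (θ c : ℝ) :
    logStrip p θ c = exp '' {s | 0 < s.re ∧ s ∈ rayStrip p θ c} := by
  ext z
  constructor
  · rintro ⟨r, y, hr, hy, rfl⟩
    have hr0 : 0 < r := by linarith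
    refine ⟨⟨Real.log r, y⟩, ⟨Real.log_pos hr, ?_⟩, ?_⟩
    · show |y - θ| < c * (Real.log r * Real.exp (-(p * Real.log r)))
      rw [Real.exp_neg, Real.exp_nat_mul, Real.exp_log hr0, ← mul_assoc, ← div_eq_mul_inv]
      exact hy
    · rw [mk_eq_add_mul_I, exp_add, ← ofReal_exp, Real.exp_log hr0]
  · rintro ⟨s, ⟨hs0, hs⟩, rfl⟩
    refine ⟨Real.exp s.re, s.im, Real.one_lt_exp_iff.2 hs0, ?_, ?_⟩
    · have hs' : |s.im - θ| < c * (s.re * Real.exp (-(p * s.re))) := hs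
      rwa [Real.exp_neg, Real.exp_nat_mul, ← mul_assoc, ← div_eq_mul_inv,
        ← Real.log_exp s.re, Real.exp_log (Real.exp_pos _)] at *
    · rw [ofReal_exp, ← exp_add, re_add_im]

lemma openAngle_eq_image (θ ε : ℝ) : openAngle θ ε = exp '' {s | |s.im - θ| < ε} := by
  ext z
  constructor
  · rintro ⟨r, y, hr, hy, rfl⟩
    refine ⟨⟨Real.log r, y⟩, hy, ?_⟩
    rw [mk_eq_add_mul_I, exp_add, ← ofReal_exp, Real.exp_log hr]
  · rintro ⟨s, hs, rfl⟩
    refine ⟨Real.exp s.re, s.im, Real.exp_pos _, hs, ?_⟩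
    rw [ofReal_exp, ← exp_add, re_add_im]

lemma exp_mem_ball {s : ℂ} {X : ℝ} : exp s ∈ Metric.ball (0 : ℂ) (Real.exp X) ↔ s.re < X := by
  rw [mem_ball_zero_iff, norm_exp, Real.exp_lt_exp]

lemma exp_add_two_pi_int (s : ℂ) (n : ℤ) : exp (s + (2 * Real.pi * n : ℝ) * I) = exp s := by
  rw [exp_eq_exp_iff_exists_int]
  exact ⟨n, by push_cast; ring⟩

lemma injOn_exp_of_abs_im {S : Set ℂ} {θ : ℝ} (hS : ∀ s ∈ S, |s.im - θ| ≤ 1) : InjOn exp S := by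
  intro s hs t ht hst
  obtain ⟨n, hn⟩ := exp_eq_exp_iff_exists_int.1 hst
  have him := congrArg im hn
  have h1 := abs_le.1 (hS s hs)
  have h2 := abs_le.1 (hS t ht)
  simp at him
  have hn0 : n = 0 := by
    have hpi := Real.pi_gt_three
    have h3 : (n : ℝ) < 1 := by
      by_contra hcon
      push Not at hcon
      nlinarith
    have h4 : -1 < (n : ℝ) := by
      by_contra hcon
      push Not at hcon
      nlinarith
    have h3' : n < 1 := by exact_mod_cast h3
    have h4' : -1 < n := by exact_mod_cast h4
    omega
  rw [hn, hn0]
  simp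


/-! ### Periodicity in the direction, and counts around an arbitrary direction -/

section

variable {ι : Type*} {p d q : ℕ} {w : ι → ℂ} {h : ι → ℂ → ℂ} {C x₀ : ℝ}

lemma dirRe_add_two_pi (q : ℕ) (a : ℂ) (y : ℝ) (n : ℤ) :
    dirRe q a (y + 2 * Real.pi * n) = dirRe q a y := by
  have h : exp (q * (y + 2 * Real.pi * n : ℝ) * I) = exp (q * y * I) :=
    exp_eq_exp_iff_exists_int.2 ⟨q * n, by push_cast; ring⟩
  rw [dirRe, dirRe, h]

lemma exp_add_two_pi (q : ℕ) (y : ℝ) (n : ℤ) :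
    exp (q * (y + 2 * Real.pi * n : ℝ) * I) = exp (q * y * I) :=
  exp_eq_exp_iff_exists_int.2 ⟨q * n, by push_cast; ring⟩

lemma DominantPair.add_two_pi {j k : ι} {θ κ ε : ℝ} (hp : DominantPair q w θ κ ε j k) (n : ℤ) :
    DominantPair q w (θ + 2 * Real.pi * n) κ ε j k where
  kappa_pos := hp.kappa_pos
  eps_pos := hp.eps_pos
  eps_le := hp.eps_le
  below u h0 h1 v hv := by
    rw [show θ + 2 * Real.pi * n - u = θ - u + 2 * Real.pi * n by ring, dirRe_add_two_pi,
      dirRe_add_two_pi]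
    exact hp.below u h0 h1 v hv
  above u h0 h1 v hv := by
    rw [show θ + 2 * Real.pi * n + u = θ + u + 2 * Real.pi * n by ring, dirRe_add_two_pi,
      dirRe_add_two_pi]
    exact hp.above u h0 h1 v hv
  diff := by rw [exp_add_two_pi]; exact hp.diff

lemma IsCriticalAngle.add_two_pi {W : Set ℂ} {θ : ℝ} (hθ : IsCriticalAngle q W θ) (n : ℤ) :
    IsCriticalAngle q W (θ + 2 * Real.pi * n) := by
  unfold IsCriticalAngle
  rw [exp_add_two_pi]
  exact hθ

lemma logStrip_add_two_pi (p : ℕ) (θ c : ℝ) (n : ℤ) :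
    logStrip p (θ + 2 * Real.pi * n) c = logStrip p θ c := by
  ext z
  constructor
  · rintro ⟨r, y, hr, hy, rfl⟩
    refine ⟨r, y - 2 * Real.pi * n, hr, by convert hy using 2; ring, ?_⟩
    congr 1
    exact exp_eq_exp_iff_exists_int.2 ⟨n, by push_cast; ring⟩
  · rintro ⟨r, y, hr, hy, rfl⟩
    refine ⟨r, y + 2 * Real.pi * n, hr, by convert hy using 2; ring, ?_⟩
    congr 1
    exact exp_eq_exp_iff_exists_int.2 ⟨-n, by push_cast; ring⟩

/-- Near a critical direction there is no other one. -/
lemma DominantPair.eq_of_isCriticalAngle {j k : ι} {θ κ ε y : ℝ}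
    (hp : DominantPair q w θ κ ε j k) (hy : |y - θ| ≤ ε)
    (hcrit : IsCriticalAngle q (range w) y) : y = θ := by
  obtain ⟨a, ⟨v₁, rfl⟩, b, ⟨v₂, rfl⟩, hne, heq, hmax⟩ := hcrit
  by_contra hyθ
  have key : ∀ i : ι, (∀ v, v ≠ i → dirRe q (w v) y < dirRe q (w i) y) → False := by
    intro i hi
    have h1 : v₁ = i := by
      by_contra hv
      exact absurd (hmax _ ⟨i, rfl⟩) (not_le.2 (hi v₁ hv))
    have h2 : v₂ = i := by
      by_contra hv
      have h3 : dirRe q (w i) y ≤ dirRe q (w v₂) y := (hmax _ ⟨i, rfl⟩).trans heq.le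
      exact absurd h3 (not_le.2 (hi v₂ hv))
    exact hne (by rw [h1, h2])
  rw [abs_le] at hy
  rcases lt_or_gt_of_ne hyθ with hlt | hgt
  · refine key j fun v hv => ?_
    have := hp.below (θ - y) (by linarith) (by linarith) v hv
    rw [sub_sub_cancel] at this
    nlinarith [hp.kappa_pos]
  · refine key k fun v hv => ?_
    have := hp.above (y - θ) (by linarith) (by linarith) v hv
    rw [add_sub_cancel] at this
    nlinarith [hp.kappa_pos]

lemma isBounded_rayStrip (p : ℕ) (θ : ℝ) {c : ℝ} (hc : 0 ≤ c) (a b : ℝ) :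
    Bornology.IsBounded {s : ℂ | a ≤ s.re ∧ s.re < b ∧ s ∈ rayStrip p θ c} := by
  set M := c * (|b| * Real.exp (p * |a|))
  refine isBounded_subset_re_im (a := a) (b := b) (y₀ := θ - M) (y₁ := θ + M) ?_
  rintro s ⟨h1, h2, h3⟩
  have h4 : |s.im - θ| < c * (s.re * Real.exp (-(p * s.re))) := h3
  have h5 : c * (s.re * Real.exp (-(p * s.re))) ≤ M := by
    refine mul_le_mul_of_nonneg_left ?_ hc
    have h6 : s.re ≤ |b| := h2.le.trans (le_abs_self b)
    refine mul_le_mul h6 (Real.exp_le_exp.2 ?_) (Real.exp_nonneg _) (abs_nonneg _)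
    have h7 : -s.re ≤ |a| := by linarith [neg_abs_le a]
    have : (p : ℝ) * -s.re ≤ p * |a| := by gcongr
    linarith
  have h6 := abs_lt.1 (h4.trans_le h5)
  exact ⟨⟨h1, h2.le⟩, by linarith, by linarith⟩

variable [Fintype ι]

/-- Unit pieces of the local zero counts, around an arbitrary direction. -/
lemma exists_local_count [Nonempty ι] (hp1 : 1 ≤ p) (hq : q = p + d)
    (ht : ∀ v, Tame d (h v) C x₀) (hC : 1 ≤ C) (hw : Function.Injective w)
    (θ : ℝ) :
    ∃ ε c₁, 0 < ε ∧ ε ≤ 1 ∧ 0 < c₁ ∧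
      (∀ y, |y - θ| ≤ ε → IsCriticalAngle q (range w) y → y = θ) ∧
      (∀ᶠ l : ℝ in atTop, (zerosIn (expSum q w h)
        {s | l ≤ s.re ∧ s.re < l + 1 ∧ s ∈ {s : ℂ | |s.im - θ| ≤ ε ∧
          (IsCriticalAngle q (range w) θ → s ∉ rayStrip p θ c₁)}} : ℝ) ≤
        4 * C * Real.exp (d * l)) ∧
      (IsCriticalAngle q (range w) θ → ∃ j k ε, j ≠ k ∧ DominantPair q w θ ε ε j k ∧
        (∀ v, v ≠ j → dirRe q (w v) θ = dirRe q (w j) θ →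
          (w v * exp (q * θ * I)).im < (w j * exp (q * θ * I)).im) ∧
        (∀ v, v ≠ k → dirRe q (w v) θ = dirRe q (w k) θ →
          (w k * exp (q * θ * I)).im < (w v * exp (q * θ * I)).im) ∧
        ∀ c, c₁ ≤ c → ∃ K, 0 ≤ K ∧ ∀ᶠ l : ℝ in atTop, |(zerosIn (expSum q w h)
          {s | l ≤ s.re ∧ s.re < l + 1 ∧ s ∈ rayStrip p θ c} : ℝ) -
          ‖w j - w k‖ * (Real.exp (q * (l + 1)) - Real.exp (q * l)) / (2 * Real.pi)| ≤
          K * (l * Real.exp (d * l))) := by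
  have hF := expSum_ne_zero hp1 hq ht hC hw
  have hFd : Differentiable ℂ (expSum q w h) := differentiable_expSum fun v => (ht v).entire
  -- Deleting the strip only when θ is critical gives critical and other directions a common form,
  -- which the compactness argument over a period needs.
  by_cases hθ : IsCriticalAngle q (range w) θ
  · obtain ⟨j, k, ε, hjk, hpair, hlj, hlk⟩ := exists_dominantPair (by omega) hw hθ
    obtain ⟨c₁, hc₁, hband⟩ := eventually_zerosIn_band_le hp1 hq ht hC hpair hF
    have hε := hpair.eps_pos
    have hε1 := hpair.eps_le
    refine ⟨ε / 2, c₁, by positivity, by linarith, hc₁, fun y hy =>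
      hpair.eq_of_isCriticalAngle (by linarith), ?_, fun _ => ⟨j, k, ε, hjk, hpair, hlj, hlk,
        fun c hc => eventually_zerosIn_strip hp1 hq ht hC hpair hF hc (hc₁.trans_le hc) hband⟩⟩
    filter_upwards [hband] with l hl
    refine le_trans ?_ hl
    have := zerosIn_mono hFd hF (A := {s | l ≤ s.re ∧ s.re < l + 1 ∧ s ∈ {s : ℂ | |s.im - θ| ≤ ε / 2 ∧
          (IsCriticalAngle q (range w) θ → s ∉ rayStrip p θ c₁)}})
      (B := {s | l ≤ s.re ∧ s.re ≤ l + 1 ∧ |s.im - θ| ≤ ε / 2 ∧ s ∉ rayStrip p θ c₁})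
      (isBounded_subset_re_im (a := l) (b := l + 1) (y₀ := θ - ε / 2) (y₁ := θ + ε / 2) fun s hs => by
        have := abs_le.1 hs.2.2.1
        exact ⟨⟨hs.1, hs.2.1⟩, by linarith, by linarith⟩)
      (fun s hs _ => ⟨hs.1, hs.2.1.le, hs.2.2.1, hs.2.2.2 hθ⟩)
    exact_mod_cast this
  · obtain ⟨j, δ, ε, hδ, hε, hε1, hdom⟩ := exists_dominant_of_not_critical hw hθ
    have hsec := eventually_zerosIn_sector_le hp1 hq ht hC hδ hε hε1 hdom hF
    refine ⟨ε / 2, 1, by positivity, by linarith, one_pos, ?_, ?_, fun h => absurd h hθ⟩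
    · rintro y hy ⟨a, ⟨v₁, rfl⟩, b, ⟨v₂, rfl⟩, hne, heq, hmax⟩
      exfalso
      have h1 : ∀ v, v ≠ j → dirRe q (w v) y < dirRe q (w j) y := fun v hv => by
        linarith [hdom y (by linarith) v hv]
      have h2 : v₁ = j := by
        by_contra hv
        exact absurd (hmax _ ⟨j, rfl⟩) (not_le.2 (h1 v₁ hv))
      have h3 : v₂ = j := by
        by_contra hv
        have h3 : dirRe q (w j) y ≤ dirRe q (w v₂) y := (hmax _ ⟨j, rfl⟩).trans heq.le
        exact absurd h3 (not_le.2 (h1 v₂ hv))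
      exact hne (by rw [h2, h3])
    filter_upwards [hsec] with l hl
    have := zerosIn_mono hFd hF (A := {s | l ≤ s.re ∧ s.re < l + 1 ∧ s ∈ {s : ℂ | |s.im - θ| ≤ ε / 2 ∧
          (IsCriticalAngle q (range w) θ → s ∉ rayStrip p θ 1)}})
      (B := {s | l ≤ s.re ∧ s.re ≤ l + 1 ∧ |s.im - θ| ≤ ε / 2})
      (isBounded_subset_re_im (a := l) (b := l + 1) (y₀ := θ - ε / 2) (y₁ := θ + ε / 2) fun s hs => by
        have := abs_le.1 hs.2.2
        exact ⟨⟨hs.1, hs.2.1⟩, by linarith, by linarith⟩)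
      (fun s hs _ => ⟨hs.1, hs.2.1.le, hs.2.2.1⟩)
    have h2 : (zerosIn (expSum q w h) {s | l ≤ s.re ∧ s.re < l + 1 ∧ s ∈ {s : ℂ | |s.im - θ| ≤ ε / 2 ∧
          (IsCriticalAngle q (range w) θ → s ∉ rayStrip p θ 1)}} : ℝ) ≤
      zerosIn (expSum q w h) {s | l ≤ s.re ∧ s.re ≤ l + 1 ∧ |s.im - θ| ≤ ε / 2} := by
      exact_mod_cast this
    have : 0 ≤ C * Real.exp (d * l) := by positivity
    exact (h2.trans hl).trans (by linarith)

end

/-- The exponential omits only 0, so otherwise `f` would vanish on a whole disc around 1. -/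
lemma comp_exp_ne_zero {f : ℂ → ℂ} (hf : Differentiable ℂ f) (h0 : f ≠ 0) :
    (fun s => f (exp s)) ≠ 0 := by
  intro hcon
  have : {z ∈ Metric.ball (1 : ℂ) 1 | f z = 0}.Finite := finite_zeros hf h0 Metric.isBounded_ball
  refine this.not_infinite ?_
  have h2 : Metric.ball (1 : ℂ) 1 ⊆ {z ∈ Metric.ball (1 : ℂ) 1 | f z = 0} := by
    intro z hz
    refine ⟨hz, ?_⟩
    have hz0 : z ≠ 0 := by
      rintro rfl
      simp at hz
    have := congrFun hcon (log z)
    simpa [exp_log hz0] using this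
  refine Infinite.mono h2 ?_
  exact infinite_of_mem_nhds (1 : ℂ) (Metric.ball_mem_nhds _ one_pos)

/-- Passage from the logarithmic plane: zeros of `f` in the image of a region of small height. -/
lemma exists_zeroCount_le {f : ℂ → ℂ} (hf : Differentiable ℂ f) (h0 : f ≠ 0) {d : ℕ} {S : Set ℂ}
    {θ K : ℝ} (hK : 0 ≤ K) (hS : ∀ s ∈ S, |s.im - θ| ≤ 1)
    (hunit : ∀ᶠ l : ℝ in atTop, (zerosIn (fun s => f (exp s))
      {s | l ≤ s.re ∧ s.re < l + 1 ∧ s ∈ S} : ℝ) ≤ K * Real.exp (d * l)) :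
    ∃ K', ∀ᶠ r : ℝ in atTop, (zeroCount f (exp '' S) r : ℝ) ≤ K' * (r ^ d + Real.log r) := by
  obtain ⟨x₁, hx₁⟩ := eventually_atTop.1 (hunit.and (eventually_ge_atTop 1))
  have hx1 : 1 ≤ x₁ := (hx₁ x₁ le_rfl).2
  have hF : Differentiable ℂ fun s => f (exp s) := hf.comp differentiable_exp
  have hF0 := comp_exp_ne_zero hf h0
  set N := zerosIn f (Metric.ball 0 (Real.exp (x₁ + 1))) with hN
  refine ⟨N + 2 * K, ?_⟩
  filter_upwards [eventually_ge_atTop (Real.exp (x₁ + 1))] with r hr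
  have hr0 : 0 < r := (Real.exp_pos _).trans_le hr
  set X := Real.log r with hX
  have hrX : r = Real.exp X := (Real.exp_log hr0).symm
  have hX1 : x₁ + 1 ≤ X := by rwa [hrX, Real.exp_le_exp] at hr
  -- Unit slabs are removed downwards from X = log r. What is left has real part below x₁ + 1 and
  -- contributes the constant `N`.
  set n := ⌊X - x₁⌋₊ with hn
  have hn1 : (n : ℝ) ≤ X - x₁ := Nat.floor_le (by linarith)
  have hn2 : X - x₁ < n + 1 := Nat.lt_floor_add_one _
  have hSb : ∀ a b : ℝ, Bornology.IsBounded {s : ℂ | a ≤ s.re ∧ s.re < b ∧ s ∈ S} := fun a b =>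
    isBounded_subset_re_im (a := a) (b := b) (y₀ := θ - 1) (y₁ := θ + 1) fun s hs => by
      have := abs_le.1 (hS s hs.2.2)
      exact ⟨⟨hs.1, hs.2.1.le⟩, by linarith, by linarith⟩
  have hsum := abs_zerosIn_sub_le hF hF0 hSb (d := d) (B := fun _ => 0) (K := K) (x₁ := x₁) (X := X) hK
    (fun l hl _ => by
      rw [sub_self, sub_zero, abs_of_nonneg (Nat.cast_nonneg _)]
      exact (hx₁ l hl).1) (n := n) (by linarith)
  rw [sub_self, sub_zero, abs_of_nonneg (Nat.cast_nonneg _), zerosIn_comp_exp f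
    (injOn_exp_of_abs_im fun s hs => hS s hs.2.2)] at hsum
  have hb : Bornology.IsBounded (exp '' {s : ℂ | X - n ≤ s.re ∧ s.re < X ∧ s ∈ S}) :=
    (Metric.isBounded_ball (x := (0 : ℂ)) (r := Real.exp X)).subset (by
      rintro _ ⟨s, hs, rfl⟩
      exact exp_mem_ball.2 hs.2.1)
  have hle := (zerosIn_mono hf h0 (A := exp '' S ∩ Metric.ball 0 r)
    ((Metric.isBounded_ball (x := (0 : ℂ)) (r := Real.exp (x₁ + 1))).union hb) (by
      rintro _ ⟨⟨s, hs, rfl⟩, hs'⟩ -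
      rw [hrX, exp_mem_ball] at hs'
      rcases lt_or_ge s.re (X - n) with hlt | hge
      · exact Or.inl (exp_mem_ball.2 (by linarith))
      · exact Or.inr ⟨s, ⟨hge, hs', hs⟩, rfl⟩)).trans
    (zerosIn_union_le hf h0 Metric.isBounded_ball hb)
  rw [zeroCount_eq_zerosIn]
  have hle' := (Nat.cast_le (α := ℝ)).2 hle
  push_cast at hle'
  have hrd : r ^ d = Real.exp (d * X) := by rw [hrX, ← Real.exp_nat_mul]
  rw [hrd]
  have hX0 : 0 ≤ X := by linarith
  have h1 : 1 ≤ Real.exp (d * X) := Real.one_le_exp (by positivity)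
  have hN0 : (0 : ℝ) ≤ N := Nat.cast_nonneg _
  have h2 : (N : ℝ) ≤ N * (Real.exp (d * X) + X) := by nlinarith
  have h3 : K * (Real.exp (d * X) + n) ≤ 2 * K * (Real.exp (d * X) + X) := by nlinarith
  rw [add_mul]
  linarith

/-- Passage from the logarithmic plane: zeros of `f` in a logarithmic strip. -/
lemma exists_zeroCount_logStrip {f : ℂ → ℂ} (hf : Differentiable ℂ f) (h0 : f ≠ 0) {p d q : ℕ}
    (hp1 : 1 ≤ p) {θ c D : ℝ} (hc : 0 < c) (hD : 0 ≤ D)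
    (hunit : ∃ K, 0 ≤ K ∧ ∀ᶠ l : ℝ in atTop, |(zerosIn (fun s => f (exp s))
      {s | l ≤ s.re ∧ s.re < l + 1 ∧ s ∈ rayStrip p θ c} : ℝ) -
      D * (Real.exp (q * (l + 1)) - Real.exp (q * l)) / (2 * Real.pi)| ≤
      K * (l * Real.exp (d * l))) :
    ∃ K', ∀ᶠ r : ℝ in atTop, |(zeroCount f (logStrip p θ c) r : ℝ) -
      D * r ^ q / (2 * Real.pi)| ≤ K' * (r ^ d * Real.log r ^ 2) := by
  obtain ⟨K, hK, hunit⟩ := hunit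
  obtain ⟨x₁, hx₁⟩ := eventually_atTop.1 (hunit.and ((eventually_ge_atTop 1).and
    (eventually_mul_exp_neg_le hp1 (show 0 < 1 / c by positivity))))
  have hx1 : 1 ≤ x₁ := (hx₁ x₁ le_rfl).2.1
  have hF : Differentiable ℂ fun s => f (exp s) := hf.comp differentiable_exp
  have hF0 := comp_exp_ne_zero hf h0
  set N := zerosIn f (Metric.ball 0 (Real.exp (x₁ + 1))) with hN
  set B : ℝ → ℝ := fun x => D * Real.exp (q * x) / (2 * Real.pi) with hB
  refine ⟨N + 2 * K + B (x₁ + 1), ?_⟩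
  filter_upwards [eventually_ge_atTop (Real.exp (x₁ + 1))] with r hr
  have hr0 : 0 < r := (Real.exp_pos _).trans_le hr
  set X := Real.log r with hX
  have hrX : r = Real.exp X := (Real.exp_log hr0).symm
  have hX1 : x₁ + 1 ≤ X := by rwa [hrX, Real.exp_le_exp] at hr
  set n := ⌊X - x₁⌋₊ with hn
  have hn1 : (n : ℝ) ≤ X - x₁ := Nat.floor_le (by linarith)
  have hn2 : X - x₁ < n + 1 := Nat.lt_floor_add_one _
  have hX0 : 0 ≤ X := by linarith
  -- Enlarging the factor l of the slab error to X lets the summation lemma run with the constant K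
  -- X. Together with n ≤ X slabs this makes a squared logarithm sufficient.
  have hsum := abs_zerosIn_sub_le hF hF0 (isBounded_rayStrip p θ hc.le) (d := d) (B := B)
    (K := K * X) (x₁ := x₁) (X := X) (by positivity) (fun l hl hlX => by
      have h1 := (hx₁ l hl).1
      have h2 : D * (Real.exp (q * (l + 1)) - Real.exp (q * l)) / (2 * Real.pi) =
          B (l + 1) - B l := by rw [hB]; ring
      rw [h2] at h1
      refine h1.trans ?_
      have hlX' : l ≤ X := by linarith
      calc K * (l * Real.exp (d * l)) ≤ K * (X * Real.exp (d * l)) := by gcongr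
        _ = _ := by ring) (n := n) (by linarith)
  rw [zerosIn_comp_exp f (injOn_exp_of_abs_im (θ := θ) fun s hs => by
    have h1 : |s.im - θ| < c * (s.re * Real.exp (-(p * s.re))) := hs.2.2
    have h2 := (hx₁ s.re (by linarith [hs.1])).2.2
    calc |s.im - θ| ≤ c * (s.re * Real.exp (-(p * s.re))) := h1.le
      _ ≤ c * (1 / c) := by gcongr
      _ = 1 := by field_simp)] at hsum
  have hb : Bornology.IsBounded (exp '' {s : ℂ | X - n ≤ s.re ∧ s.re < X ∧ s ∈ rayStrip p θ c}) :=
    (Metric.isBounded_ball (x := (0 : ℂ)) (r := Real.exp X)).subset (by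
      rintro _ ⟨s, hs, rfl⟩
      exact exp_mem_ball.2 hs.2.1)
  have hle := (zerosIn_mono hf h0 (A := logStrip p θ c ∩ Metric.ball 0 r)
    ((Metric.isBounded_ball (x := (0 : ℂ)) (r := Real.exp (x₁ + 1))).union hb) (by
      rw [logStrip_eq_image]
      rintro _ ⟨⟨s, hs, rfl⟩, hs'⟩ -
      rw [hrX, exp_mem_ball] at hs'
      rcases lt_or_ge s.re (X - n) with hlt | hge
      · exact Or.inl (exp_mem_ball.2 (by linarith))
      · exact Or.inr ⟨s, ⟨hge, hs', hs.2⟩, rfl⟩)).trans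
    (zerosIn_union_le hf h0 Metric.isBounded_ball hb)
  have hge := zerosIn_mono hf h0
    (A := exp '' {s : ℂ | X - n ≤ s.re ∧ s.re < X ∧ s ∈ rayStrip p θ c})
    (B := logStrip p θ c ∩ Metric.ball 0 r)
    (Metric.isBounded_ball.subset inter_subset_right) (by
      rw [logStrip_eq_image]
      rintro _ ⟨s, hs, rfl⟩ -
      rw [hrX]
      exact ⟨⟨s, ⟨by linarith [hs.1], hs.2.2⟩, rfl⟩, exp_mem_ball.2 hs.2.1⟩)
  rw [zeroCount_eq_zerosIn]
  have hle' := (Nat.cast_le (α := ℝ)).2 hle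
  have hge' := (Nat.cast_le (α := ℝ)).2 hge
  push_cast at hle'
  have hrd : r ^ d = Real.exp (d * X) := by rw [hrX, ← Real.exp_nat_mul]
  have hrq : D * r ^ q / (2 * Real.pi) = B X := by
    rw [hB, hrX, ← Real.exp_nat_mul]
  rw [hrd, hrq]
  have h1 : 1 ≤ Real.exp (d * X) := Real.one_le_exp (by positivity)
  have hB0 : ∀ x, 0 ≤ B x := fun x => by rw [hB]; positivity
  have hBmono : B (X - n) ≤ B (x₁ + 1) := by
    rw [hB]
    simp only
    gcongr
    linarith
  have hN0 : (0 : ℝ) ≤ N := Nat.cast_nonneg _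
  set E := Real.exp (d * X) with hE
  have hEX : 1 ≤ E * X ^ 2 := one_le_mul_of_one_le_of_one_le h1 (one_le_pow₀ (by linarith))
  have h2 : (N : ℝ) ≤ N * (E * X ^ 2) := le_mul_of_one_le_right hN0 hEX
  have h3 : K * X * (E + n) ≤ 2 * K * (E * X ^ 2) := by
    have h4 : E + n ≤ 2 * (E * X) := by nlinarith
    calc K * X * (E + n) ≤ K * X * (2 * (E * X)) := by gcongr
      _ = _ := by ring
  have h4 : B (X - n) ≤ B (x₁ + 1) * (E * X ^ 2) :=
    hBmono.trans (le_mul_of_one_le_right (hB0 _) hEX)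
  have h5 := hB0 (X - n)
  rw [add_mul, add_mul]
  rw [abs_le] at hsum ⊢
  constructor <;> linarith


/-! ### Zeros inside and outside the strips in the z-plane -/

/-- The function `∑_v H_v(z) e^{w_v z^q}` for an arbitrary finite index type. -/
def normalSum {ι : Type*} [Fintype ι] (q : ℕ) (w : ι → ℂ) (H : ι → ℂ → ℂ) : ℂ → ℂ :=
  fun z => ∑ v, H v z * exp (w v * z ^ q)

section

variable {ι : Type*} [Fintype ι] {p d q : ℕ} {w : ι → ℂ} {H : ι → ℂ → ℂ}

lemma normalSum_exp (q : ℕ) (w : ι → ℂ) (H : ι → ℂ → ℂ) :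
    (fun s => normalSum q w H (exp s)) = expSum q w fun v s => H v (exp s) := by
  funext s
  simp only [normalSum, expSum, ← exp_nat_mul]

lemma differentiable_normalSum (hH : ∀ v, IsExpPolyOfOrderLE d (H v)) :
    Differentiable ℂ (normalSum q w H) := by
  have := fun v => (hH v).differentiable
  unfold normalSum
  fun_prop

lemma exists_tame_family (hH : ∀ v, IsExpPolyOfOrderLE d (H v)) (hH0 : ∀ v, H v ≠ 0) :
    ∃ C x₀, 1 ≤ C ∧ ∀ v, Tame d (fun s => H v (exp s)) C x₀ := by
  choose C x₀ hC hx ht using fun v => (hH v).tame (hH0 v)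
  have hC' : ∀ v, 0 ≤ C v := fun v => by linarith [hC v]
  have hx' : ∀ v, 0 ≤ x₀ v := fun v => by linarith [hx v]
  refine ⟨1 + ∑ v, C v, ∑ v, x₀ v, ?_, fun v => (ht v).mono ?_ ?_ ?_⟩
  · linarith [Finset.sum_nonneg fun v (_ : v ∈ Finset.univ) => hC' v]
  · linarith [Finset.single_le_sum (fun v _ => hC' v) (Finset.mem_univ v)]
  · exact Finset.single_le_sum (fun v _ => hx' v) (Finset.mem_univ v)
  · exact Finset.sum_nonneg fun v _ => hx' v

variable [Nonempty ι]

lemma normalSum_ne_zero (hp1 : 1 ≤ p) (hq : q = p + d) (hw : Function.Injective w)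
    (hH : ∀ v, IsExpPolyOfOrderLE d (H v)) (hH0 : ∀ v, H v ≠ 0) : normalSum q w H ≠ 0 := by
  obtain ⟨C, x₀, hC, ht⟩ := exists_tame_family hH hH0
  intro h0
  refine expSum_ne_zero hp1 hq ht hC hw ?_
  rw [← normalSum_exp, h0]
  rfl

/-- Meant for the functions f - a: around a direction that is not critical for the enlarged set of
exponents there are too few a-points for a Borel direction. -/
lemma exists_zeroCount_sector_le (hp1 : 1 ≤ p) (hq : q = p + d) (hw : Function.Injective w)
    (hH : ∀ v, IsExpPolyOfOrderLE d (H v)) (hH0 : ∀ v, H v ≠ 0) {θ δ ε : ℝ} {j : ι} (hδ : 0 < δ)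
    (hε : 0 < ε) (hε1 : ε ≤ 1)
    (hdom : ∀ y, |y - θ| ≤ ε → ∀ v, v ≠ j → dirRe q (w v) y + δ ≤ dirRe q (w j) y) :
    ∃ K, ∀ᶠ r : ℝ in atTop, (zeroCount (normalSum q w H) (openAngle θ (ε / 2)) r : ℝ) ≤
      K * (r ^ d + Real.log r) := by
  obtain ⟨C, x₀, hC, ht⟩ := exists_tame_family hH hH0
  have hf := differentiable_normalSum (q := q) (w := w) hH
  have h0 := normalSum_ne_zero hp1 hq hw hH hH0
  have hsec := eventually_zerosIn_sector_le hp1 hq ht hC hδ hε hε1 hdom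
    (expSum_ne_zero hp1 hq ht hC hw)
  rw [← normalSum_exp] at hsec
  rw [openAngle_eq_image]
  refine exists_zeroCount_le hf h0 (K := 2 * C) (by positivity) (θ := θ) (fun s hs => by
    have : |s.im - θ| < ε / 2 := hs
    linarith) ?_
  filter_upwards [hsec] with l hl
  refine le_trans ?_ hl
  have := zerosIn_mono (hf.comp differentiable_exp) (comp_exp_ne_zero hf h0)
    (A := {s | l ≤ s.re ∧ s.re < l + 1 ∧ s ∈ {s : ℂ | |s.im - θ| < ε / 2}})
    (B := {s | l ≤ s.re ∧ s.re ≤ l + 1 ∧ |s.im - θ| ≤ ε / 2})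
    (isBounded_subset_re_im (a := l) (b := l + 1) (y₀ := θ - ε / 2) (y₁ := θ + ε / 2) fun s hs => by
      have := abs_le.1 hs.2.2
      exact ⟨⟨hs.1, hs.2.1⟩, by linarith, by linarith⟩)
    (fun s hs _ => ⟨hs.1, hs.2.1.le, le_of_lt hs.2.2⟩)
  exact_mod_cast this

lemma exists_int_add_mem_Ico (θ : ℝ) : ∃ n : ℤ, θ + 2 * Real.pi * n ∈ Ico 0 (2 * Real.pi) := by
  refine ⟨-toIcoDiv Real.two_pi_pos 0 θ, ?_⟩
  have := toIcoMod_mem_Ico Real.two_pi_pos 0 θ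
  rw [toIcoMod, zero_add] at this
  convert this using 1
  push_cast
  rw [zsmul_eq_mul]
  ring

/-- Zeros outside and inside the logarithmic strips. -/
theorem exists_zeroCount_bounds (hp1 : 1 ≤ p) (hq : q = p + d) (hw : Function.Injective w)
    (hH : ∀ v, IsExpPolyOfOrderLE d (H v)) (hH0 : ∀ v, H v ≠ 0) :
    ({θ : ℝ | IsCriticalAngle q (range w) θ} ∩ Ico 0 (2 * Real.pi)).Finite ∧
    ∃ c₀, 0 < c₀ ∧
      (∀ c, c₀ ≤ c → ∃ K, ∀ᶠ r : ℝ in atTop, (zeroCount (normalSum q w H)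
        (⋃ θ ∈ {θ : ℝ | IsCriticalAngle q (range w) θ}, logStrip p θ c)ᶜ r : ℝ) ≤
        K * (r ^ d + Real.log r)) ∧
      ∀ θ, IsCriticalAngle q (range w) θ → ∃ j k ε, j ≠ k ∧ DominantPair q w θ ε ε j k ∧
        (∀ v, v ≠ j → dirRe q (w v) θ = dirRe q (w j) θ →
          (w v * exp (q * θ * I)).im < (w j * exp (q * θ * I)).im) ∧
        (∀ v, v ≠ k → dirRe q (w v) θ = dirRe q (w k) θ →
          (w k * exp (q * θ * I)).im < (w v * exp (q * θ * I)).im) ∧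
        ∀ c, c₀ ≤ c → ∃ K, ∀ᶠ r : ℝ in atTop,
          |(zeroCount (normalSum q w H) (logStrip p θ c) r : ℝ) -
          ‖w j - w k‖ * r ^ q / (2 * Real.pi)| ≤ K * (r ^ d * Real.log r ^ 2) := by
  obtain ⟨C, x₀, hC, ht⟩ := exists_tame_family hH hH0
  have hf := differentiable_normalSum (q := q) (w := w) hH
  have h0 := normalSum_ne_zero hp1 hq hw hH hH0
  have hlocal := exists_local_count hp1 hq ht hC hw
  rw [← normalSum_exp] at hlocal
  choose ε c₁ hε hε1 hc₁ hisol hcount hstrip using hlocal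
  -- By compactness finitely many directions suffice for a period. A neighbourhood contains no
  -- critical angle except possibly its centre, so all critical angles of the period are among the
  -- centres; hence they are finitely many and one c₀ serves them all.
  obtain ⟨t, -, hcover⟩ := (isCompact_Icc (a := (0 : ℝ)) (b := 2 * Real.pi)).elim_nhds_subcover
    (fun y => Metric.ball y (ε y)) fun y _ => Metric.ball_mem_nhds y (hε y)
  have hmem : ∀ y ∈ Icc 0 (2 * Real.pi), ∃ y₀ ∈ t, |y - y₀| ≤ ε y₀ := by
    intro y hy
    obtain ⟨y₀, h1, h2⟩ := mem_iUnion₂.1 (hcover hy)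
    exact ⟨y₀, h1, (Real.dist_eq y y₀ ▸ Metric.mem_ball.1 h2).le⟩
  have hcritmem : ∀ y, IsCriticalAngle q (range w) y → y ∈ Ico 0 (2 * Real.pi) → y ∈ t := by
    intro y hy hy'
    obtain ⟨y₀, h1, h2⟩ := hmem y (Ico_subset_Icc_self hy')
    rwa [hisol y₀ y h2 hy]
  have hc₀ : ∀ y ∈ t, c₁ y ≤ 1 + ∑ y ∈ t, c₁ y := fun y hy => by
    linarith [Finset.single_le_sum (fun y _ => (hc₁ y).le) hy]
  have hc₀pos : 0 < 1 + ∑ y ∈ t, c₁ y := by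
    linarith [Finset.sum_nonneg fun y (_ : y ∈ t) => (hc₁ y).le]
  refine ⟨t.finite_toSet.subset fun y hy => hcritmem y hy.1 hy.2, 1 + ∑ y ∈ t, c₁ y, hc₀pos,
    fun c hc => ?_, fun θ hθ => ?_⟩
  · set S : ℝ → Set ℂ := fun y => {s : ℂ | |s.im - y| ≤ ε y ∧
      (IsCriticalAngle q (range w) y → s ∉ rayStrip p y (c₁ y))} with hS
    have hpiece : ∀ y, ∃ K, ∀ᶠ r : ℝ in atTop,
        (zeroCount (normalSum q w H) (exp '' S y) r : ℝ) ≤ K * (r ^ d + Real.log r) := fun y =>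
      exists_zeroCount_le hf h0 (K := 4 * C) (by positivity) (θ := y)
        (fun s hs => hs.1.trans (hε1 y)) (hcount y)
    choose K hK using hpiece
    set N := zerosIn (normalSum q w H) (Metric.ball 0 2)
    refine ⟨N + ∑ y ∈ t, K y, ?_⟩
    have hall : ∀ᶠ r : ℝ in atTop, ∀ y ∈ t,
        (zeroCount (normalSum q w H) (exp '' S y) r : ℝ) ≤ K y * (r ^ d + Real.log r) :=
      (eventually_all_finset t).2 fun y _ => hK y
    filter_upwards [hall, eventually_ge_atTop 1] with r hr hr1
    have hb : ∀ y ∈ t, Bornology.IsBounded (exp '' S y ∩ Metric.ball 0 r) := fun y _ =>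
      Metric.isBounded_ball.subset inter_subset_right
    have hbU : Bornology.IsBounded (⋃ y ∈ t, exp '' S y ∩ Metric.ball 0 r) :=
      Metric.isBounded_ball.subset (iUnion₂_subset fun y _ => inter_subset_right)
    have h1 := (zerosIn_mono hf h0
      (A := (⋃ θ ∈ {θ : ℝ | IsCriticalAngle q (range w) θ}, logStrip p θ c)ᶜ ∩ Metric.ball 0 r)
      ((Metric.isBounded_ball (x := (0 : ℂ)) (r := 2)).union hbU) (by
        rintro z ⟨hz, hzr⟩ -
        by_cases hz2 : ‖z‖ < 2
        · exact Or.inl (by simpa using hz2)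
        right
        push Not at hz2
        have hz0 : z ≠ 0 := by
          rintro rfl
          simp at hz2
          linarith
        obtain ⟨n, hn⟩ := exists_int_add_mem_Ico (log z).im
        set s := log z + (2 * Real.pi * n : ℝ) * I with hs
        have hsz : exp s = z := by rw [hs, exp_add_two_pi_int, exp_log hz0]
        have hsim : s.im = (log z).im + 2 * Real.pi * n := by simp [hs]
        have hsre : 0 < s.re := by
          have : Real.exp s.re = ‖z‖ := by rw [← norm_exp, hsz]
          rw [← Real.one_lt_exp_iff, this]
          linarith
        obtain ⟨y, hyt, hy⟩ := hmem s.im (by rw [hsim]; exact Ico_subset_Icc_self hn)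
        refine mem_iUnion₂.2 ⟨y, hyt, ⟨s, ⟨hy, fun hcr hsr => hz ?_⟩, hsz⟩, hzr⟩
        refine mem_iUnion₂.2 ⟨y, hcr, ?_⟩
        rw [logStrip_eq_image]
        refine ⟨s, ⟨hsre, ?_⟩, hsz⟩
        have h2 : |s.im - y| < c₁ y * (s.re * Real.exp (-(p * s.re))) := hsr
        have h3 : c₁ y ≤ c := (hc₀ y hyt).trans hc
        exact lt_of_lt_of_le h2 (by gcongr))).trans
      (zerosIn_union_le hf h0 Metric.isBounded_ball hbU)
    have h2 := zerosIn_biUnion_le hf h0 t _ hb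
    have h3 := (Nat.cast_le (α := ℝ)).2 (h1.trans (Nat.add_le_add_left h2 _))
    push_cast at h3
    rw [zeroCount_eq_zerosIn]
    refine h3.trans ?_
    have h4 : ∑ y ∈ t, (zerosIn (normalSum q w H) (exp '' S y ∩ Metric.ball 0 r) : ℝ) ≤
        ∑ y ∈ t, K y * (r ^ d + Real.log r) := Finset.sum_le_sum fun y hy => hr y hy
    rw [← Finset.sum_mul] at h4
    have h5 : 1 ≤ r ^ d + Real.log r := by
      linarith [one_le_pow₀ hr1 (n := d), Real.log_nonneg hr1]
    have h6 : (N : ℝ) ≤ N * (r ^ d + Real.log r) := le_mul_of_one_le_right (Nat.cast_nonneg _) h5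
    rw [add_mul]
    linarith
  · obtain ⟨n, hn⟩ := exists_int_add_mem_Ico θ
    have hθ' := hθ.add_two_pi n
    obtain ⟨j, k, ε', hjk, hpair, hlj, hlk, hcnt⟩ := hstrip _ hθ'
    have hpair' := hpair.add_two_pi (-n)
    have hback : θ + 2 * Real.pi * n + 2 * Real.pi * ((-n : ℤ) : ℝ) = θ := by push_cast; ring
    rw [hback] at hpair'
    simp only [dirRe_add_two_pi, exp_add_two_pi] at hlj hlk
    refine ⟨j, k, ε', hjk, hpair', hlj, hlk, fun c hc => ?_⟩
    have := exists_zeroCount_logStrip hf h0 hp1 (hc₀pos.trans_le hc) (norm_nonneg (w j - w k))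
      (hcnt c ((hc₀ _ (hcritmem _ hθ' hn)).trans hc))
    rwa [logStrip_add_two_pi] at this

end


/-! ### Sides of the polygon and critical angles -/

section

variable {ι : Type*} {q : ℕ} {w : ι → ℂ}

/-- Re(conj x · u) is the real inner product of x and u, so its maximum over the hull is the support
function in direction u. This is why the polygon is spanned by the conjugates of the leading
coefficients. -/
lemma re_conj_mul_le_of_mem_convexHull {G : Set ℂ} {u : ℂ} {M : ℝ}
    (hG : ∀ x ∈ G, ((starRingEnd ℂ) x * u).re ≤ M) {x : ℂ} (hx : x ∈ convexHull ℝ G) :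
    ((starRingEnd ℂ) x * u).re ≤ M := by
  have hconv : Convex ℝ {x : ℂ | ((starRingEnd ℂ) x * u).re ≤ M} := by
    intro x hx y hy a b ha hb hab
    simp only [mem_ofPred_eq] at hx hy ⊢
    have : ((starRingEnd ℂ) (a • x + b • y) * u).re =
        a * ((starRingEnd ℂ) x * u).re + b * ((starRingEnd ℂ) y * u).re := by
      simp
      ring
    rw [this]
    calc _ ≤ a * M + b * M := by gcongr
      _ = M := by rw [← add_mul, hab, one_mul]
  exact convexHull_min hG hconv hx

/-- An open half plane together with one point of its boundary line is convex, so strictness away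
from `a` passes from `G` to its hull. -/
lemma eq_or_re_conj_mul_lt_of_mem_convexHull {G : Set ℂ} {u a : ℂ}
    (hG : ∀ x ∈ G, x = a ∨ ((starRingEnd ℂ) x * u).re < ((starRingEnd ℂ) a * u).re) {x : ℂ}
    (hx : x ∈ convexHull ℝ G) :
    x = a ∨ ((starRingEnd ℂ) x * u).re < ((starRingEnd ℂ) a * u).re := by
  have hconv : Convex ℝ {x : ℂ | x = a ∨
      ((starRingEnd ℂ) x * u).re < ((starRingEnd ℂ) a * u).re} := by
    intro x hx y hy s t hs ht hst
    have hlin : ((starRingEnd ℂ) (s • x + t • y) * u).re =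
        s * ((starRingEnd ℂ) x * u).re + t * ((starRingEnd ℂ) y * u).re := by
      simp
      ring
    simp only [mem_ofPred_eq] at hx hy ⊢
    rw [hlin]
    set A := ((starRingEnd ℂ) a * u).re
    rcases hs.eq_or_lt with rfl | hs
    · rw [zero_add] at hst
      subst hst
      simpa using hy
    rcases ht.eq_or_lt with rfl | ht
    · rw [add_zero] at hst
      subst hst
      simpa using hx
    have hA : A = s * A + t * A := by rw [← add_mul, hst, one_mul]
    rcases hx with rfl | hx
    · rcases hy with rfl | hy
      · left
        rw [← add_smul, hst, one_smul]
      · right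
        rw [hA]
        nlinarith
    · right
      have hy' : ((starRingEnd ℂ) y * u).re ≤ A := by
        rcases hy with rfl | hy
        · exact le_rfl
        · exact hy.le
      rw [hA]
      nlinarith
  exact convexHull_min hG hconv hx

/-- A unique maximiser of a linear functional is an exposed point, hence extreme. -/
lemma mem_extremePoints_of_unique_max {G : Set ℂ} {u a : ℂ} (ha : a ∈ G)
    (hG : ∀ x ∈ G, x ≠ a → ((starRingEnd ℂ) x * u).re < ((starRingEnd ℂ) a * u).re) :
    a ∈ extremePoints ℝ (convexHull ℝ G) := by
  have hall : ∀ x ∈ convexHull ℝ G, x = a ∨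
      ((starRingEnd ℂ) x * u).re < ((starRingEnd ℂ) a * u).re := fun x hx =>
    eq_or_re_conj_mul_lt_of_mem_convexHull (fun x hx => by
      by_cases h : x = a
      · exact Or.inl h
      · exact Or.inr (hG x hx h)) hx
  rw [mem_extremePoints]
  have key : ∀ x₁ ∈ convexHull ℝ G, ∀ x₂ ∈ convexHull ℝ G, a ∈ openSegment ℝ x₁ x₂ → x₁ = a := by
    rintro x₁ h1 x₂ h2 ⟨s, t, hs, ht, hst, rfl⟩
    have hlin : ((starRingEnd ℂ) (s • x₁ + t • x₂) * u).re =
        s * ((starRingEnd ℂ) x₁ * u).re + t * ((starRingEnd ℂ) x₂ * u).re := by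
      simp
      ring
    rcases hall x₁ h1 with h | h
    · exact h
    · exfalso
      have h' : ((starRingEnd ℂ) x₂ * u).re ≤ ((starRingEnd ℂ) (s • x₁ + t • x₂) * u).re := by
        rcases hall x₂ h2 with h3 | h3
        · rw [← h3]
        · exact h3.le
      set A := ((starRingEnd ℂ) (s • x₁ + t • x₂) * u).re
      have hA : A = s * A + t * A := by rw [← add_mul, hst, one_mul]
      nlinarith
  refine ⟨subset_convexHull ℝ G ha, fun x₁ h1 x₂ h2 hseg => ⟨key x₁ h1 x₂ h2 hseg, ?_⟩⟩
  exact key x₂ h2 x₁ h1 (openSegment_symm ℝ x₁ x₂ ▸ hseg)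

lemma mem_openSegment_of_im_lt {u z₁ z₂ z₃ : ℂ} (hu : u ≠ 0) (h12 : (z₁ * u).re = (z₂ * u).re)
    (h23 : (z₂ * u).re = (z₃ * u).re) (hl : (z₁ * u).im < (z₂ * u).im)
    (hr : (z₂ * u).im < (z₃ * u).im) :
    (starRingEnd ℂ) z₂ ∈ openSegment ℝ ((starRingEnd ℂ) z₁) ((starRingEnd ℂ) z₃) := by
  set A := (z₁ * u).im with hA
  set B := (z₂ * u).im with hB
  set D := (z₃ * u).im with hD
  have hAD : 0 < D - A := by linarith
  refine ⟨(D - B) / (D - A), (B - A) / (D - A), div_pos (by linarith) hAD,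
    div_pos (by linarith) hAD, by field_simp; ring, ?_⟩
  have hz : ((D - B) / (D - A) : ℝ) * z₁ + ((B - A) / (D - A) : ℝ) * z₃ = z₂ := by
    refine mul_right_cancel₀ hu ?_
    rw [add_mul, mul_assoc, mul_assoc]
    apply Complex.ext
    · rw [add_re, re_ofReal_mul, re_ofReal_mul, h12, ← h23]
      field_simp
      ring
    · rw [add_im, im_ofReal_mul, im_ofReal_mul, ← hA, ← hB, ← hD]
      field_simp
      ring
  rw [← hz]
  simp

lemma exp_mul_I_mul_conj (x : ℝ) : exp (x * I) * (starRingEnd ℂ) (exp (x * I)) = 1 := by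
  rw [mul_conj, normSq_eq_norm_sq, norm_exp_ofReal_mul_I]
  simp

lemma natCast_mul_ofReal_mul_I (q : ℕ) (θ : ℝ) : (q : ℂ) * θ * I = ((q * θ : ℝ) : ℂ) * I := by
  push_cast
  rfl

/-- The support function at the outer normal of a side. -/
lemma re_conj_mul_le_of_isSide {G : Set ℂ} {a b : ℂ} (hs : IsSide G a b) {u : ℂ}
    (hu : b - a = (‖b - a‖ : ℂ) * (I * u)) {x : ℂ} (hx : x ∈ convexHull ℝ G) :
    ((starRingEnd ℂ) x * u).re ≤ ((starRingEnd ℂ) a * u).re := by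
  have h1 := hs.2.2.2 x hx
  have hpos : 0 < ‖b - a‖ := norm_pos_iff.2 (sub_ne_zero.2 hs.1.symm)
  rw [hu] at h1
  have h2 : ((starRingEnd ℂ) ((‖b - a‖ : ℂ) * (I * u)) * (x - a)).im =
      ‖b - a‖ * (((starRingEnd ℂ) a * u).re - ((starRingEnd ℂ) x * u).re) := by
    simp
    ring
  rw [h2] at h1
  have := nonneg_of_mul_nonneg_right h1 hpos
  linarith

lemma re_conj_mul_eq_of_outerNormal {a b u : ℂ} (hu : b - a = (‖b - a‖ : ℂ) * (I * u)) :
    ((starRingEnd ℂ) b * u).re = ((starRingEnd ℂ) a * u).re := by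
  have h : b = a + (‖b - a‖ : ℂ) * (I * u) := by rw [← hu]; ring
  set M := ‖b - a‖
  rw [h]
  simp
  ring

lemma im_conj_mul_lt_of_outerNormal {a b u : ℂ} (hab : a ≠ b) (hu0 : u ≠ 0)
    (hu : b - a = (‖b - a‖ : ℂ) * (I * u)) :
    ((starRingEnd ℂ) b * u).im < ((starRingEnd ℂ) a * u).im := by
  have hpos : 0 < ‖b - a‖ := norm_pos_iff.2 (sub_ne_zero.2 hab.symm)
  have h : b = a + (‖b - a‖ : ℂ) * (I * u) := by rw [← hu]; ring
  set M := ‖b - a‖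
  have h1 : 0 < u.re * u.re + u.im * u.im := by
    have := normSq_pos.2 hu0
    rwa [normSq_apply] at this
  have h2 : ((starRingEnd ℂ) b * u).im =
      ((starRingEnd ℂ) a * u).im - M * (u.re * u.re + u.im * u.im) := by
    rw [h]
    simp
    ring
  rw [h2]
  nlinarith

/-- Both end points of a side maximise the inner product with its outer normal. Another maximiser
lies on the same line; beyond an end point it would put that vertex inside a segment of the hull,
against extremality. So the maximisers of extreme imaginary part, which are the dominating indices,
are the end points of the side. -/
lemma isCriticalAngle_of_isSide {j k : ι} {θ : ℝ}
    (hs : IsSide (range fun j => (starRingEnd ℂ) (w j)) ((starRingEnd ℂ) (w j))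
      ((starRingEnd ℂ) (w k)))
    (hn : IsOuterNormalArg ((starRingEnd ℂ) (w j)) ((starRingEnd ℂ) (w k)) (q * θ)) :
    IsCriticalAngle q (range w) θ ∧
      ∀ j' k', (∀ v, v ≠ j' → dirRe q (w v) θ = dirRe q (w j') θ →
          (w v * exp (q * θ * I)).im < (w j' * exp (q * θ * I)).im) →
        (∀ v, v ≠ k' → dirRe q (w v) θ = dirRe q (w k') θ →
          (w k' * exp (q * θ * I)).im < (w v * exp (q * θ * I)).im) →
        (∀ v, dirRe q (w v) θ ≤ dirRe q (w j') θ) → (∀ v, dirRe q (w v) θ ≤ dirRe q (w k') θ) →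
        j' = j ∧ k' = k := by
  unfold IsOuterNormalArg at hn
  rw [← natCast_mul_ofReal_mul_I] at hn
  set u := exp (q * θ * I) with hu
  have hu0 : u ≠ 0 := exp_ne_zero _
  have hmax : ∀ v, dirRe q (w v) θ ≤ dirRe q (w j) θ := by
    intro v
    have := re_conj_mul_le_of_isSide hs hn (subset_convexHull ℝ _ ⟨v, rfl⟩)
    simp only [conj_conj] at this
    exact this
  have heq : dirRe q (w k) θ = dirRe q (w j) θ := by
    have := re_conj_mul_eq_of_outerNormal hn
    simp only [conj_conj] at this
    exact this
  have him : (w k * u).im < (w j * u).im := by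
    have := im_conj_mul_lt_of_outerNormal hs.1 hu0 hn
    simp only [conj_conj] at this
    exact this
  have hjk : w j ≠ w k := fun h => hs.1 (by rw [h])
  refine ⟨⟨w j, ⟨j, rfl⟩, w k, ⟨k, rfl⟩, hjk, heq.symm, ?_⟩, ?_⟩
  · rintro _ ⟨v, rfl⟩
    exact hmax v
  intro j' k' hj' hk' hmj hmk
  have ej : dirRe q (w j') θ = dirRe q (w j) θ := le_antisymm (hmax j') (hmj j)
  have ek : dirRe q (w k') θ = dirRe q (w j) θ := le_antisymm (hmax k') (hmk j)
  constructor
  · by_contra hne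
    have h1 := hj' j (Ne.symm hne) ej.symm
    have hseg := mem_openSegment_of_im_lt hu0 (z₁ := w k) (z₂ := w j) (z₃ := w j')
      heq ej.symm him h1
    have := (mem_extremePoints.1 hs.2.1).2 _ (subset_convexHull ℝ _ ⟨k, rfl⟩) _
      (subset_convexHull ℝ _ ⟨j', rfl⟩) hseg
    exact hs.1 this.1.symm
  · by_contra hne
    have h1 := hk' k (Ne.symm hne) (heq.trans ek.symm)
    have hseg := mem_openSegment_of_im_lt hu0 (z₁ := w k') (z₂ := w k) (z₃ := w j)
      (ek.trans heq.symm) heq h1 him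
    have := (mem_extremePoints.1 hs.2.2.1).2 _ (subset_convexHull ℝ _ ⟨k', rfl⟩) _
      (subset_convexHull ℝ _ ⟨j, rfl⟩) hseg
    exact hs.1 this.2

lemma DominantPair.isOuterNormalArg {j k : ι} {θ κ ε : ℝ} (hp : DominantPair q w θ κ ε j k) :
    IsOuterNormalArg ((starRingEnd ℂ) (w j)) ((starRingEnd ℂ) (w k)) (q * θ) := by
  unfold IsOuterNormalArg
  have h := hp.diff
  rw [natCast_mul_ofReal_mul_I] at h
  have h1 := exp_mul_I_mul_conj (q * θ)
  have h2 : w k - w j = -I * (‖w k - w j‖ : ℂ) * (starRingEnd ℂ) (exp ((q * θ : ℝ) * I)) := by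
    rw [← h, mul_assoc, h1, mul_one]
  rw [← map_sub, norm_conj]
  conv_lhs => rw [h2]
  simp
  ring

/-- Turning the direction slightly to θ - ε or θ + ε makes `w j` or `w k` the only maximiser, so
both give vertices; at θ itself they support the hull together. -/
lemma DominantPair.isSide {j k : ι} {θ κ ε : ℝ} (hp : DominantPair q w θ κ ε j k)
    (hw : Function.Injective w) (hjk : j ≠ k) :
    IsSide (range fun j => (starRingEnd ℂ) (w j)) ((starRingEnd ℂ) (w j))
      ((starRingEnd ℂ) (w k)) := by
  have hκε : 0 < κ * ε := mul_pos hp.kappa_pos hp.eps_pos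
  refine ⟨fun h => hjk (hw ((starRingEnd ℂ).injective h)), ?_, ?_, ?_⟩
  · refine mem_extremePoints_of_unique_max (u := exp (q * (θ - ε : ℝ) * I)) ⟨j, rfl⟩ ?_
    rintro _ ⟨v, rfl⟩ hv
    have hv' : v ≠ j := fun h => hv (by rw [h])
    have := hp.below ε hp.eps_pos.le le_rfl v hv'
    simp only [conj_conj]
    unfold dirRe at this
    linarith
  · refine mem_extremePoints_of_unique_max (u := exp (q * (θ + ε : ℝ) * I)) ⟨k, rfl⟩ ?_
    rintro _ ⟨v, rfl⟩ hv
    have hv' : v ≠ k := fun h => hv (by rw [h])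
    have := hp.above ε hp.eps_pos.le le_rfl v hv'
    simp only [conj_conj]
    unfold dirRe at this
    linarith
  · intro x hx
    have hle := re_conj_mul_le_of_mem_convexHull (u := exp (q * θ * I))
      (M := ((starRingEnd ℂ) ((starRingEnd ℂ) (w j)) * exp (q * θ * I)).re) (by
        rintro _ ⟨v, rfl⟩
        simpa [dirRe] using hp.max_left v) hx
    have hn := hp.isOuterNormalArg
    unfold IsOuterNormalArg at hn
    rw [← natCast_mul_ofReal_mul_I] at hn
    rw [hn]
    set a := (starRingEnd ℂ) (w j)
    set u := exp (q * θ * I)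
    set M := ‖(starRingEnd ℂ) (w k) - a‖ with hM
    have h2 : ((starRingEnd ℂ) ((M : ℂ) * (I * u)) * (x - a)).im =
        M * (((starRingEnd ℂ) a * u).re - ((starRingEnd ℂ) x * u).re) := by
      simp
      ring
    rw [h2]
    exact mul_nonneg (norm_nonneg _) (by linarith)

/-- The solutions of `e^{iqθ} = e^{iφ}` in a period. -/
lemma card_filter_exp_eq (hq : 1 ≤ q) (φ : ℝ) (T : Finset ℝ)
    (hT : ∀ θ, θ ∈ T ↔ θ ∈ Ico 0 (2 * Real.pi) ∧ exp ((q * θ : ℝ) * I) = exp (φ * I)) :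
    T.card = q := by
  obtain ⟨n₀, hφ⟩ := exists_int_add_mem_Ico φ
  set ψ := φ + 2 * Real.pi * n₀ with hψ
  have hψφ : exp (ψ * I) = exp (φ * I) :=
    exp_eq_exp_iff_exists_int.2 ⟨n₀, by rw [hψ]; push_cast; ring⟩
  have hq0 : (0 : ℝ) < q := by exact_mod_cast hq
  have hpi := Real.pi_pos
  have himg : T = (Finset.range q).image fun n : ℕ => (ψ + 2 * Real.pi * n) / q := by
    ext θ
    rw [hT, Finset.mem_image, ← hψφ]
    constructor
    · rintro ⟨hθ, he⟩
      obtain ⟨n, hn⟩ := exp_eq_exp_iff_exists_int.1 he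
      have hn' : q * θ = ψ + 2 * Real.pi * n := by
        have h1 : ((q * θ : ℝ) : ℂ) = ((ψ + 2 * Real.pi * n : ℝ) : ℂ) := by
          refine mul_right_cancel₀ I_ne_zero ?_
          rw [hn]
          push_cast
          ring
        exact_mod_cast h1
      have h1 : 0 ≤ q * θ := mul_nonneg hq0.le hθ.1
      have h2 : q * θ < q * (2 * Real.pi) := by gcongr; exact hθ.2
      have h3 : (-1 : ℝ) < n := by
        by_contra hcon
        push Not at hcon
        nlinarith [hφ.2]
      have h4 : (n : ℝ) < q := by
        by_contra hcon
        push Not at hcon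
        nlinarith [hφ.1]
      have h3' : 0 ≤ n := by
        have : (-1 : ℤ) < n := by exact_mod_cast h3
        omega
      lift n to ℕ using h3'
      refine ⟨n, Finset.mem_range.2 (by exact_mod_cast h4), ?_⟩
      rw [div_eq_iff hq0.ne']
      push_cast at hn'
      linarith
    · rintro ⟨n, hn, rfl⟩
      have hn' : (n : ℝ) + 1 ≤ q := by exact_mod_cast Finset.mem_range.1 hn
      refine ⟨⟨div_nonneg (by have := hφ.1; positivity) hq0.le, ?_⟩, ?_⟩
      · rw [div_lt_iff₀ hq0]
        nlinarith [hφ.2]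
      · rw [mul_div_cancel₀ _ hq0.ne']
        exact exp_eq_exp_iff_exists_int.2 ⟨n, by push_cast; ring⟩
  rw [himg, Finset.card_image_of_injective, Finset.card_range]
  intro a b hab
  simp only at hab
  rw [div_left_inj' hq0.ne'] at hab
  have : (a : ℝ) = b := by
    have := add_left_cancel hab
    exact mul_left_cancel₀ (by positivity) this
  exact_mod_cast this

lemma exists_isOuterNormalArg {a b : ℂ} (hab : a ≠ b) : ∃ φ : ℝ, IsOuterNormalArg a b φ := by
  have h0 : (‖b - a‖ : ℂ) ≠ 0 := by
    rw [ofReal_ne_zero, norm_ne_zero_iff]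
    exact sub_ne_zero.2 hab.symm
  set z := (b - a) / (‖b - a‖ * I) with hz
  have hz1 : ‖z‖ = 1 := by
    rw [hz, norm_div, norm_mul, norm_I, mul_one, norm_real, norm_norm]
    exact div_self (by simpa using h0)
  refine ⟨arg z, ?_⟩
  have : exp (arg z * I) = z := by
    have := norm_mul_exp_arg_mul_I z
    rwa [hz1, ofReal_one, one_mul] at this
  rw [IsOuterNormalArg, this, hz]
  field_simp

/-- The sum of the lengths attached to the critical directions in a period. -/
lemma sum_critical_eq_circumference [Fintype ι] [Nonempty ι] (hq : 1 ≤ q)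
    (hw : Function.Injective w) (T : Finset ℝ)
    (hT : ∀ θ, θ ∈ T ↔ IsCriticalAngle q (range w) θ ∧ θ ∈ Ico 0 (2 * Real.pi))
    (j k : ℝ → ι) (ε : ℝ → ℝ)
    (hjk : ∀ θ ∈ T, j θ ≠ k θ ∧ DominantPair q w θ (ε θ) (ε θ) (j θ) (k θ) ∧
        (∀ v, v ≠ j θ → dirRe q (w v) θ = dirRe q (w (j θ)) θ →
          (w v * exp (q * θ * I)).im < (w (j θ) * exp (q * θ * I)).im) ∧
        (∀ v, v ≠ k θ → dirRe q (w v) θ = dirRe q (w (k θ)) θ →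
          (w (k θ) * exp (q * θ * I)).im < (w v * exp (q * θ * I)).im)) :
    ∑ θ ∈ T, ‖w (j θ) - w (k θ)‖ =
      q * circumference (range fun j => (starRingEnd ℂ) (w j)) := by
  classical
  set G := range fun j => (starRingEnd ℂ) (w j) with hG
  set e : ℝ → ℂ × ℂ := fun θ => ((starRingEnd ℂ) (w (j θ)), (starRingEnd ℂ) (w (k θ))) with he
  have hmatch : ∀ a b φ θ, IsSide G a b → IsOuterNormalArg a b φ →
      exp ((q * θ : ℝ) * I) = exp (φ * I) → θ ∈ Ico 0 (2 * Real.pi) → θ ∈ T ∧ e θ = (a, b) := by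
    intro a b φ θ hs hn hexp hθ
    obtain ⟨j', rfl⟩ := extremePoints_convexHull_subset hs.2.1
    obtain ⟨k', rfl⟩ := extremePoints_convexHull_subset hs.2.2.1
    have hn' : IsOuterNormalArg ((starRingEnd ℂ) (w j')) ((starRingEnd ℂ) (w k')) (q * θ) := by
      unfold IsOuterNormalArg at hn ⊢
      rw [hexp]
      exact hn
    obtain ⟨hc, huniq⟩ := isCriticalAngle_of_isSide hs hn'
    have hθT := (hT θ).2 ⟨hc, hθ⟩
    obtain ⟨-, hp, hj, hk⟩ := hjk θ hθT
    obtain ⟨h1, h2⟩ := huniq _ _ hj hk hp.max_left hp.max_right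
    exact ⟨hθT, by simp only [he, h1, h2]⟩
  have hq0 : (0 : ℝ) < q := by exact_mod_cast hq
  have hsides : {e : ℂ × ℂ | IsSide G e.1 e.2} = ↑(T.image e) := by
    ext ⟨a, b⟩
    rw [Finset.coe_image]
    constructor
    · intro hs
      obtain ⟨φ, hφ⟩ := exists_isOuterNormalArg hs.1
      obtain ⟨n, hn⟩ := exists_int_add_mem_Ico (φ / q)
      obtain ⟨h1, h2⟩ := hmatch a b φ _ hs hφ (exp_eq_exp_iff_exists_int.2 ⟨q * n, by
        push_cast
        have : (q : ℂ) ≠ 0 := by exact_mod_cast hq0.ne'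
        field_simp⟩) hn
      exact ⟨_, h1, h2⟩
    · rintro ⟨θ, hθ, heq⟩
      obtain ⟨hne, hp, -, -⟩ := hjk θ hθ
      have := hp.isSide hw hne
      rw [he, Prod.mk.injEq] at heq
      show IsSide G a b
      rwa [← heq.1, ← heq.2]
  unfold circumference
  -- Group the critical angles by side. Those over a given side are the solutions of e^{iqθ} = outer
  -- normal, and a period contains q of them.
  rw [hsides, finsum_mem_coe_finset, Finset.mul_sum,
    ← Finset.sum_fiberwise_of_maps_to (g := e) (t := T.image e)
      (fun θ hθ => Finset.mem_image_of_mem e hθ)]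
  refine Finset.sum_congr rfl fun ab hab => ?_
  obtain ⟨θ₀, hθ₀, rfl⟩ := Finset.mem_image.1 hab
  obtain ⟨hne, hp, -, -⟩ := hjk θ₀ hθ₀
  have hside := hp.isSide hw hne
  have hnorm := hp.isOuterNormalArg
  have hcard : (T.filter fun θ => e θ = e θ₀).card = q := by
    refine card_filter_exp_eq hq (q * θ₀) _ fun θ => ?_
    rw [Finset.mem_filter]
    constructor
    · rintro ⟨h1, h2⟩
      refine ⟨((hT θ).1 h1).2, ?_⟩
      have hn1 := (hjk θ h1).2.1.isOuterNormalArg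
      rw [he, Prod.mk.injEq] at h2
      rw [h2.1, h2.2] at hn1
      unfold IsOuterNormalArg at hn1 hnorm
      have h3 := hn1.symm.trans hnorm
      have h4 : (‖(starRingEnd ℂ) (w (k θ₀)) - (starRingEnd ℂ) (w (j θ₀))‖ : ℂ) ≠ 0 := by
        rw [ofReal_ne_zero, norm_ne_zero_iff]
        exact sub_ne_zero.2 hside.1.symm
      exact mul_left_cancel₀ I_ne_zero (mul_left_cancel₀ h4 h3)
    · rintro ⟨h1, h2⟩
      exact hmatch _ _ _ θ hside hnorm h2 h1
  rw [Finset.sum_congr rfl (g := fun _ => ‖(e θ₀).2 - (e θ₀).1‖), Finset.sum_const, hcard,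
    nsmul_eq_mul]
  intro θ hθ
  rw [← (Finset.mem_filter.1 hθ).2]
  simp only [he]
  rw [← map_sub, norm_conj, norm_sub_rev]

end


/-! ### The total number of zeros -/

lemma eventually_mem_of_mem_logStrip {p : ℕ} (hp1 : 1 ≤ p) {c δ : ℝ} (hc : 0 < c) (hδ : 0 < δ) :
    ∃ R, ∀ θ, ∀ z ∈ logStrip p θ c, R ≤ ‖z‖ → ∃ s, exp s = z ∧ |s.im - θ| < δ := by
  obtain ⟨x₁, hx₁⟩ := eventually_atTop.1
    (eventually_mul_exp_neg_le hp1 (show 0 < δ / c by positivity))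
  refine ⟨Real.exp x₁, fun θ z hz hR => ?_⟩
  rw [logStrip_eq_image] at hz
  obtain ⟨s, ⟨hs0, hs⟩, rfl⟩ := hz
  rw [norm_exp, Real.exp_le_exp] at hR
  refine ⟨s, rfl, ?_⟩
  have h1 : |s.im - θ| < c * (s.re * Real.exp (-(p * s.re))) := hs
  refine h1.trans_le ?_
  calc c * (s.re * Real.exp (-(p * s.re))) ≤ c * (δ / c) := by
        have := hx₁ s.re hR
        gcongr
    _ = δ := by field_simp

/-- Strips around different rays are disjoint far from the origin. -/
lemma exists_logStrip_inter_subset {p : ℕ} (hp1 : 1 ≤ p) {c : ℝ} (hc : 0 < c) {θ θ' : ℝ}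
    (h : exp (θ * I) ≠ exp (θ' * I)) :
    ∃ R, ∀ z ∈ logStrip p θ c, z ∈ logStrip p θ' c → ‖z‖ < R := by
  -- Far out both strips have half-opening below δ/2, so a common point would bring two directions
  -- at chordal distance δ closer than δ.
  set δ := ‖exp (θ * I) - exp (θ' * I)‖ with hδ
  have hδ0 : 0 < δ := norm_pos_iff.2 (sub_ne_zero.2 h)
  obtain ⟨R, hR⟩ := eventually_mem_of_mem_logStrip hp1 hc (half_pos hδ0)
  refine ⟨R, fun z hz hz' => ?_⟩
  by_contra hcon
  push Not at hcon
  obtain ⟨s, hs, hsθ⟩ := hR θ z hz hcon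
  obtain ⟨s', hs', hsθ'⟩ := hR θ' z hz' hcon
  have hlip : ∀ x y : ℝ, ‖exp (x * I) - exp (y * I)‖ ≤ |x - y| := by
    intro x y
    have h1 : exp (x * I) - exp (y * I) = exp (y * I) * (exp (I * (x - y : ℝ)) - 1) := by
      rw [mul_sub, ← exp_add, mul_one]
      congr 2
      push_cast
      ring
    rw [h1, norm_mul, norm_exp_ofReal_mul_I, one_mul]
    exact Real.norm_exp_I_mul_ofReal_sub_one_le
  obtain ⟨n, hn⟩ := exp_eq_exp_iff_exists_int.1 (hs.trans hs'.symm)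
  have him : s.im = s'.im + 2 * Real.pi * n := by
    have := congrArg im hn
    simp at this
    linarith
  have heq : exp (s.im * I) = exp (s'.im * I) :=
    exp_eq_exp_iff_exists_int.2 ⟨n, by rw [him]; push_cast; ring⟩
  have h1 := hlip s.im θ
  have h2 := hlip s'.im θ'
  have h3 : δ ≤ ‖exp (s.im * I) - exp (θ * I)‖ + ‖exp (s'.im * I) - exp (θ' * I)‖ := by
    have : exp (θ * I) - exp (θ' * I) =
      (exp (s'.im * I) - exp (θ' * I)) - (exp (s.im * I) - exp (θ * I)) := by rw [heq]; ring
    rw [hδ, this]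
    linarith [norm_sub_le (exp (s'.im * I) - exp (θ' * I)) (exp (s.im * I) - exp (θ * I))]
  linarith

lemma exp_mul_I_injOn : InjOn (fun θ : ℝ => exp (θ * I)) (Ico 0 (2 * Real.pi)) := by
  intro x hx y hy hxy
  obtain ⟨n, hn⟩ := exp_eq_exp_iff_exists_int.1 hxy
  have hn' : x = y + 2 * Real.pi * n := by
    have h1 : (x : ℂ) = ((y + 2 * Real.pi * n : ℝ) : ℂ) := by
      refine mul_right_cancel₀ I_ne_zero ?_
      rw [hn]
      push_cast
      ring
    exact_mod_cast h1
  have hpi := Real.pi_pos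
  have h3 : (n : ℝ) < 1 := by
    by_contra hcon
    push Not at hcon
    nlinarith [hx.2, hy.1]
  have h4 : -1 < (n : ℝ) := by
    by_contra hcon
    push Not at hcon
    nlinarith [hx.1, hy.2]
  have h3' : n < 1 := by exact_mod_cast h3
  have h4' : -1 < n := by exact_mod_cast h4
  have : n = 0 := by omega
  rw [hn', this]
  simp

section

variable {ι : Type*} [Fintype ι] [Nonempty ι] {p d q : ℕ} {w : ι → ℂ} {H : ι → ℂ → ℂ}

/-- The number of all zeros. -/
theorem exists_zeroCount_univ (hp1 : 1 ≤ p) (hq : q = p + d) (hw : Function.Injective w)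
    (hH : ∀ v, IsExpPolyOfOrderLE d (H v)) (hH0 : ∀ v, H v ≠ 0) :
    ∃ K, ∀ᶠ r : ℝ in atTop, |(zeroCount (normalSum q w H) univ r : ℝ) -
      q * circumference (range fun j => (starRingEnd ℂ) (w j)) * r ^ q / (2 * Real.pi)| ≤
      K * (r ^ d * Real.log r ^ 2) := by
  classical
  obtain ⟨hfin, c, hc, hout, hin⟩ := exists_zeroCount_bounds hp1 hq hw hH hH0
  have hf := differentiable_normalSum (q := q) (w := w) hH
  have h0 := normalSum_ne_zero hp1 hq hw hH hH0
  set f := normalSum q w H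
  obtain ⟨Ko, hKo⟩ := hout c le_rfl
  set T := hfin.toFinset with hTdef
  have hT : ∀ θ, θ ∈ T ↔ IsCriticalAngle q (range w) θ ∧ θ ∈ Ico 0 (2 * Real.pi) := fun θ => by
    rw [hTdef, Finite.mem_toFinset]
    exact Iff.rfl
  have hin' : ∀ θ, ∃ (j k : ι) (ε K : ℝ), θ ∈ T →
      (j ≠ k ∧ DominantPair q w θ ε ε j k ∧
        (∀ v, v ≠ j → dirRe q (w v) θ = dirRe q (w j) θ →
          (w v * exp (q * θ * I)).im < (w j * exp (q * θ * I)).im) ∧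
        (∀ v, v ≠ k → dirRe q (w v) θ = dirRe q (w k) θ →
          (w k * exp (q * θ * I)).im < (w v * exp (q * θ * I)).im)) ∧
      ∀ᶠ r : ℝ in atTop, |(zeroCount f (logStrip p θ c) r : ℝ) -
          ‖w j - w k‖ * r ^ q / (2 * Real.pi)| ≤ K * (r ^ d * Real.log r ^ 2) := by
    intro θ
    by_cases hθ : θ ∈ T
    · obtain ⟨j, k, ε, h1, h2, h3, h4, h5⟩ := hin θ ((hT θ).1 hθ).1
      obtain ⟨K, hK⟩ := h5 c le_rfl
      exact ⟨j, k, ε, K, fun _ => ⟨⟨h1, h2, h3, h4⟩, hK⟩⟩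
    · exact ⟨Classical.arbitrary ι, Classical.arbitrary ι, 0, 0, fun h => absurd h hθ⟩
  choose j k ε K hjk using hin'
  have hsum := sum_critical_eq_circumference (by omega) hw T hT j k ε fun θ hθ => (hjk θ hθ).1
  have hR : ∀ θ θ', ∃ R, θ ∈ T → θ' ∈ T → θ ≠ θ' →
      ∀ z ∈ logStrip p θ c, z ∈ logStrip p θ' c → ‖z‖ < R := by
    intro θ θ'
    by_cases hcon : θ ∈ T ∧ θ' ∈ T ∧ θ ≠ θ'
    · obtain ⟨R, hR⟩ := exists_logStrip_inter_subset hp1 hc (θ := θ) (θ' := θ') fun he =>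
        hcon.2.2 (exp_mul_I_injOn ((hT θ).1 hcon.1).2 ((hT θ').1 hcon.2.1).2 he)
      exact ⟨R, fun _ _ _ => hR⟩
    · exact ⟨0, fun h1 h2 h3 => absurd ⟨h1, h2, h3⟩ hcon⟩
  choose R hR using hR
  -- Beyond radius R₀ the finitely many strips are pairwise disjoint, so adding their counts can
  -- exceed the total by at most `N` zeros per strip.
  set R₀ := ∑ θ ∈ T, ∑ θ' ∈ T, |R θ θ'| with hR₀
  have hRle : ∀ θ ∈ T, ∀ θ' ∈ T, R θ θ' ≤ R₀ := by
    intro θ hθ θ' hθ'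
    have h1 : |R θ θ'| ≤ ∑ θ' ∈ T, |R θ θ'| :=
      Finset.single_le_sum (f := fun θ' => |R θ θ'|) (fun _ _ => abs_nonneg _) hθ'
    have h2 : ∑ θ' ∈ T, |R θ θ'| ≤ R₀ := Finset.single_le_sum (f := fun θ => ∑ θ' ∈ T, |R θ θ'|)
      (fun _ _ => Finset.sum_nonneg fun _ _ => abs_nonneg _) hθ
    exact (le_abs_self _).trans (h1.trans h2)
  set N := zerosIn f (Metric.ball 0 R₀) with hN
  refine ⟨∑ θ ∈ T, |K θ| + 2 * |Ko| + T.card * N, ?_⟩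
  have hall : ∀ᶠ r : ℝ in atTop, ∀ θ ∈ T, |(zeroCount f (logStrip p θ c) r : ℝ) -
      ‖w (j θ) - w (k θ)‖ * r ^ q / (2 * Real.pi)| ≤ K θ * (r ^ d * Real.log r ^ 2) :=
    (eventually_all_finset T).2 fun θ hθ => (hjk θ hθ).2
  filter_upwards [hall, hKo, eventually_ge_atTop (Real.exp 1)] with r hr hro hr1
  have hr0 : 1 ≤ r := (Real.one_le_exp zero_le_one).trans hr1
  have hlog : 1 ≤ Real.log r := by
    rwa [Real.le_log_iff_exp_le (by linarith)]
  have hrd : 1 ≤ r ^ d := one_le_pow₀ hr0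
  have hball : Bornology.IsBounded (Metric.ball (0 : ℂ) r) := Metric.isBounded_ball
  have hbT : ∀ θ ∈ T, Bornology.IsBounded (logStrip p θ c ∩ Metric.ball 0 r) := fun θ _ =>
    hball.subset inter_subset_right
  have hbU : Bornology.IsBounded (⋃ θ ∈ T, logStrip p θ c ∩ Metric.ball 0 r) :=
    hball.subset (iUnion₂_subset fun θ _ => inter_subset_right)
  have hcover : ∀ θ, IsCriticalAngle q (range w) θ → ∃ θ' ∈ T, logStrip p θ c = logStrip p θ' c := by
    intro θ hθ
    obtain ⟨n, hn⟩ := exists_int_add_mem_Ico θ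
    exact ⟨_, (hT _).2 ⟨hθ.add_two_pi n, hn⟩, (logStrip_add_two_pi p θ c n).symm⟩
  have hupper : zeroCount f univ r ≤ ∑ θ ∈ T, zeroCount f (logStrip p θ c) r +
      zeroCount f (⋃ θ ∈ {θ : ℝ | IsCriticalAngle q (range w) θ}, logStrip p θ c)ᶜ r := by
    refine (zerosIn_mono hf h0 (B := (⋃ θ ∈ T, logStrip p θ c ∩ Metric.ball 0 r) ∪
      ((⋃ θ ∈ {θ : ℝ | IsCriticalAngle q (range w) θ}, logStrip p θ c)ᶜ ∩ Metric.ball 0 r))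
      (hbU.union (hball.subset inter_subset_right)) ?_).trans
      ((zerosIn_union_le hf h0 hbU (hball.subset inter_subset_right)).trans
        (Nat.add_le_add_right (zerosIn_biUnion_le hf h0 T _ hbT) _))
    rintro z ⟨-, hz⟩ -
    by_cases hzU : z ∈ ⋃ θ ∈ {θ : ℝ | IsCriticalAngle q (range w) θ}, logStrip p θ c
    · left
      obtain ⟨θ, hθ, hzθ⟩ := mem_iUnion₂.1 hzU
      obtain ⟨θ', hθ', he⟩ := hcover θ hθ
      exact mem_iUnion₂.2 ⟨θ', hθ', he ▸ hzθ, hz⟩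
    · exact Or.inr ⟨hzU, hz⟩
  have hlower : ∑ θ ∈ T, zeroCount f (logStrip p θ c) r ≤ zeroCount f univ r + T.card * N := by
    set A : ℝ → Set ℂ := fun θ => (logStrip p θ c ∩ Metric.ball 0 r) \ Metric.ball 0 R₀ with hA
    have hbA : ∀ θ, Bornology.IsBounded (A θ) := fun θ =>
      hball.subset (sdiff_subset.trans inter_subset_right)
    have h1 : ∀ θ ∈ T, zeroCount f (logStrip p θ c) r ≤ zerosIn f (A θ) + N := by
      intro θ hθ
      refine (zerosIn_mono hf h0 ((hbA θ).union Metric.isBounded_ball) ?_).trans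
        (zerosIn_union_le hf h0 (hbA θ) Metric.isBounded_ball)
      intro z hz _
      by_cases hzR : z ∈ Metric.ball 0 R₀
      · exact Or.inr hzR
      · exact Or.inl ⟨hz, hzR⟩
    have h2 : zerosIn f (⋃ θ ∈ T, A θ) = ∑ θ ∈ T, zerosIn f (A θ) := by
      refine zerosIn_biUnion_disjoint hf h0 T A (fun θ _ => hbA θ) ?_
      intro θ hθ θ' hθ' hne
      rw [Function.onFun, Set.disjoint_left]
      rintro z ⟨⟨hz, -⟩, hzR⟩ ⟨⟨hz', -⟩, -⟩
      refine hzR (mem_ball_zero_iff.2 ?_)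
      exact (hR θ θ' hθ hθ' hne z hz hz').trans_le (hRle θ hθ θ' hθ')
    have h3 : zerosIn f (⋃ θ ∈ T, A θ) ≤ zeroCount f univ r := by
      refine zerosIn_mono hf h0 (hball.subset inter_subset_right) ?_
      intro z hz _
      obtain ⟨θ, -, hzθ⟩ := mem_iUnion₂.1 hz
      exact ⟨mem_univ z, hzθ.1.2⟩
    calc ∑ θ ∈ T, zeroCount f (logStrip p θ c) r ≤ ∑ θ ∈ T, (zerosIn f (A θ) + N) :=
          Finset.sum_le_sum h1
      _ = zerosIn f (⋃ θ ∈ T, A θ) + T.card * N := by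
          rw [Finset.sum_add_distrib, h2, Finset.sum_const, smul_eq_mul]
      _ ≤ _ := Nat.add_le_add_right h3 _
  have hup := (Nat.cast_le (α := ℝ)).2 hupper
  have hlo := (Nat.cast_le (α := ℝ)).2 hlower
  push_cast at hup hlo
  set M := r ^ d * Real.log r ^ 2 with hM
  have hlog2 : Real.log r ≤ Real.log r ^ 2 := by nlinarith
  have hM1 : 1 ≤ M := one_le_mul_of_one_le_of_one_le hrd (one_le_pow₀ hlog)
  have hmain : |∑ θ ∈ T, (zeroCount f (logStrip p θ c) r : ℝ) -
      q * circumference (range fun j => (starRingEnd ℂ) (w j)) * r ^ q / (2 * Real.pi)| ≤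
      (∑ θ ∈ T, |K θ|) * M := by
    rw [← hsum, Finset.sum_mul, Finset.sum_div, ← Finset.sum_sub_distrib, Finset.sum_mul]
    refine (Finset.abs_sum_le_sum_abs _ _).trans (Finset.sum_le_sum fun θ hθ => ?_)
    refine (hr θ hθ).trans ?_
    gcongr
    exact le_abs_self _
  have hout' : (zeroCount f (⋃ θ ∈ {θ : ℝ | IsCriticalAngle q (range w) θ},
      logStrip p θ c)ᶜ r : ℝ) ≤ 2 * |Ko| * M := by
    refine hro.trans ?_
    have h1 : r ^ d + Real.log r ≤ 2 * M := by
      have h2 : r ^ d ≤ M := le_mul_of_one_le_right (by linarith) (one_le_pow₀ hlog)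
      have h3 : Real.log r ≤ M := hlog2.trans (le_mul_of_one_le_left (by positivity) hrd)
      linarith
    calc Ko * (r ^ d + Real.log r) ≤ |Ko| * (r ^ d + Real.log r) := by
          gcongr
          exact le_abs_self _
      _ ≤ |Ko| * (2 * M) := by gcongr
      _ = _ := by ring
  have hN' : (T.card * N : ℝ) ≤ T.card * N * M := le_mul_of_one_le_right (by positivity) hM1
  have hKo0 : 0 ≤ 2 * |Ko| * M := by positivity
  have hTN0 : 0 ≤ (T.card * N : ℝ) * M := by positivity
  rw [abs_le] at hmain ⊢
  rw [add_mul, add_mul]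
  constructor <;> linarith

end


/-! ### Asymptotics, a-points and Borel directions -/

lemma isBigO_log_rpow {d : ℕ} {a : ℝ → ℝ} {ε : ℝ} (hε : 0 < ε)
    (h : ∃ K, ∀ᶠ r : ℝ in atTop, |a r| ≤ K * (r ^ d * Real.log r ^ 2)) :
    a =O[atTop] fun r : ℝ => r ^ d * Real.log r ^ (3 + ε) := by
  obtain ⟨K, hK⟩ := h
  refine IsBigO.of_bound |K| ?_
  filter_upwards [hK, eventually_ge_atTop (Real.exp 1)] with r hr hr1
  have hr0 : 0 < r := (Real.exp_pos 1).trans_le hr1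
  have hlog : 1 ≤ Real.log r := by rwa [Real.le_log_iff_exp_le hr0]
  -- The proved error has only log² r, which is below log^{3+ε} r once log r ≥ 1.
  have h1 : Real.log r ^ 2 ≤ Real.log r ^ (3 + ε) := by
    rw [← Real.rpow_natCast]
    exact Real.rpow_le_rpow_of_exponent_le hlog (by push_cast; linarith)
  have h2 : 0 ≤ Real.log r ^ (3 + ε) := Real.rpow_nonneg (by linarith) _
  rw [Real.norm_eq_abs, Real.norm_eq_abs, abs_of_nonneg (a := r ^ d * _) (by positivity)]
  refine hr.trans ?_
  calc K * (r ^ d * Real.log r ^ 2) ≤ |K| * (r ^ d * Real.log r ^ 2) := by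
        gcongr
        exact le_abs_self _
    _ ≤ _ := by gcongr

/-- Because p ≥ 1, the error terms are of lower order than r^q, so a strip around a critical ray
really contains a number of zeros of order r^q. -/
lemma isLittleO_pow_mul_log_sq {p d q : ℕ} (hp1 : 1 ≤ p) (hq : q = p + d) :
    (fun r : ℝ => r ^ d * Real.log r ^ 2) =o[atTop] fun r : ℝ => r ^ q := by
  have h1 : (fun r : ℝ => Real.log r ^ 2) =o[atTop] fun r : ℝ => r ^ p := by
    have := isLittleO_log_rpow_rpow_atTop (s := p) 2 (by exact_mod_cast hp1)
    refine this.congr' ?_ ?_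
    · exact Eventually.of_forall fun r => by norm_cast
    · exact Eventually.of_forall fun r => by norm_cast
  refine ((isBigO_refl (fun r : ℝ => r ^ d) atTop).mul_isLittleO h1).congr (fun _ => rfl) fun r => ?_
  rw [hq, pow_add, mul_comm]

lemma IsExpPolyOfOrderLE.const (d : ℕ) (a : ℂ) : IsExpPolyOfOrderLE d fun _ => a :=
  ⟨1, fun _ => Polynomial.C a, fun _ => 0, by simp, by simp⟩

lemma IsExpPolyOfOrderLE.sub_const {d : ℕ} {g : ℂ → ℂ} (hg : IsExpPolyOfOrderLE d g) (a : ℂ) :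
    IsExpPolyOfOrderLE d fun z => g z - a := by
  obtain ⟨n, P, Q, hQ, hgz⟩ := hg
  refine ⟨n + 1, Fin.cons (Polynomial.C (-a)) P, Fin.cons 0 Q, ?_, fun z => ?_⟩
  · intro j
    refine Fin.cases ?_ (fun i => ?_) j
    · simp
    · simpa using hQ i
  · rw [Fin.sum_univ_succ]
    simp only [hgz]
    simp
    ring

/-- The functions `f - a` are of the same form, with `0` adjoined to the exponents. -/
lemma exists_normalSum_sub_const {ι : Type} [Fintype ι] {d q : ℕ} {w : ι → ℂ} {H : ι → ℂ → ℂ}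
    (hw : Function.Injective w) (hH : ∀ v, IsExpPolyOfOrderLE d (H v)) (hH0 : ∀ v, H v ≠ 0) :
    ∃ (ι' : Type) (_ : Fintype ι') (_ : Nonempty ι') (w' : ι' → ℂ) (a₀ : ℂ),
      Function.Injective w' ∧ range w' = insert 0 (range w) ∧
      ∀ a, a ≠ a₀ → ∃ H' : ι' → ℂ → ℂ, (∀ v, IsExpPolyOfOrderLE d (H' v)) ∧ (∀ v, H' v ≠ 0) ∧
        (fun z => normalSum q w H z - a) = normalSum q w' H' := by
  classical
  by_cases h0 : (0 : ℂ) ∈ range w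
  · obtain ⟨j₀, hj₀⟩ := h0
    -- The constant is subtracted from the coefficient H_{j₀} of the exponent 0. That coefficient
    -- can become identically zero only for a = H_{j₀}(0), which is taken as the excluded value.
    refine ⟨ι, inferInstance, ⟨j₀⟩, w, H j₀ 0, hw, ?_, fun a ha => ?_⟩
    · rw [insert_eq_of_mem]
      exact ⟨j₀, hj₀⟩
    refine ⟨Function.update H j₀ fun z => H j₀ z - a, fun v => ?_, fun v => ?_, ?_⟩
    · rcases eq_or_ne v j₀ with rfl | hv
      · rw [Function.update_self]
        exact (hH v).sub_const a
      · rw [Function.update_of_ne hv]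
        exact hH v
    · rcases eq_or_ne v j₀ with rfl | hv
      · rw [Function.update_self]
        intro hcon
        have := congrFun hcon 0
        exact ha (sub_eq_zero.1 this).symm
      · rw [Function.update_of_ne hv]
        exact hH0 v
    · funext z
      simp only [normalSum]
      rw [← Finset.add_sum_erase Finset.univ _ (Finset.mem_univ j₀),
        ← Finset.add_sum_erase Finset.univ
          (fun v => Function.update H j₀ (fun z => H j₀ z - a) v z * exp (w v * z ^ q))
          (Finset.mem_univ j₀),
        Function.update_self, hj₀, Finset.sum_congr rfl (s₁ := Finset.univ.erase j₀)
        (g := fun v => Function.update H j₀ (fun z => H j₀ z - a) v z * exp (w v * z ^ q))]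
      · simp
        ring
      · intro v hv
        rw [Function.update_of_ne (Finset.ne_of_mem_erase hv)]
  -- Here 0 is a new exponent with constant coefficient -a, so only a = 0 has to be excluded.
  · refine ⟨Option ι, inferInstance, inferInstance, fun v => v.elim 0 w, 0, ?_, ?_, fun a ha => ?_⟩
    · rintro (_ | x) (_ | y) hxy
      · rfl
      · exact absurd ⟨y, hxy.symm⟩ h0
      · exact absurd ⟨x, hxy⟩ h0
      · exact congrArg some (hw hxy)
    · ext z
      simp only [mem_range, Option.exists, Option.elim, mem_insert_iff]
      rw [eq_comm]
    refine ⟨fun v => v.elim (fun _ => -a) H, ?_, ?_, ?_⟩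
    · rintro (_ | v)
      · exact IsExpPolyOfOrderLE.const d (-a)
      · exact hH v
    · rintro (_ | v)
      · intro hcon
        exact ha (neg_eq_zero.1 (congrFun hcon 0))
      · exact hH0 v
    · funext z
      simp only [normalSum, Fintype.sum_option, Option.elim]
      simp
      ring

lemma tendsto_log_div_log {q : ℕ} {n : ℝ → ℝ} {A B : ℝ} (hA : 0 < A)
    (h : ∀ᶠ r : ℝ in atTop, A * r ^ q ≤ n r ∧ n r ≤ B * r ^ q) :
    Tendsto (fun r => Real.log (n r) / Real.log r) atTop (𝓝 q) := by
  have hlim : ∀ c : ℝ, Tendsto (fun r => c / Real.log r + q) atTop (𝓝 (q : ℝ)) := by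
    intro c
    simpa using (Tendsto.const_div_atTop Real.tendsto_log_atTop c).add_const (q : ℝ)
  refine tendsto_of_tendsto_of_tendsto_of_le_of_le' (hlim (Real.log A)) (hlim (Real.log B)) ?_ ?_
  · filter_upwards [h, eventually_gt_atTop 1] with r hr hr1
    have hlog := Real.log_pos hr1
    have hr0 : 0 < r := by linarith
    have h1 := Real.log_le_log (by positivity) hr.1
    rw [Real.log_mul hA.ne' (by positivity), Real.log_pow] at h1
    rw [le_div_iff₀ hlog, add_mul, div_mul_cancel₀ _ hlog.ne']
    exact h1
  · filter_upwards [h, eventually_gt_atTop 1] with r hr hr1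
    have hlog := Real.log_pos hr1
    have hr0 : 0 < r := by linarith
    have hAr : 0 < A * r ^ q := by positivity
    have hB : 0 < B := by
      have : 0 < B * r ^ q := hAr.trans_le (hr.1.trans hr.2)
      exact pos_of_mul_pos_left this (by positivity)
    have h1 := Real.log_le_log (hAr.trans_le hr.1) hr.2
    rw [Real.log_mul hB.ne' (by positivity), Real.log_pow] at h1
    rw [div_le_iff₀ hlog, add_mul, div_mul_cancel₀ _ hlog.ne']
    exact h1

/-- The extra 1/2 absorbs the constant K and, for d = 0, the logarithm, yet stays below q ≥ d + 1.
When there are no zeros the quotient is 0, since `Real.log 0 = 0`. -/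
lemma eventually_log_div_log_le {d : ℕ} {n : ℝ → ℕ} {K : ℝ}
    (h : ∀ᶠ r : ℝ in atTop, (n r : ℝ) ≤ K * (r ^ d + Real.log r)) :
    ∀ᶠ r : ℝ in atTop, Real.log (n r) / Real.log r ≤ d + 1 / 2 := by
  have ho : (fun r : ℝ => K * (r ^ d + Real.log r)) =o[atTop] fun r : ℝ => r ^ ((d : ℝ) + 1 / 2) := by
    refine IsLittleO.const_mul_left (IsLittleO.add ?_ ?_) K
    · have h1 : (fun _ : ℝ => (1 : ℝ)) =o[atTop] fun r : ℝ => r ^ (1 / 2 : ℝ) :=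
        isLittleO_const_left.2 (Or.inr (tendsto_norm_atTop_atTop.comp
          (tendsto_rpow_atTop (by norm_num))))
      refine ((isBigO_refl (fun r : ℝ => r ^ d) atTop).mul_isLittleO h1).congr'
        (Eventually.of_forall fun r => mul_one _) ?_
      filter_upwards [eventually_gt_atTop 0] with r hr
      rw [Real.rpow_add hr, Real.rpow_natCast]
    · exact isLittleO_log_rpow_atTop (by positivity)
  have hb := ho.bound one_pos
  filter_upwards [h, hb, eventually_gt_atTop 1] with r hr hr' hr1
  have hlog := Real.log_pos hr1
  have hr0 : 0 < r := by linarith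
  rw [div_le_iff₀ hlog]
  rcases Nat.eq_zero_or_pos (n r) with h0 | h0
  · rw [h0, Nat.cast_zero, Real.log_zero]
    positivity
  · rw [one_mul, Real.norm_eq_abs, Real.norm_eq_abs, abs_of_nonneg (Real.rpow_nonneg hr0.le _)] at hr'
    have h1 := Real.log_le_log (by exact_mod_cast h0) (hr.trans ((le_abs_self _).trans hr'))
    rwa [Real.log_rpow hr0] at h1

section

variable {ι : Type} [Fintype ι] [Nonempty ι] {p d q : ℕ} {w : ι → ℂ} {H : ι → ℂ → ℂ}

/-- Zeros in an angle around a critical ray. -/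
lemma exists_zeroCount_openAngle_bounds (hp1 : 1 ≤ p) (hq : q = p + d) (hw : Function.Injective w)
    (hH : ∀ v, IsExpPolyOfOrderLE d (H v)) (hH0 : ∀ v, H v ≠ 0) {θ ε : ℝ}
    (hθ : IsCriticalAngle q (range w) θ) (hε : 0 < ε) :
    ∃ A B : ℝ, 0 < A ∧ ∀ᶠ r : ℝ in atTop,
      A * r ^ q ≤ zeroCount (normalSum q w H) (openAngle θ ε) r ∧
      (zeroCount (normalSum q w H) (openAngle θ ε) r : ℝ) ≤ B * r ^ q := by
  have hf := differentiable_normalSum (q := q) (w := w) hH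
  have h0 := normalSum_ne_zero hp1 hq hw hH hH0
  obtain ⟨-, c, hc, -, hin⟩ := exists_zeroCount_bounds hp1 hq hw hH hH0
  obtain ⟨K, hK⟩ := exists_zeroCount_univ hp1 hq hw hH hH0
  obtain ⟨j, k, -, hjk, -, -, -, hcnt⟩ := hin θ hθ
  obtain ⟨K', hK'⟩ := hcnt c le_rfl
  obtain ⟨R, hR⟩ := eventually_mem_of_mem_logStrip hp1 hc hε
  set f := normalSum q w H
  set D := ‖w j - w k‖ / (2 * Real.pi) with hD
  have hD0 : 0 < D := div_pos (norm_pos_iff.2 (sub_ne_zero.2 fun h => hjk (hw h))) Real.two_pi_pos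
  set L := q * circumference (range fun j => (starRingEnd ℂ) (w j)) / (2 * Real.pi) with hL
  set N := zerosIn f (Metric.ball 0 R) with hN
  have ho := isLittleO_pow_mul_log_sq hp1 hq
  have h1 := (ho.const_mul_left K').bound (show 0 < D / 4 by positivity)
  have h2 := (ho.const_mul_left K).bound one_pos
  have h3 : ∀ᶠ r : ℝ in atTop, (N : ℝ) ≤ D / 4 * r ^ q := by
    have : Tendsto (fun r : ℝ => D / 4 * r ^ q) atTop atTop :=
      (tendsto_pow_atTop (by omega)).const_mul_atTop (by positivity)
    exact this.eventually_ge_atTop _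
  refine ⟨D / 2, L + 1, by positivity, ?_⟩
  filter_upwards [h1, h2, h3, hK, hK', eventually_ge_atTop 1] with r h1 h2 h3 h4 h5 hr1
  have hr0 : 0 ≤ r ^ q := by positivity
  have hball : Bornology.IsBounded (Metric.ball (0 : ℂ) r) := Metric.isBounded_ball
  rw [Real.norm_eq_abs, Real.norm_eq_abs, abs_of_nonneg hr0] at h1 h2
  rw [show ‖w j - w k‖ * r ^ q / (2 * Real.pi) = D * r ^ q by rw [hD]; ring] at h5
  rw [show ∀ x : ℝ, q * x * r ^ q / (2 * Real.pi) = q * x / (2 * Real.pi) * r ^ q by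
    intro x; ring] at h4
  have hup : zeroCount f (openAngle θ ε) r ≤ zeroCount f univ r :=
    zerosIn_mono hf h0 (hball.subset inter_subset_right) fun z hz _ => ⟨mem_univ z, hz.2⟩
  have hlo : zeroCount f (logStrip p θ c) r ≤ zeroCount f (openAngle θ ε) r + N := by
    refine (zerosIn_mono hf h0 ((hball.subset inter_subset_right).union Metric.isBounded_ball)
      ?_).trans (zerosIn_union_le hf h0 (hball.subset inter_subset_right) Metric.isBounded_ball)
    rintro z ⟨hz, hzr⟩ -
    by_cases hzR : ‖z‖ < R
    · exact Or.inr (by simpa using hzR)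
    · left
      rw [openAngle_eq_image]
      obtain ⟨s, hs, hsθ⟩ := hR θ z hz (not_lt.1 hzR)
      exact ⟨⟨s, hsθ, hs⟩, hzr⟩
  have hup' := (Nat.cast_le (α := ℝ)).2 hup
  have hlo' := (Nat.cast_le (α := ℝ)).2 hlo
  push_cast at hlo'
  have h1' := (le_abs_self _).trans h1
  have h2' := (le_abs_self _).trans h2
  rw [abs_le] at h4 h5
  rw [add_mul]
  constructor <;> linarith

end

section

variable {ι : Type} [Fintype ι] {p d q : ℕ} {w : ι → ℂ} {H : ι → ℂ → ℂ}

/-- The Borel directions of maximal order. -/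
theorem isBorelDirection_iff (hp1 : 1 ≤ p) (hq : q = p + d) (hw : Function.Injective w)
    (hH : ∀ v, IsExpPolyOfOrderLE d (H v)) (hH0 : ∀ v, H v ≠ 0) (θ : ℝ) :
    IsBorelDirection (normalSum q w H) q θ ↔ IsCriticalAngle q (insert 0 (range w)) θ := by
  obtain ⟨ι', _, _, w', a₀, hw', hrange, hsub⟩ := exists_normalSum_sub_const (q := q) hw hH hH0
  rw [← hrange]
  constructor
  · intro hB
    by_contra hθ
    obtain ⟨j, δ, ε, hδ, hε, hε1, hdom⟩ := exists_dominant_of_not_critical hw' hθ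
    have hsubset : (fun a : ℂ => (some a : OnePoint ℂ)) '' {a₀}ᶜ ⊆ {a : OnePoint ℂ |
        ¬ limsup (fun r : ℝ => ((Real.log (pointCount (normalSum q w H) (openAngle θ (ε / 2)) r a) /
          Real.log r : ℝ) : EReal)) atTop = ((q : ℝ) : EReal)} := by
      rintro _ ⟨a, ha, rfl⟩
      obtain ⟨H', hH', hH0', heq⟩ := hsub a ha
      obtain ⟨K, hK⟩ := exists_zeroCount_sector_le hp1 hq hw' hH' hH0' hδ hε hε1 hdom
      rw [← heq] at hK
      have hle := eventually_log_div_log_le hK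
      show ¬ limsup (fun r : ℝ => ((Real.log (zeroCount (fun z => normalSum q w H z - a)
        (openAngle θ (ε / 2)) r) / Real.log r : ℝ) : EReal)) atTop = ((q : ℝ) : EReal)
      have hlim : limsup (fun r : ℝ => ((Real.log (zeroCount (fun z => normalSum q w H z - a)
          (openAngle θ (ε / 2)) r) / Real.log r : ℝ) : EReal)) atTop ≤
          (((d : ℝ) + 1 / 2 : ℝ) : EReal) :=
        limsup_le_of_le (h := hle.mono fun r hr => EReal.coe_le_coe_iff.2 hr)
      intro hcon
      rw [hcon, EReal.coe_le_coe_iff, hq] at hlim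
      have hp' : (1 : ℝ) ≤ p := by exact_mod_cast hp1
      push_cast at hlim
      linarith
    -- Every finite value other than a₀ is exceptional, and these are infinitely many.
    have hinf : ({a₀}ᶜ : Set ℂ).Infinite := (finite_singleton a₀).infinite_compl
    have hinf' := hinf.image (f := fun a : ℂ => (some a : OnePoint ℂ))
      fun x _ y _ h => Option.some_injective _ h
    have hle := (encard_le_encard hsubset).trans (hB (ε / 2) (by positivity))
    rw [hinf'.encard_eq] at hle
    exact absurd hle (by simp)
  · intro hθ ε hε
    -- The only possible exceptions are ∞, which is never attained, and a₀.
    refine (encard_le_encard (t := {none, some a₀}) ?_).trans ?_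
    swap
    · exact (encard_insert_le _ _).trans (by rw [encard_singleton]; norm_num)
    rintro (_ | a) ha
    · exact Or.inl rfl
    by_contra hne
    have haa : a ≠ a₀ := fun h => hne (Or.inr (by rw [h]; rfl))
    refine ha ?_
    obtain ⟨H', hH', hH0', heq⟩ := hsub a haa
    obtain ⟨A, B, hA, hAB⟩ := exists_zeroCount_openAngle_bounds hp1 hq hw' hH' hH0' hθ hε
    rw [← heq] at hAB
    have htend := tendsto_log_div_log hA hAB
    exact ((continuous_coe_real_ereal.tendsto _).comp htend).limsup_eq

/-- If 0 lies in the hull, the support function is nonnegative, so adjoining 0 never raises the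
maximum. If 0 ties with some b ≠ 0 and no other exponent does, b would be the unique maximiser on
the hull, and 0, attaining the same value, would have to coincide with it. -/
lemma isCriticalAngle_insert_zero_iff {W : Set ℂ}
    (h0 : (0 : ℂ) ∈ convexHull ℝ ((starRingEnd ℂ) '' W)) (θ : ℝ) :
    IsCriticalAngle q (insert 0 W) θ ↔ IsCriticalAngle q W θ := by
  have hnonneg : ∀ M, (∀ v ∈ W, (v * exp (q * θ * I)).re ≤ M) → 0 ≤ M := by
    intro M hM
    have := re_conj_mul_le_of_mem_convexHull (u := exp (q * θ * I)) (M := M) (by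
      rintro _ ⟨v, hv, rfl⟩
      simpa only [conj_conj] using hM v hv) h0
    simpa using this
  have hzero : ∀ b ∈ W, b ≠ 0 → (b * exp (q * θ * I)).re = 0 →
      (∀ v ∈ W, (v * exp (q * θ * I)).re ≤ 0) → IsCriticalAngle q W θ := by
    intro b hb hb0 hbre hle
    by_contra hcon
    have hlt : ∀ v ∈ W, v ≠ b → (v * exp (q * θ * I)).re < 0 := by
      intro v hv hvb
      refine lt_of_le_of_ne (hle v hv) fun h => hcon ?_
      exact ⟨b, hb, v, hv, hvb.symm, by rw [hbre, h], by rw [hbre]; exact hle⟩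
    have := eq_or_re_conj_mul_lt_of_mem_convexHull (u := exp (q * θ * I))
      (a := (starRingEnd ℂ) b) (by
        rintro _ ⟨v, hv, rfl⟩
        by_cases hvb : v = b
        · exact Or.inl (by rw [hvb])
        · right
          rw [conj_conj, conj_conj, hbre]
          exact hlt v hv hvb) h0
    rcases this with h | h
    · exact hb0 ((map_eq_zero _).1 h.symm)
    · rw [conj_conj, hbre] at h
      simp at h
  constructor
  · rintro ⟨a, ha, b, hb, hne, heq, hmax⟩
    rcases ha with rfl | ha
    · rcases hb with rfl | hb
      · exact absurd rfl hne
      · rw [zero_mul, zero_re] at heq hmax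
        exact hzero b hb hne.symm heq.symm fun v hv => hmax v (Or.inr hv)
    · rcases hb with rfl | hb
      · rw [zero_mul, zero_re] at heq
        rw [heq] at hmax
        exact hzero a ha hne heq fun v hv => hmax v (Or.inr hv)
      · exact ⟨a, ha, b, hb, hne, heq, fun v hv => hmax v (Or.inr hv)⟩
  · rintro ⟨a, ha, b, hb, hne, heq, hmax⟩
    refine ⟨a, Or.inr ha, b, Or.inr hb, hne, heq, ?_⟩
    rintro v (rfl | hv)
    · rw [zero_mul, zero_re]
      exact hnonneg _ hmax
    · exact hmax v hv

end

end

/-! ### Assembling the statements -/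

theorem theorem2p1 (p q : ℕ) (hp : 1 ≤ p) (hpq : p ≤ q) (m : ℕ)
    (w : Fin (m + 1) → ℂ) (hw : Function.Injective w)
    (H : Fin (m + 1) → ℂ → ℂ) (hH : ∀ j, IsExpPolyOfOrderLE (q - p) (H j))
    (hH0 : ∀ j, H j ≠ 0)
    (f : ℂ → ℂ) (hf : f = normalForm q w H) :
    (∃ c₀ : ℝ, 0 < c₀ ∧ ∀ c : ℝ, c₀ ≤ c →
      -- the zeros outside the strips
      ((fun r : ℝ =>
          (zeroCount f (⋃ θ ∈ {θ : ℝ | IsCriticalAngle q (range w) θ}, logStrip p θ c)ᶜ r : ℝ))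
        =O[atTop] fun r : ℝ => r ^ (q - p) + Real.log r) ∧
      -- the zeros in each strip attached to a side of the polygon
      ∀ j k : Fin (m + 1),
        IsSide (conjLeading w) ((starRingEnd ℂ) (w j)) ((starRingEnd ℂ) (w k)) →
        ∀ φ : ℝ, IsOuterNormalArg ((starRingEnd ℂ) (w j)) ((starRingEnd ℂ) (w k)) φ →
        ∀ (n : ℤ) (θ : ℝ), θ = (φ + 2 * Real.pi * n) / q →
        ∀ ε : ℝ, 0 < ε →
          (fun r : ℝ => (zeroCount f (logStrip p θ c) r : ℝ)
              - ‖w j - w k‖ * r ^ q / (2 * Real.pi))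
            =O[atTop] fun r : ℝ => r ^ (q - p) * Real.log r ^ (3 + ε)) ∧
    -- all zeros
    (∀ ε : ℝ, 0 < ε →
      (fun r : ℝ => (zeroCount f univ r : ℝ)
          - q * circumference (conjLeading w) * r ^ q / (2 * Real.pi))
        =O[atTop] fun r : ℝ => r ^ (q - p) * Real.log r ^ (3 + ε)) ∧
    -- the Borel directions
    (∀ θ : ℝ, IsBorelDirection f q θ ↔ IsCriticalAngle q (insert 0 (range w)) θ) ∧
    ((0 : ℂ) ∈ convexHull ℝ (conjLeading w) →
      ∀ θ : ℝ, IsBorelDirection f q θ ↔ IsCriticalAngle q (range w) θ) := by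
  have hq : q = p + (q - p) := by omega
  have hfs : f = normalSum q w H := hf
  have hconj : conjLeading w = range fun j => (starRingEnd ℂ) (w j) := rfl
  rw [hfs, hconj]
  obtain ⟨-, c₀, hc₀, hout, hin⟩ := exists_zeroCount_bounds hp hq hw hH hH0
  refine ⟨⟨c₀, hc₀, fun c hc => ⟨?_, ?_⟩⟩, ?_, isBorelDirection_iff hp hq hw hH hH0, ?_⟩
  · obtain ⟨K, hK⟩ := hout c hc
    refine IsBigO.of_bound |K| ?_
    filter_upwards [hK, eventually_ge_atTop 1] with r hr hr1
    have hlog := Real.log_nonneg hr1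
    have h1 : 0 ≤ r ^ (q - p) + Real.log r := by positivity
    rw [Real.norm_eq_abs, Real.norm_eq_abs, abs_of_nonneg (Nat.cast_nonneg _), abs_of_nonneg h1]
    refine hr.trans ?_
    gcongr
    exact le_abs_self _
  · intro j k hs φ hφ n θ hθ ε hε
    have hq0 : (q : ℝ) ≠ 0 := by
      have : q ≠ 0 := by omega
      exact_mod_cast this
    -- So qθ is another argument of the same outer normal, whatever n is.
    have hqθ : q * θ = φ + 2 * Real.pi * n := by
      rw [hθ]
      field_simp
    have hexp : exp ((q * θ : ℝ) * I) = exp (φ * I) :=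
      exp_eq_exp_iff_exists_int.2 ⟨n, by rw [hqθ]; push_cast; ring⟩
    have hn : IsOuterNormalArg ((starRingEnd ℂ) (w j)) ((starRingEnd ℂ) (w k)) (q * θ) := by
      unfold IsOuterNormalArg at hφ ⊢
      rw [hexp]
      exact hφ
    obtain ⟨hcrit, huniq⟩ := isCriticalAngle_of_isSide hs hn
    obtain ⟨j', k', ε', -, hpair, hj, hk, hcnt⟩ := hin θ hcrit
    -- The dominating pair found at θ consists of the end points of the given side, so its strip
    -- count carries the right leading coefficient.
    obtain ⟨rfl, rfl⟩ := huniq j' k' hj hk hpair.max_left hpair.max_right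
    exact isBigO_log_rpow hε (hcnt c hc)
  · intro ε hε
    exact isBigO_log_rpow hε (exists_zeroCount_univ hp hq hw hH hH0)
  · intro h0 θ
    rw [isBorelDirection_iff hp hq hw hH hH0]
    refine isCriticalAngle_insert_zero_iff ?_ θ
    rwa [← range_comp]
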